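/- **Theorem 1 (Equivalent model).** Let $\sigma_1,\sigma_2,\sigma_3$ be the Pauli matrices and $t_a=\sigma_a/2$. For $x^{(1)},x^{(2)}\in\mathbb{R}^3$ put $\mathfrak X^{(i)}=\sum_a x^{(i)}_a t_a$ and $\mathfrak P^{(i)}=\sum_a p^{(i)}_a t_a^*$, where $p^{(i)}_a=-\mathrm i\,\partial/\partial x^{(i)}_a$ and $t_a^*$ is the entrywise complex conjugate, and let $$H=\operatorname{Tr}\Bigl[\tfrac12\sum_{i=1}^2\mathfrak P^{(i)}\mathfrak P^{(i)}-\tfrac14\sum_{i,j=1}^2[\mathfrak X^{(i)},\mathfrak X^{(j)}]^2\Bigr]$$ be the Hamiltonian of the $d=2$, $N=2$ bosonic matrix model. Then: 1. As differential expressions, $4H=(p^{(1)})^2+(p^{(2)})^2+(x^{(1)}\times x^{(2)})^2$. 2. Let $H$ also denote the Friedrichs extension in $L^2(\mathbb{R}^6)$ of this expression on $C_c^\infty(\mathbb{R}^6)$. Let $\mathcal S\subset L^2(\mathbb{R}^6)$ be the space of $SU(2)$ singlets, i.e. of all $\psi$ invariant under $\mathfrak X^{(i)}\mapsto g\,\mathfrak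 X^{(i)}g^{-1}$ ($i=1,2$) for every $g\in SU(2)$. On $\mathcal H=L^2(\mathbb{R}^+)\otimes L^2(\mathbb{R}^+)\otimes\ell^2(\{0,1,2,\dots\})$ let $M$ be the Friedrichs extension of $$(P^2\otimes 1+1\otimes P^2)\otimes 1+(X^{-2}\otimes 1+1\otimes X^{-2})\otimes\sum_{\ell}\ell(\ell+1)|\ell\rangle\langle\ell|+X^2\otimes X^2\otimes\sum_{\ell,\ell'}A_{\ell,\ell'}|\ell\rangle\langle\ell'|,$$ defined on finite sums $\sum_\ell\rho_\ell\otimes|\ell\rangle$ with $\rho_\ell\in C_c^\infty((0,\infty)^2)$. Here $X$ is multiplication by the coordinate, $P=-\mathrm i\,d/dr$, and $A=A^T$ is the banded matrix with $$A_{\ell,\ell}=\frac12-\frac{1}{8\ell(\ell+1)-6},\qquad A_{\ell,\ell+2}=A_{\ell+2,\ell}=-\frac{(\ell+1)(\ell+2)}{\sqrt{2\ell+1}\,(2\ell+3)\sqrt{2\ell+5}},$$ all other entries being zero. Then $H$ and $M$ are self-adjoint, $4H$ maps $\operatorname{dom}(H)\cap\mathcal S$ into $\mathcal S$, and the operator obtained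 by restricting $4H$ to singlets is unitarily equivalent to $M$: there is a unitary $W:\mathcal H\to\mathcal S$ with $W\operatorname{dom}(M)=\operatorname{dom}(H)\cap\mathcal S$ and $4HW\psi=WM\psi$ for all $\psi\in\operatorname{dom}(M)$. -/

import Mathlib

open MeasureTheory Set Filter Topology
open scoped ContDiff InnerProductSpace Matrix

noncomputable section

namespace MatrixModel

/-! ### Unbounded operators -/

/-- `ψ` lies in the form domain of the nonnegative symmetric operator with graph `T`, that is, in
the closure of the domain of `T` for the norm `⟪u, T u⟫ + ‖u‖²`. -/
def InFormDomain {E : Type*} [NormedAddCommGroup E] [InnerProductSpace ℂ E]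
    (T : Set (E × E)) (ψ : E) : Prop :=
  ∃ p : ℕ → E × E, (∀ n, p n ∈ T) ∧ Tendsto (fun n => (p n).1) atTop (𝓝 ψ) ∧
    Tendsto (fun k : ℕ × ℕ => ⟪(p k.1).1 - (p k.2).1, (p k.1).2 - (p k.2).2⟫_ℂ) atTop (𝓝 0)

/-- `S` is the Friedrichs extension of the nonnegative symmetric operator with graph `T`: the
restriction of the adjoint of that operator to the form domain. -/
def IsFriedrichsExtension {E : Type*} [NormedAddCommGroup E] [InnerProductSpace ℂ E]
    (T : Set (E × E)) (S : E →ₗ.[ℂ] E) : Prop :=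
  ∀ ψ φ : E, (ψ, φ) ∈ S.graph ↔
    InFormDomain T ψ ∧ ∀ p ∈ T, ⟪ψ, p.2⟫_ℂ = ⟪φ, p.1⟫_ℂ

/-- The momentum operator `-i ∂` in the direction `e`, on functions. -/
def momentum {V : Type*} [NormedAddCommGroup V] [NormedSpace ℝ V]
    (e : V) (f : V → ℂ) : V → ℂ :=
  fun x => -Complex.I * fderiv ℝ f x e

/-! ### The bosonic matrix model with two `2 × 2` matrices -/

/-- The coordinates `x i a` of the two matrices `∑ a, x i a • t a`. -/
abbrev Config : Type := Fin 2 → EuclideanSpace ℝ (Fin 3)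

/-- The Pauli matrices. -/
def pauli : Fin 3 → Matrix (Fin 2) (Fin 2) ℂ :=
  ![!![0, 1; 1, 0], !![0, -Complex.I; Complex.I, 0], !![1, 0; 0, -1]]

/-- The generators `t a = σ a / 2` of `SU(2)`. -/
def generator (a : Fin 3) : Matrix (Fin 2) (Fin 2) ℂ := (1 / 2 : ℂ) • pauli a

/-- The traceless Hermitian matrix with coordinates `v`. -/
def toMatrix (v : EuclideanSpace ℝ (Fin 3)) : Matrix (Fin 2) (Fin 2) ℂ :=
  ∑ a, (v a : ℂ) • generator a

/-- The coordinate direction of `x i a`. -/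
def direction (i : Fin 2) (a : Fin 3) : Config := Pi.single i (EuclideanSpace.single a 1)

/-- The differential expression
`H = Tr (1/2 ∑ i, P i * P i - 1/4 ∑ i j, [X i, X j] ^ 2)`, where `X i = ∑ a, x i a • t a` and
`P i = ∑ a, p i a • (t a)^*` (entrywise conjugate), with `p i a = -i ∂ / ∂ (x i a)`. -/
def hamiltonian (f : Config → ℂ) (x : Config) : ℂ :=
  (1 / 2) * ∑ i, ∑ a, ∑ b,
      ((generator a).map star * (generator b).map star).trace *
        momentum (direction i a) (momentum (direction i b) f) x
    - (1 / 4) * ∑ i, ∑ j, (⁅toMatrix (x i), toMatrix (x j)⁆ ^ 2).trace * f x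

/-- The state space `L²` of the matrix model, in the position representation. -/
abbrev StateSpace : Type := Lp ℂ 2 (volume : Measure Config)

/-- The graph of the Hamiltonian on smooth compactly supported functions. -/
def hamiltonianCore : Set (StateSpace × StateSpace) :=
  {p | ∃ f : Config → ℂ, ContDiff ℝ ∞ f ∧ HasCompactSupport f ∧
    p.1 =ᵐ[volume] f ∧ p.2 =ᵐ[volume] hamiltonian f}

/-- The action `X i ↦ g * X i * g⁻¹` of a unitary matrix `g` (with `g⁻¹ = gᴴ`), in coordinates. -/
def gaugeAction (g : Matrix (Fin 2) (Fin 2) ℂ) (x : Config) : Config :=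
  fun i => WithLp.toLp 2 fun a => (pauli a * (g * toMatrix (x i) * gᴴ)).trace.re

/-- The `SU(2)` singlets. -/
def IsSinglet (ψ : StateSpace) : Prop :=
  ∀ g ∈ Matrix.specialUnitaryGroup (Fin 2) ℂ,
    (fun x => ψ (gaugeAction g x)) =ᵐ[volume] ψ

/-! ### The radial lattice model -/

/-- `L²(ℝ⁺) ⊗ L²(ℝ⁺)`, as the space `L²(ℝ⁺ × ℝ⁺)`. -/
abbrev RadialSpace : Type :=
  Lp ℂ 2 (((volume : Measure ℝ).restrict (Ioi 0)).prod ((volume : Measure ℝ).restrict (Ioi 0)))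

/-- `L²(ℝ⁺) ⊗ L²(ℝ⁺) ⊗ ℓ²`, as the Hilbert sum over `ℓ = 0, 1, 2, …` of copies of
`L²(ℝ⁺ × ℝ⁺)`. -/
abbrev ModelSpace : Type := lp (fun _ : ℕ => RadialSpace) 2

/-- The banded symmetric coupling matrix `A`. -/
def coupling (l l' : ℕ) : ℝ :=
  if l = l' then 1 / 2 - 1 / (8 * (l : ℝ) * ((l : ℝ) + 1) - 6)
  else if l' = l + 2 then
    -(((l : ℝ) + 1) * ((l : ℝ) + 2)) /
      (√(2 * (l : ℝ) + 1) * (2 * (l : ℝ) + 3) * √(2 * (l : ℝ) + 5))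
  else if l = l' + 2 then
    -(((l' : ℝ) + 1) * ((l' : ℝ) + 2)) /
      (√(2 * (l' : ℝ) + 1) * (2 * (l' : ℝ) + 3) * √(2 * (l' : ℝ) + 5))
  else 0

/-- The component `l` of
`(P² ⊗ 1 + 1 ⊗ P²) ⊗ 1 + (X⁻² ⊗ 1 + 1 ⊗ X⁻²) ⊗ ℓ(ℓ+1) + X² ⊗ X² ⊗ A` applied to the family
`ρ` (finitely many members nonzero), at the point `r = (r₁, r₂)`. -/
def modelOperator (ρ : ℕ → ℝ × ℝ → ℂ) (l : ℕ) (r : ℝ × ℝ) : ℂ :=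
  momentum (1, 0) (momentum (1, 0) (ρ l)) r + momentum (0, 1) (momentum (0, 1) (ρ l)) r
    + ((r.1 ^ 2)⁻¹ + (r.2 ^ 2)⁻¹ : ℝ) * ((l : ℂ) * ((l : ℂ) + 1)) * ρ l r
    + (r.1 ^ 2 * r.2 ^ 2 : ℝ) * ∑' l' : ℕ, (coupling l l' : ℂ) * ρ l' r

/-- The graph of the model operator on finite families of smooth functions with compact support
in `(0, ∞) × (0, ∞)`. -/
def modelCore : Set (ModelSpace × ModelSpace) :=
  {p | ∃ ρ : ℕ → ℝ × ℝ → ℂ, {l | ρ l ≠ 0}.Finite ∧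
    (∀ l, ContDiff ℝ ∞ (ρ l) ∧ HasCompactSupport (ρ l) ∧ tsupport (ρ l) ⊆ Ioi 0 ×ˢ Ioi 0) ∧
    ∀ l, p.1 l =ᵐ[(volume.restrict (Ioi 0)).prod (volume.restrict (Ioi 0))] ρ l ∧
      p.2 l =ᵐ[(volume.restrict (Ioi 0)).prod (volume.restrict (Ioi 0))] modelOperator ρ l}

end MatrixModel

end

noncomputable section

namespace MatrixModel

/-! ### Friedrichs extensions of nonnegative symmetric graphs -/

section Friedrichs

variable {E : Type*} [NormedAddCommGroup E] [InnerProductSpace ℂ E]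

/-! Write `r₁`, `r₂` for the lengths of the two vectors and `c` for the cosine of their angle. Pauli
algebra turns `4 H` into minus the Laplacian on `ℝ⁶` plus the potential `r₁² r₂² (1 - c²)`
(`four_mul_hamiltonian`, `potential_eq`). `SU(2)` acts by rotations, transitively on the pairs with
given `r₁, r₂, c` (`exists_gaugeAction_eq`), so a singlet is almost everywhere a function of these
three numbers, and Lebesgue measure becomes `8π² r₁² r₂² dr₁ dr₂ dc` (`map_relCoords`). The
functions `√(2ℓ+1) P_ℓ(c) h(r₁, r₂) / (4π r₁ r₂)` therefore give mutually orthogonal isometric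
copies of the radial space. They combine to `modelIsometry`, called `W` below, whose range is all
singlets because polynomials in `c` are dense (`range_modelIsometry`).

On such a partial wave the factor `1 / (r₁ r₂)` removes the first-order radial derivatives, and the
Legendre equation produces `ℓ(ℓ+1)/rᵢ²` (`kinetic_partialWave`). The three-term recurrence turns
multiplication by `1 - c²` into the matrix `A` (`normLegendre_coupling`). Hence `W` carries the core
of `M` into the core of `4 H`, with the operators matching (`modelIsometry_mem_scaledGraph`);
symmetry and nonnegativity of the model operator are inherited from this.

Matching on the smaller core does not identify the Friedrichs extensions: the partial waves of a
general test function are infinitely many and need not vanish near `rᵢ = 0`. By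
`friedrichsExtension_intertwining` it is enough that `W†` sends the core of `4 H` into the form
domain of `M`; the same criterion yields that `4 H` preserves the singlets. The form domain is
stable under limits along which the form merely stays bounded (`inFormDomain_of_bounded`,
`inFormDomain_adjoint_of_bounded`), so two estimates finish the proof, in `inFormDomain_adjoint`.

First, multiplying a test function by a cutoff that removes `|xᵢ| < δ/2` costs a gradient of size `B
/ |xᵢ|` with `B` independent of `δ`. Since `|xᵢ|⁻²` is locally integrable in three dimensions, the
form stays bounded as `δ → 0`. Second, if `f` vanishes near `xᵢ = 0`, its radial coefficients are
test functions, and its partial sums `g N` over `ℓ < N` have bounded form: the kinetic energy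
commutes with the projections, so its form is `⟪(-Δ) f, g N⟫`, while the potential is bounded on the
support. -/

/-- `T` is the graph of a densely defined nonnegative symmetric operator. -/
structure IsNonnegSymmetric (T : Submodule ℂ (E × E)) : Prop where
  symm : ∀ p ∈ T, ∀ q ∈ T, ⟪p.1, q.2⟫_ℂ = ⟪p.2, q.1⟫_ℂ
  nonneg : ∀ p ∈ T, 0 ≤ (⟪p.1, p.2⟫_ℂ).re
  dense : Dense (Prod.fst '' (T : Set (E × E)))

/-- The domain of the operator with graph `T`, to be equipped with the form inner product. -/
def FormCore (T : Submodule ℂ (E × E)) : Type _ := T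

namespace FormCore

variable (T : Submodule ℂ (E × E))

instance : AddCommGroup (FormCore T) := inferInstanceAs (AddCommGroup T)

instance : Module ℂ (FormCore T) := inferInstanceAs (Module ℂ T)

/-- The inclusion of the operator domain into the ambient space. -/
def fst : FormCore T →ₗ[ℂ] E := (LinearMap.fst ℂ E E).comp T.subtype

/-- The operator on its domain. -/
def snd : FormCore T →ₗ[ℂ] E := (LinearMap.snd ℂ E E).comp T.subtype

variable {T}

/-- A member of the graph as an element of the form core. -/
def mk (p : E × E) (hp : p ∈ T) : FormCore T := (⟨p, hp⟩ : T)

lemma mem (p : FormCore T) : (fst T p, snd T p) ∈ T := p.2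

variable (T) in
/-- The form inner product `⟪u, T v⟫ + ⟪u, v⟫`. -/
@[reducible]
def core [h : Fact (IsNonnegSymmetric T)] : PreInnerProductSpace.Core ℂ (FormCore T) where
  inner p q := ⟪fst T p, snd T q⟫_ℂ + ⟪fst T p, fst T q⟫_ℂ
  conj_inner_symm p q := by
    rw [map_add, inner_conj_symm, inner_conj_symm, h.out.symm _ p.mem _ q.mem]
  re_inner_nonneg p := by
    have h1 := h.out.nonneg _ p.mem
    have h2 := inner_self_nonneg (𝕜 := ℂ) (x := fst T p)
    simp only [RCLike.re_to_complex, Complex.add_re] at *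
    positivity
  add_left p q r := by simp only [map_add, inner_add_left]; ring
  smul_left p q r := by simp only [map_smul, inner_smul_left]; ring

instance [Fact (IsNonnegSymmetric T)] : SeminormedAddCommGroup (FormCore T) :=
  @InnerProductSpace.Core.toSeminormedAddCommGroup ℂ _ _ _ _ (core T)

instance [Fact (IsNonnegSymmetric T)] : InnerProductSpace ℂ (FormCore T) :=
  InnerProductSpace.ofCore (core T)

variable [h : Fact (IsNonnegSymmetric T)]

lemma inner_def (p q : FormCore T) :
    ⟪p, q⟫_ℂ = ⟪fst T p, snd T q⟫_ℂ + ⟪fst T p, fst T q⟫_ℂ := rfl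

lemma norm_sq (p : FormCore T) :
    ‖p‖ ^ 2 = (⟪fst T p, snd T p⟫_ℂ).re + ‖fst T p‖ ^ 2 := by
  rw [← inner_self_eq_norm_sq (𝕜 := ℂ) p, inner_def, ← inner_self_eq_norm_sq (𝕜 := ℂ) (fst T p)]
  simp

lemma norm_fst_le (p : FormCore T) : ‖fst T p‖ ≤ 1 * ‖p‖ := by
  have h1 := norm_sq p
  have h2 := h.out.nonneg _ p.mem
  dsimp only at h2
  rw [one_mul]
  exact abs_le_of_sq_le_sq' (by linarith) (norm_nonneg _) |>.2

end FormCore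

/-- The form domain, as an abstract Hilbert space. -/
abbrev FormSpace (T : Submodule ℂ (E × E)) [Fact (IsNonnegSymmetric T)] : Type _ :=
  UniformSpace.Completion (FormCore T)

namespace FormSpace

variable (T : Submodule ℂ (E × E)) [h : Fact (IsNonnegSymmetric T)]

/-- The inclusion of the operator domain into the form domain. -/
def incl : FormCore T →ₗᵢ[ℂ] FormSpace T := UniformSpace.Completion.toComplₗᵢ

lemma denseRange_incl : DenseRange (incl T) := UniformSpace.Completion.denseRange_coe

variable [CompleteSpace E]

/-- The inclusion of the form domain into the ambient space. -/
def emb : FormSpace T →L[ℂ] E :=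
  ((FormCore.fst T).mkContinuous 1 FormCore.norm_fst_le).extend (incl T).toContinuousLinearMap

variable {T}

lemma emb_incl (p : FormCore T) : emb T (incl T p) = FormCore.fst T p :=
  ContinuousLinearMap.extend_eq (e := (incl T).toContinuousLinearMap) _ (denseRange_incl T)
    (incl T).isometry.isUniformInducing p

/-- Symmetry moves the operator onto the element of its domain, and both sides are then continuous
in `ξ`. The abstract completion is handled almost entirely through this identity. -/
lemma inner_incl_left (p : FormCore T) (ξ : FormSpace T) :
    ⟪incl T p, ξ⟫_ℂ = ⟪FormCore.snd T p + FormCore.fst T p, emb T ξ⟫_ℂ := by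
  refine (denseRange_incl T).induction_on ξ
    (isClosed_eq (by fun_prop) (by fun_prop)) fun q => ?_
  rw [LinearIsometry.inner_map_map, FormCore.inner_def, emb_incl, inner_add_left,
    ← h.out.symm _ p.mem _ q.mem]

/-- This is closability of the form: a vector killed by `emb` is orthogonal, in the form space, to
the dense image of the operator domain. So the completion can be regarded as a subspace of `E`. -/
lemma emb_injective : Function.Injective (emb T) := by
  rw [injective_iff_map_eq_zero]
  intro ξ hξ
  refine (denseRange_incl T).eq_zero_of_inner_left ℂ fun p => ?_
  rw [← inner_conj_symm, inner_incl_left, hξ, inner_zero_right, map_zero]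

lemma denseRange_emb : DenseRange (emb T) := by
  refine h.out.dense.mono ?_
  rintro _ ⟨p, hp, rfl⟩
  exact ⟨incl T (FormCore.mk p hp), emb_incl _⟩

omit [CompleteSpace E] in
lemma norm_incl_sub_sq (p q : FormCore T) :
    ‖incl T p - incl T q‖ ^ 2 =
      (⟪FormCore.fst T p - FormCore.fst T q, FormCore.snd T p - FormCore.snd T q⟫_ℂ).re +
        ‖FormCore.fst T p - FormCore.fst T q‖ ^ 2 := by
  rw [← map_sub, LinearIsometry.norm_map, FormCore.norm_sq, map_sub, map_sub]

omit [CompleteSpace E] in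
-- `InFormDomain` asks for decay of a complex inner product, whereas completeness concerns the form
-- norm; this translates between them.
lemma inner_fst_snd_eq (p : FormCore T) :
    ⟪FormCore.fst T p, FormCore.snd T p⟫_ℂ =
      ((‖incl T p‖ ^ 2 - ‖FormCore.fst T p‖ ^ 2 : ℝ) : ℂ) := by
  rw [LinearIsometry.norm_map]
  have h1 := FormCore.inner_def p p
  rw [inner_self_eq_norm_sq_to_K, inner_self_eq_norm_sq_to_K] at h1
  push_cast
  rw [eq_sub_iff_add_eq]
  exact h1.symm

/-- Convergence in `E` together with decay of the form on differences is exactly the Cauchy property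
for the form norm, so the sequential definition describes the image of the completion. -/
lemma inFormDomain_iff {ψ : E} : InFormDomain (T : Set (E × E)) ψ ↔ ψ ∈ range (emb T) := by
  constructor
  · rintro ⟨p, hp, hlim, hc⟩
    let P : ℕ → FormCore T := fun n => FormCore.mk _ (hp n)
    have hP1 : ∀ n, FormCore.fst T (P n) = (p n).1 := fun _ => rfl
    have hP2 : ∀ n, FormCore.snd T (P n) = (p n).2 := fun _ => rfl
    have hcauchy : CauchySeq fun n => incl T (P n) := by
      rw [cauchySeq_iff_tendsto_dist_atTop_0]
      have h1 : Tendsto (fun k : ℕ × ℕ => ‖incl T (P k.1) - incl T (P k.2)‖ ^ 2) atTop (𝓝 0) := by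
        simp only [norm_incl_sub_sq, hP1, hP2]
        have h2 : Tendsto (fun k : ℕ × ℕ => ‖(p k.1).1 - (p k.2).1‖) atTop (𝓝 0) := by
          have := cauchySeq_iff_tendsto_dist_atTop_0.1 hlim.cauchySeq
          simpa only [dist_eq_norm] using this
        have h3 := (Complex.continuous_re.tendsto _).comp hc
        simpa using h3.add (h2.pow 2)
      have h4 := h1.sqrt
      simpa [dist_eq_norm, Real.sqrt_sq (norm_nonneg _)] using h4
    obtain ⟨ξ, hξ⟩ := cauchySeq_tendsto_of_complete hcauchy
    refine ⟨ξ, tendsto_nhds_unique (((emb T).continuous.tendsto ξ).comp hξ) ?_⟩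
    simpa [Function.comp_def, emb_incl, hP1] using hlim
  · rintro ⟨ξ, rfl⟩
    obtain ⟨P, hP, hPξ⟩ := (mem_closure_iff_seq_limit (s := range (incl T))).1
      ((denseRange_incl T) ξ)
    choose Q hQ using hP
    obtain rfl : (fun n => incl T (Q n)) = P := funext hQ
    refine ⟨fun n => (FormCore.fst T (Q n), FormCore.snd T (Q n)), fun n => (Q n).mem, ?_, ?_⟩
    · have := ((emb T).continuous.tendsto ξ).comp hPξ
      simp only [Function.comp_def, emb_incl] at this
      exact this
    · have h1 := cauchySeq_iff_tendsto_dist_atTop_0.1 hPξ.cauchySeq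
      have h2 := cauchySeq_iff_tendsto_dist_atTop_0.1
        (((emb T).continuous.tendsto ξ).comp hPξ).cauchySeq
      have h3 : ∀ k : ℕ × ℕ,
          ⟪FormCore.fst T (Q k.1) - FormCore.fst T (Q k.2),
            FormCore.snd T (Q k.1) - FormCore.snd T (Q k.2)⟫_ℂ =
            ((dist (incl T (Q k.1)) (incl T (Q k.2)) ^ 2
              - dist (emb T (incl T (Q k.1))) (emb T (incl T (Q k.2))) ^ 2 : ℝ) : ℂ) := by
        intro k
        have := inner_fst_snd_eq (Q k.1 - Q k.2)
        rw [← emb_incl, map_sub, map_sub, map_sub, ← dist_eq_norm, ← dist_eq_norm,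
          emb_incl, emb_incl] at this
        rw [emb_incl, emb_incl]
        exact this
      simp only [h3]
      have h4 := (h1.pow 2).sub (h2.pow 2)
      have h5 := (Complex.continuous_ofReal.tendsto _).comp h4
      simpa [Function.comp_def] using h5

/-- A vector that is a weak limit of a sequence bounded for the form norm is in the form domain. -/
lemma mem_range_emb_of_bounded {ψ : E} (ξ : ℕ → FormSpace T) (C : ℝ) (hC : ∀ n, ‖ξ n‖ ≤ C)
    (hlim : ∀ e, Tendsto (fun n => ⟪e, emb T (ξ n)⟫_ℂ) atTop (𝓝 ⟪e, ψ⟫_ℂ)) :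
    ψ ∈ range (emb T) := by
  -- The bound on `⟪e, emb T (ξ n)⟫` by `C ‖emb† e‖` survives the weak limit. Hence `e ↦ ⟪ψ, e⟫`
  -- factors through `emb†` as a bounded functional.
  have hbound : ∀ e, ‖innerSL ℂ ψ e‖ ≤ C * ‖(emb T).adjoint e‖ := by
    intro e
    rw [innerSL_apply_apply, norm_inner_symm]
    refine le_of_tendsto (hlim e).norm (Eventually.of_forall fun n => ?_)
    rw [← ContinuousLinearMap.adjoint_inner_left, mul_comm]
    exact (norm_inner_le_norm _ _).trans
      (mul_le_mul_of_nonneg_left (hC n) (norm_nonneg _))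
  -- The orthogonal complement of the range of `emb†` is the kernel of `emb`, which is trivial.
  have hdense : DenseRange ((emb T).adjoint) := by
    have h1 : (emb T).adjoint.rangeᗮ = ⊥ := by
      rw [ContinuousLinearMap.orthogonal_range, ContinuousLinearMap.adjoint_adjoint,
        LinearMap.ker_eq_bot]
      exact emb_injective
    have h2 := Submodule.dense_iff_topologicalClosure_eq_top.2
      (Submodule.topologicalClosure_eq_top_iff.2 h1)
    exact h2
  let L : StrongDual ℂ (FormSpace T) :=
    (innerSL ℂ ψ).toLinearMap.extendOfNorm (emb T).adjoint.toLinearMap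
  have hL : ∀ e, L ((emb T).adjoint e) = ⟪ψ, e⟫_ℂ := fun e =>
    LinearMap.extendOfNorm_eq (e := (emb T).adjoint.toLinearMap) hdense ⟨C, hbound⟩ e
  -- The Riesz vector of the extended functional is the preimage of `ψ`.
  refine ⟨(InnerProductSpace.toDual ℂ _).symm L, ext_inner_right ℂ fun e => ?_⟩
  rw [← ContinuousLinearMap.adjoint_inner_right, InnerProductSpace.toDual_symm_apply, hL]

end FormSpace

open FormSpace

variable [CompleteSpace E] {T : Submodule ℂ (E × E)}

/-- The Friedrichs extension of a densely defined nonnegative symmetric operator exists and is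
self-adjoint. -/
theorem exists_friedrichsExtension (h : IsNonnegSymmetric T) :
    ∃ S : E →ₗ.[ℂ] E, IsFriedrichsExtension (T : Set (E × E)) S ∧ IsSelfAdjoint S := by
  have : Fact (IsNonnegSymmetric T) := ⟨h⟩
  -- `R` will be the resolvent `(S + 1)⁻¹`. It is bounded, symmetric and injective, and everything
  -- about `S` is derived from these facts.
  let R : E →L[ℂ] E := (emb T) ∘L (emb T).adjoint
  have hR : ∀ u v, ⟪R u, v⟫_ℂ = ⟪u, R v⟫_ℂ := by
    intro u v
    simp only [R, ContinuousLinearMap.comp_apply]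
    rw [← ContinuousLinearMap.adjoint_inner_right, ContinuousLinearMap.adjoint_inner_left]
  have hR0 : ∀ e, R e = 0 → e = 0 := by
    intro e he
    have h1 : (emb T).adjoint e = 0 := emb_injective (by rw [map_zero]; exact he)
    refine (denseRange_emb (T := T)).eq_zero_of_inner_left ℂ fun ξ => ?_
    rw [← ContinuousLinearMap.adjoint_inner_left, h1, inner_zero_left]
  -- The pairs `(R e, e - R e)`, which form the graph of `R⁻¹ - 1`.
  let G : Submodule ℂ (E × E) :=
    LinearMap.range (R.toLinearMap.prod (LinearMap.id - R.toLinearMap))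
  have hG : ∀ x : E × E, x ∈ G ↔ x.1 = R (x.1 + x.2) := by
    rintro ⟨a, b⟩
    simp only [G, LinearMap.mem_range, LinearMap.prod_apply, Function.prod, Prod.mk.injEq]
    constructor
    · rintro ⟨e, rfl, rfl⟩
      simp
    · intro hab
      exact ⟨a + b, hab.symm, by simp [← hab]⟩
  have hGf : ∀ x ∈ G, x.1 = 0 → x.2 = 0 := by
    intro x hx h0
    rw [hG, h0, zero_add] at hx
    exact hR0 _ hx.symm
  let S := G.toLinearPMap
  have hS : S.graph = G := Submodule.toLinearPMap_graph_eq G (fun x => hGf x)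
  have hdense : Dense (S.domain : Set E) := by
    rw [Submodule.dense_iff_topologicalClosure_eq_top, Submodule.topologicalClosure_eq_top_iff,
      Submodule.eq_bot_iff]
    intro v hv
    refine hR0 v (ext_inner_left ℂ fun e => ?_)
    rw [← hR, inner_zero_right]
    refine (Submodule.mem_orthogonal _ _).1 hv _ ?_
    rw [LinearPMap.mem_domain_iff]
    exact ⟨e - R e, by rw [hS, hG]; simp⟩
  refine ⟨S, fun ψ φ => ?_, ?_⟩
  · rw [hS, hG, inFormDomain_iff]
    constructor
    · intro hψ
      refine ⟨⟨_, hψ.symm⟩, fun p hp => ?_⟩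
      have h1 := inner_incl_left (T := T) (FormCore.mk p hp) ((emb T).adjoint (ψ + φ))
      rw [ContinuousLinearMap.adjoint_inner_right, emb_incl] at h1
      change ⟪p.1, ψ + φ⟫_ℂ = ⟪p.2 + p.1, R (ψ + φ)⟫_ℂ at h1
      change ψ = R (ψ + φ) at hψ
      rw [← hψ, inner_add_left, inner_add_right, add_comm, add_right_cancel_iff] at h1
      rw [← inner_conj_symm, ← h1, inner_conj_symm]
    · rintro ⟨⟨ξ, rfl⟩, hadj⟩
      -- Tested against the dense operator domain, the adjoint condition says that `ξ` represents
      -- the functional `⟪emb T ξ + φ, emb ·⟫` for the form inner product.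
      have h1 : ξ = (emb T).adjoint (emb T ξ + φ) := by
        refine (denseRange_incl T).eq_of_inner_right ℂ fun p => ?_
        rw [inner_incl_left, ContinuousLinearMap.adjoint_inner_right, emb_incl,
          inner_add_left, inner_add_right, ← inner_conj_symm, hadj _ p.mem, inner_conj_symm,
          add_comm]
      exact congrArg (emb T) h1
  · rw [LinearPMap.isSelfAdjoint_def]
    apply LinearPMap.eq_of_eq_graph
    rw [LinearPMap.adjoint_graph_eq_graph_adjoint hdense, hS]
    ext x
    rw [Submodule.mem_adjoint_iff, hG]
    constructor
    · intro hx
      refine ext_inner_left ℂ fun e => ?_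
      -- Every graph element has the form `(R e, e - R e)`, so the adjoint condition becomes
      -- symmetry of `R` tested against an arbitrary `e`.
      have := hx (R e) (e - R e) (by rw [hG]; simp)
      rw [inner_sub_left, hR, hR] at this
      rw [map_add, inner_add_right]
      linear_combination this
    · intro hx a b hab
      rw [hG] at hab
      dsimp only at hab
      have h1 : ⟪a + b, x.1⟫_ℂ = ⟪a, x.1 + x.2⟫_ℂ := by
        conv_lhs => rw [hx]
        conv_rhs => rw [hab]
        rw [hR]
      rw [inner_add_left, inner_add_right] at h1
      linear_combination h1

omit [CompleteSpace E] in
lemma _root_.Filter.Tendsto.inner_const_left {e ψ : E} {u : ℕ → E} (h : Tendsto u atTop (𝓝 ψ)) :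
    Tendsto (fun n => ⟪e, u n⟫_ℂ) atTop (𝓝 ⟪e, ψ⟫_ℂ) :=
  tendsto_const_nhds.inner h

/-- The limit of a sequence with bounded form is in the form domain. -/
theorem inFormDomain_of_bounded (h : IsNonnegSymmetric T) {ψ : E} (q : ℕ → E × E)
    (hq : ∀ n, q n ∈ T) (hlim : Tendsto (fun n => (q n).1) atTop (𝓝 ψ)) (C : ℝ)
    (hC : ∀ n, (⟪(q n).1, (q n).2⟫_ℂ).re ≤ C) : InFormDomain (T : Set (E × E)) ψ := by
  have : Fact (IsNonnegSymmetric T) := ⟨h⟩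
  let Q : ℕ → FormCore T := fun n => FormCore.mk _ (hq n)
  obtain ⟨B, hB⟩ := hlim.norm.bddAbove_range
  have hB' : ∀ n, ‖(q n).1‖ ≤ B := fun n => hB ⟨n, rfl⟩
  have hB0 : 0 ≤ B := (norm_nonneg _).trans (hB' 0)
  rw [inFormDomain_iff]
  refine mem_range_emb_of_bounded (fun n => incl T (Q n)) (√(C + B ^ 2)) (fun n => ?_)
    fun e => ?_
  · refine Real.le_sqrt_of_sq_le ?_
    rw [LinearIsometry.norm_map, FormCore.norm_sq]
    exact add_le_add (hC n) (pow_le_pow_left₀ (norm_nonneg _) (hB' n) 2)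
  · simp only [emb_incl]
    exact hlim.inner_const_left

/-! ### Comparing the Friedrichs extensions of two operators related by an isometry -/

section Intertwining

variable {F : Type*} [NormedAddCommGroup F] [InnerProductSpace ℂ F] [CompleteSpace F]
  {T' : Submodule ℂ (F × F)} {W : F →ₗᵢ[ℂ] E}

/-- If `W` maps the graph `T'` into `T`, then `W† u` has form at most that of `u`. -/
lemma norm_le_of_emb_eq_adjoint [Fact (IsNonnegSymmetric T)] [Fact (IsNonnegSymmetric T')]
    (hW : ∀ p ∈ T', (W p.1, W p.2) ∈ T) (p : FormCore T) (ξ : FormSpace T')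
    (hξ : emb T' ξ = W.toContinuousLinearMap.adjoint (FormCore.fst T p)) : ‖ξ‖ ≤ ‖p‖ := by
  -- `⟪incl q, ξ⟫` equals `⟪(T' + 1) q, W† p⟫ = ⟪(T + 1) W q, p⟫`, which is the form inner product
  -- of `W q` and `p`; then Cauchy-Schwarz applies, `W` being isometric for the form norms.
  have key : ∀ q : FormCore T', ‖⟪incl T' q, ξ⟫_ℂ‖ ≤ ‖incl T' q‖ * ‖p‖ := by
    intro q
    let q' : FormCore T := FormCore.mk _ (hW _ q.mem)
    have hq' : ‖q'‖ = ‖q‖ := by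
      have h1 : ‖q'‖ ^ 2 = ‖q‖ ^ 2 := by
        rw [FormCore.norm_sq, FormCore.norm_sq]
        change (⟪W _, W _⟫_ℂ).re + ‖W _‖ ^ 2 = _
        rw [W.inner_map_map, W.norm_map]
      exact (pow_left_inj₀ (norm_nonneg _) (norm_nonneg _) two_ne_zero).1 h1
    rw [inner_incl_left, hξ, ContinuousLinearMap.adjoint_inner_right, map_add,
      LinearIsometry.norm_map, ← hq']
    have h2 := inner_incl_left q' (incl T p)
    rw [emb_incl, LinearIsometry.inner_map_map] at h2
    change ‖⟪FormCore.snd T q' + FormCore.fst T q', _⟫_ℂ‖ ≤ _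
    rw [← h2]
    exact norm_inner_le_norm _ _
  have key2 : ∀ η : FormSpace T', ‖⟪η, ξ⟫_ℂ‖ ≤ ‖η‖ * ‖p‖ := fun η =>
    (denseRange_incl T').induction_on η (isClosed_le (by fun_prop) (by fun_prop)) key
  have h3 := key2 ξ
  rw [inner_self_eq_norm_sq_to_K, norm_pow, RCLike.norm_ofReal, abs_norm, sq] at h3
  rcases (norm_nonneg ξ).eq_or_lt with h0 | h0
  · rw [← h0]
    exact norm_nonneg p
  · exact le_of_mul_le_mul_left h3 h0

/-- The property that `W†` maps a domain vector to the form domain is stable under limits with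
bounded form. -/
theorem inFormDomain_adjoint_of_bounded (h : IsNonnegSymmetric T) (h' : IsNonnegSymmetric T')
    (hW : ∀ p ∈ T', (W p.1, W p.2) ∈ T) {ψ : E} (q : ℕ → E × E) (hq : ∀ n, q n ∈ T)
    (hgood : ∀ n, InFormDomain (T' : Set (F × F)) (W.toContinuousLinearMap.adjoint (q n).1))
    (hlim : Tendsto (fun n => (q n).1) atTop (𝓝 ψ)) (C : ℝ)
    (hC : ∀ n, (⟪(q n).1, (q n).2⟫_ℂ).re ≤ C) :
    InFormDomain (T' : Set (F × F)) (W.toContinuousLinearMap.adjoint ψ) := by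
  have : Fact (IsNonnegSymmetric T) := ⟨h⟩
  have : Fact (IsNonnegSymmetric T') := ⟨h'⟩
  simp only [inFormDomain_iff] at hgood ⊢
  choose ξ hξ using hgood
  let Q : ℕ → FormCore T := fun n => FormCore.mk _ (hq n)
  obtain ⟨B, hB⟩ := hlim.norm.bddAbove_range
  have hB' : ∀ n, ‖(q n).1‖ ≤ B := fun n => hB ⟨n, rfl⟩
  refine mem_range_emb_of_bounded ξ (√(C + B ^ 2)) (fun n => ?_) fun e => ?_
  · refine (norm_le_of_emb_eq_adjoint hW (Q n) (ξ n) (hξ n)).trans ?_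
    refine Real.le_sqrt_of_sq_le ?_
    rw [FormCore.norm_sq]
    exact add_le_add (hC n) (pow_le_pow_left₀ (norm_nonneg _) (hB' n) 2)
  · simp only [hξ]
    exact (((W.toContinuousLinearMap.adjoint).continuous.tendsto ψ).comp hlim).inner_const_left

/-- If the isometry `W` maps the graph `T'` into `T` and `W†` maps the domain of `T` into the form
domain of `T'`, then `W` intertwines the Friedrichs extensions. -/
theorem friedrichsExtension_intertwining (h : IsNonnegSymmetric T) (h' : IsNonnegSymmetric T')
    (hW : ∀ p ∈ T', (W p.1, W p.2) ∈ T)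
    (hdom : ∀ p ∈ T, InFormDomain (T' : Set (F × F)) (W.toContinuousLinearMap.adjoint p.1))
    (ψ : F) (Φ : E) :
    (InFormDomain (T : Set (E × E)) (W ψ) ∧ ∀ p ∈ T, ⟪W ψ, p.2⟫_ℂ = ⟪Φ, p.1⟫_ℂ) ↔
      ∃ φ, (InFormDomain (T' : Set (F × F)) ψ ∧ ∀ p ∈ T', ⟪ψ, p.2⟫_ℂ = ⟪φ, p.1⟫_ℂ) ∧
        Φ = W φ := by
  have : Fact (IsNonnegSymmetric T) := ⟨h⟩
  have : Fact (IsNonnegSymmetric T') := ⟨h'⟩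
  have hWW : ∀ u, W.toContinuousLinearMap.adjoint (W u) = u := by
    intro u
    refine ext_inner_left ℂ fun v => ?_
    rw [ContinuousLinearMap.adjoint_inner_right]
    exact W.inner_map_map _ _
  -- `hdom` lets an arbitrary `p ∈ T` be tested: with `ζ` in the form space over `W† p.1`, the form
  -- inner product of `ξ` and `ζ` is computed once through the adjoint condition on `ψ` and once
  -- through the operator acting on `p`.
  have hback : ∀ φ, InFormDomain (T' : Set (F × F)) ψ →
      (∀ p ∈ T', ⟪ψ, p.2⟫_ℂ = ⟪φ, p.1⟫_ℂ) → ∀ p ∈ T, ⟪W ψ, p.2⟫_ℂ = ⟪W φ, p.1⟫_ℂ := by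
    intro φ hψ hφ p hp
    obtain ⟨ξ, rfl⟩ := inFormDomain_iff.1 hψ
    obtain ⟨ζ, hζ⟩ := inFormDomain_iff.1 (hdom p hp)
    have h1 : ∀ η : FormSpace T', ⟪ξ, η⟫_ℂ = ⟪φ + emb T' ξ, emb T' η⟫_ℂ := fun η => by
      refine (denseRange_incl T').induction_on η
        (isClosed_eq (by fun_prop) (by fun_prop)) fun q => ?_
      rw [← inner_conj_symm, inner_incl_left, inner_conj_symm, emb_incl, inner_add_left,
        inner_add_right, hφ _ q.mem]
    have h2 : ∀ η : FormSpace T', ⟪η, ζ⟫_ℂ = ⟪W (emb T' η), p.2 + p.1⟫_ℂ := fun η => by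
      refine (denseRange_incl T').induction_on η
        (isClosed_eq (by fun_prop) (by fun_prop)) fun q => ?_
      rw [inner_incl_left, hζ, ContinuousLinearMap.adjoint_inner_right, emb_incl, map_add,
        inner_add_left, inner_add_right]
      have := h.symm _ (hW _ q.mem) _ hp
      dsimp only at this
      rw [this]
      rfl
    have h3 := h1 ζ
    rw [h2, hζ, ContinuousLinearMap.adjoint_inner_right, map_add, inner_add_left,
      inner_add_right] at h3
    exact add_right_cancel h3
  have hfwd : InFormDomain (T' : Set (F × F)) ψ → InFormDomain (T : Set (E × E)) (W ψ) := by
    rintro ⟨p, hp, hlim, hc⟩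
    refine ⟨fun n => (W (p n).1, W (p n).2), fun n => hW _ (hp n),
      (W.continuous.tendsto ψ).comp hlim, ?_⟩
    simpa only [← map_sub, W.inner_map_map] using hc
  constructor
  · rintro ⟨hψ, hΦ⟩
    -- An approximating sequence for `W ψ` has bounded form. Its image under `W†` lies in the form
    -- domain by `hdom` and tends to `W† W ψ = ψ`.
    have hψ' : InFormDomain (T' : Set (F × F)) ψ := by
      obtain ⟨ξ, hξ⟩ := inFormDomain_iff.1 hψ
      obtain ⟨P, hP, hPξ⟩ := (mem_closure_iff_seq_limit (s := range (incl T))).1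
        ((denseRange_incl T) ξ)
      choose Q hQ using hP
      obtain rfl : (fun n => incl T (Q n)) = P := funext hQ
      obtain ⟨B, hB⟩ := hPξ.norm.bddAbove_range
      rw [← hWW ψ]
      refine inFormDomain_adjoint_of_bounded h h' hW
        (fun n => (FormCore.fst T (Q n), FormCore.snd T (Q n))) (fun n => (Q n).mem)
        (fun n => hdom _ (Q n).mem) ?_ (B ^ 2) fun n => ?_
      · have := ((emb T).continuous.tendsto ξ).comp hPξ
        simp only [Function.comp_def, emb_incl, hξ] at this
        exact this
      · have h1 := FormCore.norm_sq (Q n)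
        have h2 : ‖incl T (Q n)‖ ≤ B := hB ⟨n, rfl⟩
        rw [LinearIsometry.norm_map] at h2
        have h3 := pow_le_pow_left₀ (norm_nonneg _) h2 2
        dsimp only
        nlinarith [sq_nonneg ‖FormCore.fst T (Q n)‖]
    have hφ : ∀ p ∈ T', ⟪ψ, p.2⟫_ℂ = ⟪W.toContinuousLinearMap.adjoint Φ, p.1⟫_ℂ := by
      intro p hp
      rw [ContinuousLinearMap.adjoint_inner_left]
      have := hΦ _ (hW p hp)
      rw [W.inner_map_map] at this
      exact this
    refine ⟨W.toContinuousLinearMap.adjoint Φ, ⟨hψ', hφ⟩, ?_⟩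
    -- `Φ` and `W (W† Φ)` pair equally with the dense domain of `T`, so `Φ` lies in the range of
    -- `W`. Invariance of that range under the extension is thus a consequence rather than a
    -- hypothesis.
    refine h.dense.eq_of_inner_left ℂ ?_
    rintro _ ⟨p, hp, rfl⟩
    rw [← hΦ p hp, hback _ hψ' hφ p hp]
  · rintro ⟨φ, ⟨hψ, hφ⟩, rfl⟩
    exact ⟨hfwd hψ, hback φ hψ hφ⟩

end Intertwining

end Friedrichs

/-! ### Legendre polynomials -/

section Legendre

open Polynomial

/-- The Legendre polynomials. -/
def legendre : ℕ → ℝ[X]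
  | 0 => 1
  | 1 => X
  | n + 2 => C ((n + 2 : ℝ)⁻¹) * ((2 * (n : ℝ[X]) + 3) * X * legendre (n + 1)
      - ((n : ℝ[X]) + 1) * legendre n)

lemma legendre_recurrence (n : ℕ) :
    ((n : ℝ[X]) + 2) * legendre (n + 2) =
      (2 * (n : ℝ[X]) + 3) * X * legendre (n + 1) - ((n : ℝ[X]) + 1) * legendre n := by
  rw [legendre]
  have h : ((n : ℝ[X]) + 2) * C ((n + 2 : ℝ)⁻¹) = 1 := by
    have h1 : ((n : ℝ[X]) + 2) = C ((n : ℝ) + 2) := by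
      rw [C_add, C_ofNat, C_eq_natCast]
    rw [h1, ← C_mul, mul_inv_cancel₀ (by positivity), C_1]
  rw [← mul_assoc, h, one_mul]

lemma natCast_add_two_ne_zero (n : ℕ) : ((n : ℝ[X]) + 2) ≠ 0 := by
  exact_mod_cast (by positivity : (n + 2 : ℕ) ≠ 0)

/-- The two derivative relations feed each other through the differentiated recurrence, so they are
proved by a joint induction. -/
lemma derivative_legendre_aux (n : ℕ) :
    derivative (legendre (n + 1)) = X * derivative (legendre n) + ((n : ℝ[X]) + 1) * legendre n ∧
    derivative (legendre n) = X * derivative (legendre (n + 1))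
      - ((n : ℝ[X]) + 1) * legendre (n + 1) := by
  induction n with
  | zero => simp [legendre]
  | succ n ih =>
    obtain ⟨hA, hB⟩ := ih
    have hrec := legendre_recurrence n
    have hd := congrArg derivative hrec
    simp only [derivative_mul, derivative_sub, derivative_add, derivative_natCast,
      derivative_ofNat, derivative_X, derivative_one] at hd
    have hA' : derivative (legendre (n + 2)) = X * derivative (legendre (n + 1))
        + ((n : ℝ[X]) + 2) * legendre (n + 1) := by
      refine mul_left_cancel₀ (natCast_add_two_ne_zero n) ?_
      linear_combination hd - ((n : ℝ[X]) + 1) * hB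
    refine ⟨by push_cast; linear_combination hA', ?_⟩
    push_cast
    rw [show n + 1 + 1 = n + 2 from rfl]
    linear_combination hA - X * hA' + X * hB + hrec

/-- The Legendre differential equation. -/
lemma legendre_ode (n : ℕ) :
    (1 - X ^ 2) * derivative (derivative (legendre n)) - 2 * X * derivative (legendre n) =
      -((n : ℝ[X]) * ((n : ℝ[X]) + 1)) * legendre n := by
  cases n with
  | zero => simp [legendre]
  | succ n =>
    obtain ⟨hA, hB⟩ := derivative_legendre_aux n
    have h1 : (1 - X ^ 2) * derivative (legendre (n + 1)) =
        ((n : ℝ[X]) + 1) * (legendre n - X * legendre (n + 1)) := by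
      linear_combination hA + X * hB
    have h2 := congrArg derivative h1
    simp only [derivative_mul, derivative_sub, derivative_add, derivative_natCast, derivative_pow,
      derivative_X, derivative_one, C_eq_natCast] at h2
    push_cast at h2 ⊢
    linear_combination h2 + ((n : ℝ[X]) + 1) * hB

/-- The recurrence expresses `X * P (n + 1)` through its neighbours, so the span is closed under
multiplication by `X`; it contains the constants. -/
lemma mem_span_legendre (p : ℝ[X]) : p ∈ Submodule.span ℝ (range legendre) := by
  set S := Submodule.span ℝ (range legendre)
  have hmem : ∀ n, legendre n ∈ S := fun n => Submodule.subset_span ⟨n, rfl⟩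
  have hX : ∀ q ∈ S, X * q ∈ S := by
    intro q hq
    refine Submodule.span_induction ?_ ?_ ?_ ?_ hq
    · rintro _ ⟨n, rfl⟩
      cases n with
      | zero =>
        have := hmem 1
        simpa [legendre] using this
      | succ n =>
        have hrec := legendre_recurrence n
        have h1 : X * legendre (n + 1) = (2 * (n : ℝ) + 3)⁻¹ •
            (((n : ℝ) + 2) • legendre (n + 2) + ((n : ℝ) + 1) • legendre n) := by
          have h3 : (2 * (n : ℝ) + 3) ≠ 0 := by positivity
          rw [eq_inv_smul_iff₀ h3]
          simp only [smul_eq_C_mul, C_add, C_mul, C_ofNat, C_eq_natCast, C_1]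
          linear_combination -hrec
        rw [h1]
        exact S.smul_mem _ (S.add_mem (S.smul_mem _ (hmem _)) (S.smul_mem _ (hmem _)))
    · simp
    · intro a b _ _ ha hb
      rw [mul_add]
      exact S.add_mem ha hb
    · intro c a _ ha
      rw [mul_smul_comm]
      exact S.smul_mem _ ha
  induction p using Polynomial.induction_on with
  | C a =>
    have := S.smul_mem a (hmem 0)
    simpa [legendre, smul_eq_C_mul] using this
  | add p q hp hq => exact S.add_mem hp hq
  | monomial n a h =>
    have := hX _ h
    convert this using 1
    ring

lemma intervalIntegrable_eval (p : ℝ[X]) (a b : ℝ) :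
    IntervalIntegrable (fun x => p.eval x) volume a b := p.continuous.intervalIntegrable _ _

lemma integral_legendre_mul_of_ne {n m : ℕ} (h : n ≠ m) :
    ∫ x in (-1 : ℝ)..1, (legendre n).eval x * (legendre m).eval x = 0 := by
  -- The weighted Wronskian of the two polynomials. By the Legendre equation its derivative is a
  -- nonzero multiple of their product, and `1 - X ^ 2` kills both boundary terms.
  set Q : ℝ[X] := (1 - X ^ 2) * (derivative (legendre n) * legendre m
    - legendre n * derivative (legendre m)) with hQ
  have hQ' : derivative Q = C ((m : ℝ) * (m + 1) - n * (n + 1)) * (legendre n * legendre m) := by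
    have h1 := legendre_ode n
    have h2 := legendre_ode m
    simp only [hQ, derivative_mul, derivative_sub, derivative_pow, derivative_X, derivative_one,
      C_sub, C_add, C_mul, C_eq_natCast, C_1]
    push_cast
    linear_combination legendre m * h1 - legendre n * h2
  have hint := intervalIntegral.integral_eq_sub_of_hasDerivAt (a := -1) (b := 1)
    (fun x _ => Q.hasDerivAt x) (intervalIntegrable_eval _ _ _)
  have hne : (m : ℝ) * (m + 1) - n * (n + 1) ≠ 0 := by
    have : (m : ℝ) * (m + 1) - n * (n + 1) = (m - n) * (m + n + 1) := by ring
    rw [this]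
    refine mul_ne_zero (sub_ne_zero.2 (by exact_mod_cast h.symm)) (by positivity)
  rw [hQ'] at hint
  simp only [eval_mul, eval_C, hQ, eval_sub, eval_one, eval_pow, eval_X] at hint
  rw [intervalIntegral.integral_const_mul] at hint
  norm_num at hint
  exact hint.resolve_left hne

lemma eval_legendre_recurrence (n : ℕ) (x : ℝ) :
    ((n : ℝ) + 2) * (legendre (n + 2)).eval x =
      (2 * n + 3) * x * (legendre (n + 1)).eval x - (n + 1) * (legendre n).eval x := by
  have := congrArg (eval x) (legendre_recurrence n)
  simpa using this

/-- Evaluating `∫ x P (n + 1) P n` by the recurrence for either factor and eliminating it leaves `(2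
n + 3) ‖P (n + 1)‖² = (2 n + 1) ‖P n‖²`. -/
lemma integral_legendre_sq (n : ℕ) :
    ∫ x in (-1 : ℝ)..1, (legendre n).eval x ^ 2 = 2 / (2 * n + 1) := by
  have hint : ∀ p : ℝ → ℝ, Continuous p → IntervalIntegrable p volume (-1) 1 :=
    fun p hp => hp.intervalIntegrable _ _
  have hc : ∀ n, Continuous fun x => (legendre n).eval x := fun n => (legendre n).continuous
  -- `n ‖P (n - 1)‖² = (2 n + 1) ⟪x P n, P (n - 1)⟫`
  have h1 : ∀ n : ℕ, ((n : ℝ) + 1) * ∫ x in (-1 : ℝ)..1, (legendre n).eval x ^ 2 =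
      (2 * n + 3) * ∫ x in (-1 : ℝ)..1, x * (legendre (n + 1)).eval x * (legendre n).eval x := by
    intro n
    have h0 := integral_legendre_mul_of_ne (n := n + 2) (m := n) (by omega)
    have h2 : ∫ x in (-1 : ℝ)..1, ((n : ℝ) + 2) *
        ((legendre (n + 2)).eval x * (legendre n).eval x) =
        ∫ x in (-1 : ℝ)..1, ((2 * n + 3) * (x * (legendre (n + 1)).eval x * (legendre n).eval x)
          - (n + 1) * (legendre n).eval x ^ 2) := by
      refine intervalIntegral.integral_congr fun x _ => ?_
      linear_combination (legendre n).eval x * eval_legendre_recurrence n x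
    rw [intervalIntegral.integral_const_mul, h0, intervalIntegral.integral_sub
      (hint _ (by have := hc n; have := hc (n + 1); fun_prop))
      (hint _ (by have := hc n; fun_prop)),
      intervalIntegral.integral_const_mul, intervalIntegral.integral_const_mul] at h2
    linarith
  have h3 : ∀ n : ℕ, ((n : ℝ) + 1) * ∫ x in (-1 : ℝ)..1, (legendre (n + 1)).eval x ^ 2 =
      (2 * n + 1) * ∫ x in (-1 : ℝ)..1, x * (legendre (n + 1)).eval x * (legendre n).eval x := by
    intro n
    cases n with
    | zero => simp [legendre, sq]
    | succ n =>
      have h0 := integral_legendre_mul_of_ne (n := n) (m := n + 2) (by omega)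
      have h2 : ∫ x in (-1 : ℝ)..1, ((n : ℝ) + 2) * (legendre (n + 2)).eval x ^ 2 =
          ∫ x in (-1 : ℝ)..1,
            ((2 * n + 3) * (x * (legendre (n + 2)).eval x * (legendre (n + 1)).eval x)
            - (n + 1) * ((legendre n).eval x * (legendre (n + 2)).eval x)) := by
        refine intervalIntegral.integral_congr fun x _ => ?_
        linear_combination (legendre (n + 2)).eval x * eval_legendre_recurrence n x
      rw [intervalIntegral.integral_const_mul, intervalIntegral.integral_sub
        (hint _ (by have := hc (n + 2); have := hc (n + 1); fun_prop))
        (hint _ (by have := hc n; have := hc (n + 2); fun_prop)),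
        intervalIntegral.integral_const_mul, intervalIntegral.integral_const_mul, h0] at h2
      push_cast
      rw [show n + 1 + 1 = n + 2 from rfl]
      linarith
  induction n with
  | zero => simp [legendre]; norm_num
  | succ n ih =>
    have h4 := h1 n
    have h5 := h3 n
    rw [ih] at h4
    have hn1 : (n : ℝ) + 1 ≠ 0 := by positivity
    have hn2 : 2 * (n : ℝ) + 1 ≠ 0 := by positivity
    have hn3 : 2 * (n : ℝ) + 3 ≠ 0 := by positivity
    push_cast
    rw [eq_div_iff (by positivity)]
    refine mul_left_cancel₀ (mul_ne_zero hn1 hn2) ?_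
    field_simp at h4
    set I := ∫ x in (-1 : ℝ)..1, x * (legendre (n + 1)).eval x * (legendre n).eval x
    linear_combination (2 * (n : ℝ) + 1) * (2 * (n + 1) + 1) * h5 - (2 * (n : ℝ) + 1) * h4

/-- The Legendre functions normalized with respect to the uniform probability measure on
`[-1, 1]`. -/
def normLegendre (l : ℕ) (x : ℝ) : ℝ := √(2 * l + 1) * (legendre l).eval x

lemma continuous_normLegendre (l : ℕ) : Continuous (normLegendre l) :=
  continuous_const.mul (legendre l).continuous

lemma integral_normLegendre_mul (l m : ℕ) :
    ∫ x in (-1 : ℝ)..1, normLegendre l x * normLegendre m x = if l = m then 2 else 0 := by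
  have h : ∀ x, normLegendre l x * normLegendre m x =
      (√(2 * l + 1) * √(2 * m + 1)) * ((legendre l).eval x * (legendre m).eval x) := fun x => by
    rw [normLegendre, normLegendre]; ring
  simp only [h]
  rw [intervalIntegral.integral_const_mul]
  split_ifs with hlm
  · subst hlm
    simp only [← sq]
    rw [integral_legendre_sq, Real.sq_sqrt (by positivity)]
    field_simp
  · rw [integral_legendre_mul_of_ne hlm, mul_zero]

/-! ### Multiplication by `1 - x²` in the normalized Legendre basis -/

lemma coupling_self (l : ℕ) :
    coupling l l = 1 / 2 - 1 / (8 * (l : ℝ) * ((l : ℝ) + 1) - 6) := by simp [coupling]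

lemma coupling_eq_ite (l m : ℕ) : coupling l m =
    (if l = m then coupling m m else 0) + (if m = l + 2 then coupling l (l + 2) else 0) +
      (if l = m + 2 then coupling m (m + 2) else 0) := by
  rcases eq_or_ne l m with rfl | h
  · simp
  rcases eq_or_ne m (l + 2) with rfl | h2
  · simp [show ¬ l = l + 2 + 2 by omega]
  rcases eq_or_ne l (m + 2) with rfl | h3
  · simp [coupling, show ¬ m = m + 2 + 2 by omega]
  · simp [coupling, h, h2, h3]

/-- Two applications of the three-term recurrence. Starting at degree `l + 2` makes both neighbours
exist, and the diagonal entry simplifies because `8 l (l + 1) - 6 = 2 (2 l - 1) (2 l + 3)`. -/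
lemma eval_legendre_two_steps (l : ℕ) (x : ℝ) :
    (1 - x ^ 2) * (legendre (l + 2)).eval x =
      coupling (l + 2) (l + 2) * (legendre (l + 2)).eval x
      - ((l : ℝ) + 3) * (l + 4) / ((2 * l + 5) * (2 * l + 7)) * (legendre (l + 4)).eval x
      - ((l : ℝ) + 2) * (l + 1) / ((2 * l + 5) * (2 * l + 3)) * (legendre l).eval x := by
  have h0 := eval_legendre_recurrence l x
  have h1 := eval_legendre_recurrence (l + 1) x
  have h2 := eval_legendre_recurrence (l + 2) x
  rw [coupling_self]
  simp only [show l + 1 + 2 = l + 3 from rfl, show l + 2 + 2 = l + 4 from rfl,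
    show l + 1 + 1 = l + 2 from rfl] at *
  push_cast at *
  have e : 8 * ((l : ℝ) + 2) * (l + 2 + 1) - 6 = 2 * (2 * l + 3) * (2 * l + 7) := by ring
  have e3 : 2 * (l : ℝ) + 3 ≠ 0 := by positivity
  have e5 : 2 * (l : ℝ) + 5 ≠ 0 := by positivity
  have e7 : 2 * (l : ℝ) + 7 ≠ 0 := by positivity
  rw [e]
  field_simp
  linear_combination (2 * (2 * (l : ℝ) + 7) * (2 * l + 3)) * x * h1
    + 2 * (2 * (l : ℝ) + 3) * (l + 3) * h2 + 2 * (2 * (l : ℝ) + 7) * (l + 2) * h0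

/-- Normalization rescales the unsymmetric coefficients for `P_ℓ` by ratios of square roots. This
identity and the next recover both of them from the single symmetric entry of `A`. -/
lemma coupling_add_two_mul_sqrt (l : ℕ) :
    coupling l (l + 2) * √(2 * l + 5) =
      -(√(2 * l + 1) * (((l : ℝ) + 1) * (l + 2) / ((2 * l + 1) * (2 * l + 3)))) := by
  have h1 : √(2 * (l : ℝ) + 1) ≠ 0 := (Real.sqrt_pos.2 (by positivity)).ne'
  have h5 : √(2 * (l : ℝ) + 5) ≠ 0 := (Real.sqrt_pos.2 (by positivity)).ne'
  have h1' : √(2 * (l : ℝ) + 1) ^ 2 = 2 * l + 1 := Real.sq_sqrt (by positivity)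
  simp only [coupling, show ¬ l = l + 2 by omega, if_false, if_true]
  have h3 : 2 * (l : ℝ) + 1 ≠ 0 := by positivity
  field_simp
  rw [mul_comm (l : ℝ) 2, h1']

lemma coupling_add_two_mul_sqrt' (l : ℕ) :
    coupling l (l + 2) * √(2 * l + 1) =
      -(√(2 * l + 5) * (((l : ℝ) + 1) * (l + 2) / ((2 * l + 5) * (2 * l + 3)))) := by
  have h1 : √(2 * (l : ℝ) + 1) ≠ 0 := (Real.sqrt_pos.2 (by positivity)).ne'
  have h5 : √(2 * (l : ℝ) + 5) ≠ 0 := (Real.sqrt_pos.2 (by positivity)).ne'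
  have h5' : √(2 * (l : ℝ) + 5) ^ 2 = 2 * l + 5 := Real.sq_sqrt (by positivity)
  simp only [coupling, show ¬ l = l + 2 by omega, if_false, if_true]
  have h3 : 2 * (l : ℝ) + 5 ≠ 0 := by positivity
  field_simp
  rw [mul_comm (l : ℝ) 2, h5']

/-- The columns of `A` are the coefficients of multiplication by `1 - x²`. The band reaches only `m
± 2`, so a finite sum beyond `m + 2` suffices; `m = 0` and `m = 1` have no lower neighbour and are
checked directly. -/
lemma normLegendre_coupling {m N : ℕ} (hN : m + 2 < N) (x : ℝ) :
    ∑ l ∈ Finset.range N, coupling l m * normLegendre l x = (1 - x ^ 2) * normLegendre m x := by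
  have h1 : ∀ l, coupling l m * normLegendre l x =
      (if l = m then coupling m m * normLegendre m x else 0) +
      (if m = l + 2 then coupling l (l + 2) * normLegendre l x else 0) +
      (if l = m + 2 then coupling m (m + 2) * normLegendre (m + 2) x else 0) := by
    intro l
    rw [coupling_eq_ite]
    split_ifs with h2 h3 h4 h3 <;> first | (exfalso; omega) | (subst_vars; simp)
  rw [Finset.sum_congr rfl fun l _ => h1 l]
  simp only [Finset.sum_add_distrib]
  rw [Finset.sum_ite_eq' (Finset.range N) m, Finset.sum_ite_eq' (Finset.range N) (m + 2),
    if_pos (by simp; omega), if_pos (by simp; omega)]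
  have hup : coupling m (m + 2) * normLegendre (m + 2) x = -(√(2 * m + 1) *
      (((m : ℝ) + 1) * (m + 2) / ((2 * m + 1) * (2 * m + 3)))) * (legendre (m + 2)).eval x := by
    rw [← coupling_add_two_mul_sqrt, normLegendre]
    push_cast
    ring_nf
  rw [hup]
  match m with
  | 0 =>
    rw [Finset.sum_eq_zero fun l _ => by simp]
    simp only [normLegendre, coupling_self, legendre]
    simp
    ring
  | 1 =>
    rw [Finset.sum_eq_zero fun l _ => if_neg (by omega)]
    have h2 := eval_legendre_recurrence 1 x
    have h3 := eval_legendre_recurrence 0 x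
    simp only [normLegendre, coupling_self, legendre] at *
    simp at *
    norm_num at *
    ring
  | k + 2 =>
    have h2 : ∀ l, (if k + 2 = l + 2 then coupling l (l + 2) * normLegendre l x else 0) =
        if l = k then coupling k (k + 2) * normLegendre k x else 0 := by
      intro l
      split_ifs with h3 h4 h4 <;> first | (exfalso; omega) | (subst_vars; simp)
    simp only [h2]
    rw [Finset.sum_ite_eq', if_pos (by simp; omega)]
    have hdown : coupling k (k + 2) * normLegendre k x = -(√(2 * k + 5) *
        (((k : ℝ) + 1) * (k + 2) / ((2 * k + 5) * (2 * k + 3)))) * (legendre k).eval x := by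
      rw [← coupling_add_two_mul_sqrt', normLegendre, mul_assoc]
    rw [hdown]
    simp only [normLegendre]
    have h3 := eval_legendre_two_steps k x
    push_cast
    have e5 : 2 * ((k : ℝ) + 2) + 1 = 2 * k + 5 := by ring
    have e7 : 2 * ((k : ℝ) + 2) + 3 = 2 * k + 7 := by ring
    rw [e5, e7]
    linear_combination -√(2 * (k : ℝ) + 5) * h3

end Legendre

/-! ### Test functions and the momentum operators -/

section Momentum

variable {V : Type*} [NormedAddCommGroup V] [NormedSpace ℝ V]

/-- Smooth functions with compact support. -/
structure IsTest (f : V → ℂ) : Prop where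
  contDiff : ContDiff ℝ ∞ f
  hasCompactSupport : HasCompactSupport f

lemma IsTest.zero : IsTest (0 : V → ℂ) := ⟨contDiff_const, HasCompactSupport.zero⟩

lemma IsTest.add {f g : V → ℂ} (hf : IsTest f) (hg : IsTest g) : IsTest (f + g) :=
  ⟨hf.1.add hg.1, hf.2.add hg.2⟩

lemma IsTest.smul {f : V → ℂ} (hf : IsTest f) (c : ℂ) : IsTest (c • f) :=
  ⟨hf.1.const_smul c, hf.2.smul_left (f := fun _ => c)⟩

lemma IsTest.mul_left {f g : V → ℂ} (hf : IsTest f) (hg : ContDiff ℝ ∞ g) :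
    IsTest fun x => g x * f x :=
  ⟨hg.mul hf.1, hf.2.mul_left⟩

lemma IsTest.sum {ι : Type*} {s : Finset ι} {f : ι → V → ℂ} (hf : ∀ i ∈ s, IsTest (f i)) :
    IsTest (∑ i ∈ s, f i) :=
  Finset.sum_induction _ IsTest (fun _ _ => IsTest.add) IsTest.zero hf

lemma IsTest.differentiable {f : V → ℂ} (hf : IsTest f) : Differentiable ℝ f :=
  hf.1.differentiable (by simp)

lemma IsTest.continuous {f : V → ℂ} (hf : IsTest f) : Continuous f := hf.1.continuous

lemma IsTest.momentum {f : V → ℂ} (hf : IsTest f) (e : V) : IsTest (momentum e f) :=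
  ⟨contDiff_const.mul ((hf.1.fderiv_right (by simp)).clm_apply contDiff_const),
    (hf.2.fderiv_apply ℝ e).mul_left⟩

lemma momentum_add {f g : V → ℂ} (hf : Differentiable ℝ f) (hg : Differentiable ℝ g) (e : V) :
    momentum e (f + g) = momentum e f + momentum e g := by
  ext x
  simp [momentum, fderiv_add (hf x) (hg x), mul_add]

lemma momentum_smul (f : V → ℂ) (c : ℂ) (e : V) :
    momentum e (c • f) = c • momentum e f := by
  ext x
  simp only [momentum, fderiv_const_smul_field, Pi.smul_apply, smul_apply, smul_eq_mul]
  ring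

lemma momentum_momentum_apply (e : V) (f : V → ℂ) (x : V) :
    momentum e (momentum e f) x = -fderiv ℝ (fun y => fderiv ℝ f y e) x e := by
  have h : momentum e f = (-Complex.I) • fun x => fderiv ℝ f x e := rfl
  rw [momentum, h, fderiv_const_smul_field]
  simp only [Pi.smul_apply, smul_apply, smul_eq_mul]
  linear_combination Complex.I_mul_I * fderiv ℝ (fun x => fderiv ℝ f x e) x e

variable [MeasurableSpace V] [BorelSpace V] {μ : Measure V}

lemma IsTest.memLp [IsFiniteMeasureOnCompacts μ] {f : V → ℂ} (hf : IsTest f) (p : ENNReal) :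
    MemLp f p μ :=
  hf.continuous.memLp_of_hasCompactSupport hf.2

lemma IsTest.integrable_conj_mul [IsFiniteMeasureOnCompacts μ] {f g : V → ℂ} (hf : IsTest f)
    (hg : IsTest g) : Integrable (fun x => starRingEnd ℂ (f x) * g x) μ :=
  ((Complex.continuous_conj.comp hf.continuous).mul hg.continuous).integrable_of_hasCompactSupport
    hg.2.mul_left

variable [FiniteDimensional ℝ V] [μ.IsAddHaarMeasure]

/-- The momentum operators are symmetric. -/
lemma IsTest.integral_conj_mul_momentum {f g : V → ℂ} (hf : IsTest f) (hg : IsTest g) (e : V) :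
    ∫ x, starRingEnd ℂ (f x) * MatrixModel.momentum e g x ∂μ =
      ∫ x, starRingEnd ℂ (MatrixModel.momentum e f x) * g x ∂μ := by
  -- Conjugation is only real linear, so integration by parts uses the pairing as a real bilinear
  -- map. The minus sign it produces is absorbed by conjugating the factor `-i`.
  let B : ℂ →L[ℝ] ℂ →L[ℝ] ℂ :=
    (ContinuousLinearMap.mul ℝ ℂ).comp (Complex.conjCLE : ℂ →L[ℝ] ℂ)
  have hB : ∀ a b, B a b = starRingEnd ℂ a * b := fun _ _ => rfl
  have key := integral_bilinear_fderiv_right_eq_neg_left_of_integrable (μ := μ) (f := f) (g := g)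
    (v := e) (B := B) ?_ ?_ ?_ (fun x _ => hf.differentiable x) (fun x _ => hg.differentiable x)
  · simp only [hB] at key
    simp only [MatrixModel.momentum, map_mul, map_neg, Complex.conj_I, neg_neg]
    calc _ = ∫ x, -Complex.I * (starRingEnd ℂ (f x) * fderiv ℝ g x e) ∂μ := by
          congr 1; ext x; ring
      _ = ∫ x, Complex.I * (starRingEnd ℂ (fderiv ℝ f x e) * g x) ∂μ := by
          rw [integral_const_mul, integral_const_mul, key]; ring
      _ = _ := by congr 1; ext x; ring
  · have := ((hf.momentum e).integrable_conj_mul (μ := μ) hg).const_mul (-Complex.I)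
    refine this.congr (Eventually.of_forall fun x => ?_)
    simp only [hB, MatrixModel.momentum, map_mul, map_neg, Complex.conj_I, neg_neg]
    linear_combination (-(starRingEnd ℂ (fderiv ℝ f x e) * g x)) * Complex.I_mul_I
  · have := (hf.integrable_conj_mul (μ := μ) (hg.momentum e)).const_mul Complex.I
    refine this.congr (Eventually.of_forall fun x => ?_)
    simp only [hB, MatrixModel.momentum]
    linear_combination (-(starRingEnd ℂ (f x) * fderiv ℝ g x e)) * Complex.I_mul_I
  · exact hf.integrable_conj_mul hg

end Momentum

/-! ### The Hamiltonian in coordinates -/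

section Hamiltonian

/-- The kinetic energy `(p⁽¹⁾)² + (p⁽²⁾)²`. -/
def kinetic (f : Config → ℂ) (x : Config) : ℂ :=
  ∑ i, ∑ a, momentum (direction i a) (momentum (direction i a) f) x

/-- The potential `(x⁽¹⁾ × x⁽²⁾)²`. -/
def potential (x : Config) : ℝ := ((x 0).ofLp ⨯₃ (x 1).ofLp) ⬝ᵥ ((x 0).ofLp ⨯₃ (x 1).ofLp)

/-- Lagrange's identity for the cross product; it exposes the dependence on lengths and angle alone.
-/
lemma potential_eq (x : Config) :
    potential x = ‖x 0‖ ^ 2 * ‖x 1‖ ^ 2 - (inner ℝ (x 0) (x 1)) ^ 2 := by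
  rw [potential, cross_dot_cross, EuclideanSpace.norm_sq_eq, EuclideanSpace.norm_sq_eq]
  simp only [PiLp.inner_apply, dotProduct, Fin.sum_univ_three, Real.norm_eq_abs, sq_abs,
    RCLike.inner_apply, conj_trivial]
  ring

lemma potential_nonneg (x : Config) : 0 ≤ potential x := by
  simp only [potential, dotProduct]
  exact Finset.sum_nonneg fun i _ => mul_self_nonneg _

lemma trace_conj_generator_mul (a b : Fin 3) :
    ((generator a).map star * (generator b).map star).trace = if a = b then 1 / 2 else 0 := by
  fin_cases a <;> fin_cases b <;>
    simp [generator, pauli, Matrix.trace_fin_two, Matrix.mul_apply, Fin.sum_univ_two, map_ofNat] <;>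
    ring_nf <;> norm_num [Complex.I_sq]

lemma toMatrix_eq (v : EuclideanSpace ℝ (Fin 3)) : toMatrix v =
    (1 / 2 : ℂ) • !![(v 2 : ℂ), v 0 - Complex.I * v 1; v 0 + Complex.I * v 1, -v 2] := by
  ext i j
  fin_cases i <;> fin_cases j <;>
    simp [toMatrix, generator, pauli, Fin.sum_univ_three] <;> ring

/-- The commutator is `i` times the matrix with coordinates `v × w`, and `Tr (t_a t_b) = δ_ab / 2`.
-/
lemma trace_lie_sq (v w : EuclideanSpace ℝ (Fin 3)) :
    (⁅toMatrix v, toMatrix w⁆ ^ 2).trace =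
      -(1 / 2) * (((v.ofLp ⨯₃ w.ofLp) ⬝ᵥ (v.ofLp ⨯₃ w.ofLp) : ℝ) : ℂ) := by
  rw [toMatrix_eq, toMatrix_eq, Ring.lie_def, sq]
  simp [Matrix.trace_fin_two, cross_apply, dotProduct,
    Fin.sum_univ_three]
  ring_nf
  simp only [Complex.I_sq]
  ring

/-- The trace normalization gives the kinetic term the factor `1/4`. In the potential the diagonal
commutators vanish and the two off-diagonal ones add to the same `1/4`. -/
theorem four_mul_hamiltonian (f : Config → ℂ) (x : Config) :
    4 * hamiltonian f x = kinetic f x + potential x * f x := by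
  have h1 := cross_anticomm (x 1).ofLp (x 0).ofLp
  simp only [hamiltonian, kinetic, trace_conj_generator_mul, ite_mul, zero_mul,
    Finset.sum_ite_eq, Finset.mem_univ, if_true, Fin.sum_univ_two, trace_lie_sq,
    Fin.sum_univ_three, potential, cross_self, ← h1, zero_dotProduct, neg_dotProduct_neg]
  push_cast
  ring

lemma contDiff_potential : ContDiff ℝ ∞ potential := by
  have h : potential = fun x : Config => ‖x 0‖ ^ 2 * ‖x 1‖ ^ 2 - (inner ℝ (x 0) (x 1)) ^ 2 :=
    funext potential_eq
  rw [h]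
  have h0 : ContDiff ℝ ∞ fun x : Config => x 0 := contDiff_apply _ _ 0
  have h1 : ContDiff ℝ ∞ fun x : Config => x 1 := contDiff_apply _ _ 1
  exact ((h0.norm_sq ℝ).mul (h1.norm_sq ℝ)).sub ((h0.inner ℝ h1).pow 2)

variable {f g : Config → ℂ}

lemma IsTest.kinetic (hf : IsTest f) : IsTest (kinetic f) := by
  have : MatrixModel.kinetic f =
      ∑ i, ∑ a, MatrixModel.momentum (direction i a) (MatrixModel.momentum (direction i a) f) := by
    ext x; simp [MatrixModel.kinetic]
  rw [this]
  exact IsTest.sum fun i _ => IsTest.sum fun a _ => (hf.momentum _).momentum _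

lemma IsTest.potential_mul (hf : IsTest f) : IsTest fun x => (potential x : ℂ) * f x :=
  hf.mul_left (Complex.ofRealCLM.contDiff.comp contDiff_potential)

lemma kinetic_add (hf : IsTest f) (hg : IsTest g) :
    kinetic (f + g) = kinetic f + kinetic g := by
  ext x
  simp only [kinetic, Pi.add_apply, ← Finset.sum_add_distrib]
  refine Finset.sum_congr rfl fun i _ => Finset.sum_congr rfl fun a _ => ?_
  rw [momentum_add hf.differentiable hg.differentiable, momentum_add
    (hf.momentum _).differentiable (hg.momentum _).differentiable, Pi.add_apply]

lemma kinetic_smul (c : ℂ) : kinetic (c • f) = c • kinetic f := by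
  ext x
  simp only [kinetic, Pi.smul_apply, Finset.smul_sum, momentum_smul]

lemma integral_conj_mul_kinetic (hf : IsTest f) (hg : IsTest g) :
    ∫ x, starRingEnd ℂ (f x) * kinetic g x =
      ∑ i, ∑ a, ∫ x, starRingEnd ℂ (momentum (direction i a) f x) *
        momentum (direction i a) g x := by
  simp only [kinetic, Finset.mul_sum]
  have hi : ∀ i a, Integrable fun x => starRingEnd ℂ (f x) *
      momentum (direction i a) (momentum (direction i a) g) x := fun i a =>
    hf.integrable_conj_mul ((hg.momentum _).momentum _)
  rw [integral_finsetSum _ fun i _ => integrable_finsetSum _ fun a _ => hi i a]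
  refine Finset.sum_congr rfl fun i _ => ?_
  rw [integral_finsetSum _ fun a _ => hi i a]
  exact Finset.sum_congr rfl fun a _ => hf.integral_conj_mul_momentum (hg.momentum _) _

lemma integral_kinetic_symm (hf : IsTest f) (hg : IsTest g) :
    ∫ x, starRingEnd ℂ (f x) * kinetic g x = ∫ x, starRingEnd ℂ (kinetic f x) * g x := by
  have h1 : ∫ x, starRingEnd ℂ (kinetic f x) * g x =
      starRingEnd ℂ (∫ x, starRingEnd ℂ (g x) * kinetic f x) := by
    rw [← integral_conj]
    congr 1; ext x; simp [mul_comm]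
  rw [h1, integral_conj_mul_kinetic hf hg, integral_conj_mul_kinetic hg hf, map_sum]
  refine Finset.sum_congr rfl fun i _ => ?_
  rw [map_sum]
  refine Finset.sum_congr rfl fun a _ => ?_
  rw [← integral_conj]
  congr 1; ext x; simp [mul_comm]

lemma inner_eq_integral {α : Type*} [MeasurableSpace α] {μ : Measure α} {u v : Lp ℂ 2 μ}
    {f g : α → ℂ} (hu : u =ᵐ[μ] f) (hv : v =ᵐ[μ] g) :
    ⟪u, v⟫_ℂ = ∫ x, starRingEnd ℂ (f x) * g x ∂μ := by
  rw [L2.inner_def]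
  refine integral_congr_ae ?_
  filter_upwards [hu, hv] with x h1 h2
  rw [h1, h2, RCLike.inner_apply, mul_comm]

/-- The graph of `4 H` on test functions. -/
def scaledGraph : Submodule ℂ (StateSpace × StateSpace) where
  carrier := {p | ∃ f : Config → ℂ, IsTest f ∧ p.1 =ᵐ[volume] f ∧
    p.2 =ᵐ[volume] fun x => kinetic f x + potential x * f x}
  zero_mem' := by
    refine ⟨0, IsTest.zero, Lp.coeFn_zero _ _ _, ?_⟩
    have h : kinetic 0 = 0 := by simpa using kinetic_smul (f := 0) 0
    exact (Lp.coeFn_zero ℂ 2 (volume : Measure Config)).trans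
      (Eventually.of_forall fun x => by simp [h])
  add_mem' := by
    rintro p q ⟨f, hf, hp1, hp2⟩ ⟨g, hg, hq1, hq2⟩
    refine ⟨f + g, hf.add hg, (Lp.coeFn_add _ _).trans (hp1.add hq1),
      (Lp.coeFn_add _ _).trans ((hp2.add hq2).trans (Eventually.of_forall fun x => ?_))⟩
    simp only [kinetic_add hf hg, Pi.add_apply]
    ring
  smul_mem' := by
    rintro c p ⟨f, hf, hp1, hp2⟩
    refine ⟨c • f, hf.smul c, (Lp.coeFn_smul _ _).trans (hp1.const_smul c),
      (Lp.coeFn_smul _ _).trans ((hp2.const_smul c).trans (Eventually.of_forall fun x => ?_))⟩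
    simp only [kinetic_smul, Pi.smul_apply, smul_eq_mul]
    ring

lemma IsTest.scaled (hf : IsTest f) :
    IsTest fun x => MatrixModel.kinetic f x + potential x * f x :=
  hf.kinetic.add hf.potential_mul

/-- A test function as an element of the state space. -/
def IsTest.toState (hf : IsTest f) : StateSpace := MemLp.toLp f (hf.memLp 2)

lemma IsTest.coeFn_toState (hf : IsTest f) : hf.toState =ᵐ[volume] f := MemLp.coeFn_toLp _

lemma IsTest.mem_scaledGraph (hf : IsTest f) :
    (hf.toState, hf.scaled.toState) ∈ scaledGraph :=
  ⟨f, hf, hf.coeFn_toState, hf.scaled.coeFn_toState⟩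

/-- Integration by parts makes the form a sum of `‖p f‖²` plus the integral of a nonnegative
potential times `|f|²`. Density of the test functions is the fundamental lemma of the calculus of
variations. -/
lemma isNonnegSymmetric_scaledGraph : IsNonnegSymmetric scaledGraph where
  symm := by
    rintro p ⟨f, hf, hp1, hp2⟩ q ⟨g, hg, hq1, hq2⟩
    rw [inner_eq_integral hp1 hq2, inner_eq_integral hp2 hq1]
    simp only [mul_add, map_add, add_mul]
    rw [integral_add (hf.integrable_conj_mul hg.kinetic) (hf.integrable_conj_mul hg.potential_mul),
      integral_add (hf.kinetic.integrable_conj_mul hg) (hf.potential_mul.integrable_conj_mul hg),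
      integral_kinetic_symm hf hg]
    congr 2
    ext x
    simp
    ring
  nonneg := by
    rintro p ⟨f, hf, hp1, hp2⟩
    rw [inner_eq_integral hp1 hp2]
    simp only [mul_add]
    rw [integral_add (hf.integrable_conj_mul hf.kinetic) (hf.integrable_conj_mul hf.potential_mul),
      integral_conj_mul_kinetic hf hf]
    have hpos : ∀ h : Config → ℝ, (∀ x, 0 ≤ h x) → 0 ≤ (∫ x, (h x : ℂ)).re := fun h hh => by
      rw [integral_complex_ofReal, Complex.ofReal_re]
      exact integral_nonneg hh
    have e1 : ∀ h : Config → ℂ, (∫ x, starRingEnd ℂ (h x) * h x) = ∫ x, ((‖h x‖ ^ 2 : ℝ) : ℂ) := by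
      intro h
      congr 1; ext x
      rw [Complex.conj_mul']
      push_cast; rfl
    have e2 : (∫ x, starRingEnd ℂ (f x) * (potential x * f x)) =
        ∫ x, ((potential x * ‖f x‖ ^ 2 : ℝ) : ℂ) := by
      congr 1; ext x
      push_cast
      rw [← Complex.conj_mul']
      ring
    rw [Complex.add_re, Complex.re_sum]
    refine add_nonneg (Finset.sum_nonneg fun i _ => ?_) ?_
    · rw [Complex.re_sum]
      refine Finset.sum_nonneg fun a _ => ?_
      rw [e1]
      exact hpos _ fun x => by positivity
    · rw [e2]
      exact hpos _ fun x => mul_nonneg (potential_nonneg x) (by positivity)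
  dense := by
    have h : (Prod.fst '' (scaledGraph : Set (StateSpace × StateSpace))) =
        (scaledGraph.map (LinearMap.fst ℂ StateSpace StateSpace) : Set StateSpace) := rfl
    rw [h, Submodule.dense_iff_topologicalClosure_eq_top, Submodule.topologicalClosure_eq_top_iff,
      Submodule.eq_bot_iff]
    intro v hv
    rw [Submodule.mem_orthogonal] at hv
    refine (Lp.eq_zero_iff_ae_eq_zero).2 ?_
    refine ae_eq_zero_of_integral_contDiff_smul_eq_zero
      ((Lp.memLp v).locallyIntegrable (by norm_num)) fun g hg hgs => ?_
    have ht : IsTest fun x => (g x : ℂ) :=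
      ⟨Complex.ofRealCLM.contDiff.comp hg, hgs.comp_left (g := Complex.ofReal) (by simp)⟩
    have := hv _ ⟨_, ht.mem_scaledGraph, rfl⟩
    rw [LinearMap.fst_apply, inner_eq_integral ht.coeFn_toState (ae_eq_refl _)] at this
    simpa using this

end Hamiltonian

/-! ### Relative coordinates -/

section Coordinates

/-- The measure of `L²(ℝ⁺) ⊗ L²(ℝ⁺)`. -/
abbrev radialMeasure : Measure (ℝ × ℝ) :=
  ((volume : Measure ℝ).restrict (Ioi 0)).prod ((volume : Measure ℝ).restrict (Ioi 0))

/-- The measure `dr₁ dr₂ dc` on `(0, ∞) × (0, ∞) × (-1, 1)`. -/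
abbrev relMeasure : Measure ((ℝ × ℝ) × ℝ) :=
  radialMeasure.prod ((volume : Measure ℝ).restrict (Ioo (-1) 1))

/-- The lengths of the two vectors. -/
def radii (x : Config) : ℝ × ℝ := (‖x 0‖, ‖x 1‖)

/-- The cosine of the angle between the two vectors. -/
def cosAngle (x : Config) : ℝ := inner ℝ (x 0) (x 1) / (‖x 0‖ * ‖x 1‖)

/-- The lengths of the two vectors and the cosine of their angle. -/
def relCoords (x : Config) : (ℝ × ℝ) × ℝ := (radii x, cosAngle x)

lemma continuous_radii : Continuous radii := by unfold radii; fun_prop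

lemma measurable_cosAngle : Measurable cosAngle := by
  unfold cosAngle
  have h0 : Measurable fun x : Config => x 0 := measurable_pi_apply 0
  have h1 : Measurable fun x : Config => x 1 := measurable_pi_apply 1
  exact (h0.inner h1).div (h0.norm.mul h1.norm)

lemma measurable_relCoords : Measurable relCoords :=
  continuous_radii.measurable.prodMk measurable_cosAngle

open Real in
lemma lintegral_sin_mul_comp_cos (Φ : ℝ → ENNReal) :
    ∫⁻ θ in Ioo 0 π, ENNReal.ofReal (sin θ) * Φ (cos θ) = ∫⁻ c in Ioo (-1) 1, Φ c := by
  have himg : cos '' Ioo 0 π = Ioo (-1) 1 := by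
    ext c
    constructor
    · rintro ⟨θ, ⟨h0, h1⟩, rfl⟩
      have hs := sin_pos_of_pos_of_lt_pi h0 h1
      have := sin_sq_add_cos_sq θ
      constructor <;> nlinarith [neg_one_le_cos θ, cos_le_one θ]
    · rintro ⟨h0, h1⟩
      refine ⟨arccos c, ⟨arccos_pos.2 h1, ?_⟩, cos_arccos h0.le h1.le⟩
      refine (arccos_le_pi c).lt_of_ne fun h => ?_
      rw [arccos_eq_pi] at h
      linarith
  rw [← himg, lintegral_image_eq_lintegral_abs_deriv_mul measurableSet_Ioo
    (fun θ _ => (hasDerivAt_cos θ).hasDerivWithinAt) (injOn_cos.mono Ioo_subset_Icc_self)]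
  refine setLIntegral_congr_fun measurableSet_Ioo fun θ hθ => ?_
  simp only [abs_neg, abs_of_pos (sin_pos_of_pos_of_lt_pi hθ.1 hθ.2)]

open Real in
lemma lintegral_comp_sqrt_add_sq (F : ℝ → ENNReal) (hF : Measurable F) :
    ∫⁻ y : ℝ × ℝ, F (y.1 ^ 2 + y.2 ^ 2) =
      ENNReal.ofReal (2 * π) * ∫⁻ s in Ioi 0, ENNReal.ofReal s * F (s ^ 2) := by
  rw [← lintegral_comp_polarCoord_symm]
  have h : ∀ p : ℝ × ℝ, (polarCoord.symm p).1 ^ 2 + (polarCoord.symm p).2 ^ 2 = p.1 ^ 2 := by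
    intro p
    simp only [polarCoord_symm_apply]
    linear_combination p.1 ^ 2 * sin_sq_add_cos_sq p.2
  simp only [h, smul_eq_mul, polarCoord_target]
  rw [Measure.volume_eq_prod, ← Measure.prod_restrict, lintegral_prod _ (by fun_prop)]
  simp only [lintegral_const, Measure.restrict_apply MeasurableSet.univ, univ_inter, volume_Ioo]
  rw [lintegral_mul_const _ (by fun_prop), mul_comm]
  ring_nf

open Real in
-- Polar coordinates with the domain of integration cut to positive second coordinate, which
-- restricts the angle from `(-π, π)` to `(0, π)`.
lemma lintegral_halfPlane (G : ℝ × ℝ → ENNReal) (hG : Measurable G) :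
    ∫⁻ z, ∫⁻ s in Ioi 0, G (z, s) =
      ∫⁻ r in Ioi 0, ∫⁻ θ in Ioo 0 π, ENNReal.ofReal r * G (r * cos θ, r * sin θ) := by
  have h1 : ∫⁻ z, ∫⁻ s in Ioi 0, G (z, s) =
      ∫⁻ p : ℝ × ℝ, (univ ×ˢ Ioi (0 : ℝ)).indicator G p := by
    rw [lintegral_indicator (MeasurableSet.univ.prod measurableSet_Ioi), Measure.volume_eq_prod,
      ← Measure.prod_restrict, lintegral_prod _ (by fun_prop), Measure.restrict_univ]
  rw [h1, ← lintegral_comp_polarCoord_symm, polarCoord_target, Measure.volume_eq_prod,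
    ← Measure.prod_restrict, lintegral_prod]
  · refine setLIntegral_congr_fun measurableSet_Ioi fun r hr => ?_
    have h2 : ∀ θ ∈ Ioo (-π) π, ENNReal.ofReal r •
        (univ ×ˢ Ioi (0 : ℝ)).indicator G (polarCoord.symm (r, θ)) =
        (Ioo 0 π).indicator (fun θ => ENNReal.ofReal r * G (r * cos θ, r * sin θ)) θ := by
      intro θ hθ
      simp only [polarCoord_symm_apply, smul_eq_mul]
      by_cases h0 : 0 < θ
      · have hs := sin_pos_of_pos_of_lt_pi h0 hθ.2
        rw [indicator_of_mem, indicator_of_mem]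
        · exact ⟨h0, hθ.2⟩
        · exact ⟨mem_univ _, mul_pos hr hs⟩
      · have hs := sin_nonpos_of_nonpos_of_neg_pi_le (not_lt.1 h0) hθ.1.le
        rw [indicator_of_notMem, indicator_of_notMem, mul_zero]
        · exact fun h => h0 h.1
        · exact fun h => (mul_nonpos_of_nonneg_of_nonpos (le_of_lt hr) hs).not_gt h.2
    rw [setLIntegral_congr_fun measurableSet_Ioo h2, lintegral_indicator measurableSet_Ioo,
      Measure.restrict_restrict measurableSet_Ioo]
    congr 2
    exact inter_eq_left.2 (Ioo_subset_Ioo_left (by linarith [pi_pos]))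
  · refine Measurable.aemeasurable ?_
    have h3 : Measurable fun p : ℝ × ℝ => polarCoord.symm p := by
      simp only [polarCoord_symm_apply]
      fun_prop
    have h4 := (hG.indicator (MeasurableSet.univ.prod (measurableSet_Ioi (a := (0 : ℝ))))).comp h3
    simp only [smul_eq_mul]
    exact (by fun_prop : Measurable fun p : ℝ × ℝ => ENNReal.ofReal p.1).mul h4

open Real in
-- Spherical coordinates in two steps: polar coordinates in the plane orthogonal to the axis, then
-- polar coordinates in the half-plane of height and distance from the axis. The Jacobians multiply
-- to `r² sin θ`, and `c = cos θ` absorbs the sine.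
lemma lintegral_norm_coord (Φ : ℝ × ℝ → ENNReal) (hΦ : Measurable Φ) :
    ∫⁻ x : EuclideanSpace ℝ (Fin 3), Φ (‖x‖, x 2 / ‖x‖) =
      ENNReal.ofReal (2 * π) *
        ∫⁻ r in Ioi 0, ∫⁻ c in Ioo (-1) 1, ENNReal.ofReal (r ^ 2) * Φ (r, c) := by
  let F : ℝ × ℝ → ENNReal := fun p => Φ (√(p.2 + p.1 ^ 2), p.1 / √(p.2 + p.1 ^ 2))
  have hF : Measurable F := hΦ.comp (by fun_prop)
  have h1 : ∫⁻ x : EuclideanSpace ℝ (Fin 3), Φ (‖x‖, x 2 / ‖x‖) =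
      ∫⁻ z, ∫⁻ y : ℝ × ℝ, F (z, y.1 ^ 2 + y.2 ^ 2) := by
    let G : ℝ × (Fin 2 → ℝ) → ENNReal := fun p => F (p.1, p.2 0 ^ 2 + p.2 1 ^ 2)
    have hG : Measurable G := hF.comp (by fun_prop)
    have e1 : ∀ x : EuclideanSpace ℝ (Fin 3), Φ (‖x‖, x 2 / ‖x‖) =
        G (MeasurableEquiv.piFinSuccAbove (fun _ => ℝ) 2 (WithLp.ofLp x)) := by
      intro x
      have hn : ‖x‖ = √(x 0 ^ 2 + x 1 ^ 2 + x 2 ^ 2) := by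
        rw [EuclideanSpace.norm_eq, Fin.sum_univ_three]
        simp only [Real.norm_eq_abs, sq_abs]
      simp only [G, F, hn]
      rfl
    simp only [e1]
    rw [(PiLp.volume_preserving_ofLp (Fin 3)).lintegral_comp
        (f := fun y => G (MeasurableEquiv.piFinSuccAbove (fun _ => ℝ) 2 y))
        (hG.comp (MeasurableEquiv.measurable _)),
      (volume_preserving_piFinSuccAbove (fun _ : Fin 3 => ℝ) 2).lintegral_comp hG,
      Measure.volume_eq_prod, lintegral_prod _ hG.aemeasurable]
    refine lintegral_congr fun z => ?_
    exact (volume_preserving_finTwoArrow ℝ).lintegral_comp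
      (f := fun y : ℝ × ℝ => F (z, y.1 ^ 2 + y.2 ^ 2)) (hF.comp (by fun_prop))
  rw [h1]
  have h2 : ∀ z, ∫⁻ y : ℝ × ℝ, F (z, y.1 ^ 2 + y.2 ^ 2) =
      ENNReal.ofReal (2 * π) * ∫⁻ s in Ioi 0, ENNReal.ofReal s * F (z, s ^ 2) := fun z =>
    lintegral_comp_sqrt_add_sq (fun s => F (z, s)) (hF.comp (by fun_prop))
  simp only [h2]
  have hm : Measurable fun p : ℝ × ℝ => ENNReal.ofReal p.2 * F (p.1, p.2 ^ 2) :=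
    (by fun_prop : Measurable fun p : ℝ × ℝ => ENNReal.ofReal p.2).mul (hF.comp (by fun_prop))
  rw [lintegral_const_mul _ hm.lintegral_prod_right,
    lintegral_halfPlane (fun p => ENNReal.ofReal p.2 * F (p.1, p.2 ^ 2)) hm]
  congr 1
  refine setLIntegral_congr_fun measurableSet_Ioi fun r hr => ?_
  have hr0 : (0 : ℝ) < r := hr
  rw [← lintegral_sin_mul_comp_cos]
  refine setLIntegral_congr_fun measurableSet_Ioo fun θ hθ => ?_
  have e2 : √((r * sin θ) ^ 2 + (r * cos θ) ^ 2) = r := by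
    rw [show (r * sin θ) ^ 2 + (r * cos θ) ^ 2 = r ^ 2 by
      linear_combination r ^ 2 * sin_sq_add_cos_sq θ, sqrt_sq hr0.le]
  simp only [F, e2]
  rw [mul_div_cancel_left₀ _ hr0.ne', sq, ENNReal.ofReal_mul hr0.le, ENNReal.ofReal_mul hr0.le]
  ring

open Real in
-- A reflection takes the unit vector `u` to the coordinate axis and preserves lengths, inner
-- products and volume.
lemma lintegral_norm_inner {u : EuclideanSpace ℝ (Fin 3)} (hu : ‖u‖ = 1) (Φ : ℝ × ℝ → ENNReal)
    (hΦ : Measurable Φ) :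
    ∫⁻ x : EuclideanSpace ℝ (Fin 3), Φ (‖x‖, inner ℝ u x / ‖x‖) =
      ENNReal.ofReal (2 * π) *
        ∫⁻ r in Ioi 0, ∫⁻ c in Ioo (-1) 1, ENNReal.ofReal (r ^ 2) * Φ (r, c) := by
  rw [← lintegral_norm_coord Φ hΦ]
  let e : EuclideanSpace ℝ (Fin 3) := EuclideanSpace.single 2 1
  have he : ‖u‖ = ‖e‖ := by simp [e, hu]
  let L := (ℝ ∙ (u - e))ᗮ.reflection
  have hL : L u = e := Submodule.reflection_sub he
  have h1 : ∀ x, inner ℝ u x = (L x) 2 := by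
    intro x
    rw [← L.inner_map_map, hL, EuclideanSpace.inner_single_left]
    simp
  have h2 : ∀ x : EuclideanSpace ℝ (Fin 3), Φ (‖x‖, inner ℝ u x / ‖x‖) =
      (fun y : EuclideanSpace ℝ (Fin 3) => Φ (‖y‖, y 2 / ‖y‖)) (L x) := by
    intro x
    simp only [h1, L.norm_map]
  simp only [h2]
  exact L.measurePreserving.lintegral_comp
    (f := fun y : EuclideanSpace ℝ (Fin 3) => Φ (‖y‖, y 2 / ‖y‖)) (hΦ.comp (by fun_prop))

open Real in
/-- Integration of functions of the relative coordinates. -/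
theorem lintegral_comp_relCoords (Φ : (ℝ × ℝ) × ℝ → ENNReal) (hΦ : Measurable Φ) :
    ∫⁻ x, Φ (relCoords x) =
      ∫⁻ p, ENNReal.ofReal (8 * π ^ 2 * (p.1.1 ^ 2 * p.1.2 ^ 2)) * Φ p ∂relMeasure := by
  have hm : Measurable fun y : EuclideanSpace ℝ (Fin 3) × EuclideanSpace ℝ (Fin 3) =>
      Φ ((‖y.1‖, ‖y.2‖), inner ℝ y.1 y.2 / (‖y.1‖ * ‖y.2‖)) := hΦ.comp (by fun_prop)
  have h1 : ∫⁻ x, Φ (relCoords x) = ∫⁻ y : EuclideanSpace ℝ (Fin 3),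
      ∫⁻ z : EuclideanSpace ℝ (Fin 3), Φ ((‖y‖, ‖z‖), inner ℝ y z / (‖y‖ * ‖z‖)) := by
    rw [← lintegral_prod _ hm.aemeasurable, ← Measure.volume_eq_prod]
    exact (volume_preserving_finTwoArrow (EuclideanSpace ℝ (Fin 3))).lintegral_comp hm
  rw [h1]
  let Ψ : ℝ → ENNReal := fun r => ∫⁻ s in Ioi 0, ∫⁻ c in Ioo (-1) 1,
    ENNReal.ofReal (s ^ 2) * Φ ((r, s), c)
  have hm2 : Measurable fun q : (ℝ × ℝ) × ℝ => ENNReal.ofReal (q.1.2 ^ 2) * Φ q :=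
    (by fun_prop : Measurable fun q : (ℝ × ℝ) × ℝ => ENNReal.ofReal (q.1.2 ^ 2)).mul hΦ
  have hΨ : Measurable Ψ := (hm2.lintegral_prod_right').lintegral_prod_right'
  -- The second vector is integrated with the first as axis, which requires only that the first be
  -- nonzero.
  have h2 : ∀ᵐ y : EuclideanSpace ℝ (Fin 3),
      ∫⁻ z : EuclideanSpace ℝ (Fin 3), Φ ((‖y‖, ‖z‖), inner ℝ y z / (‖y‖ * ‖z‖)) =
        ENNReal.ofReal (2 * π) * Ψ ‖y‖ := by
    have : ∀ᵐ y : EuclideanSpace ℝ (Fin 3), y ≠ 0 := by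
      simp [ae_iff, measure_singleton]
    filter_upwards [this] with y hy
    have hy' : ‖y‖ ≠ 0 := norm_ne_zero_iff.2 hy
    rw [← lintegral_norm_inner (u := (‖y‖⁻¹ : ℝ) • y) 
      (by rw [norm_smul, norm_inv, norm_norm, inv_mul_cancel₀ hy'])
      (fun p => Φ ((‖y‖, p.1), p.2)) (hΦ.comp (by fun_prop))]
    refine lintegral_congr fun z => ?_
    rw [inner_smul_left]
    simp only [conj_trivial]
    congr 2
    field_simp
  -- The remaining integrand depends on the length alone, so the cosine of the first vector
  -- contributes the length `2` of `(-1, 1)`; the constant is `2π · 2π · 2 = 8π²`.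
  have hl : ∫⁻ y : EuclideanSpace ℝ (Fin 3), ENNReal.ofReal (2 * π) * Ψ ‖y‖ =
      ∫⁻ r in Ioi 0, ENNReal.ofReal (8 * π ^ 2 * r ^ 2) * Ψ r := by
    have hΨn : Measurable fun y : EuclideanSpace ℝ (Fin 3) => Ψ ‖y‖ := hΨ.comp measurable_norm
    rw [lintegral_const_mul _ hΨn,
      lintegral_norm_coord (fun p => Ψ p.1) (hΨ.comp measurable_fst), ← mul_assoc,
      ← ENNReal.ofReal_mul (by positivity), ← lintegral_const_mul]
    · refine lintegral_congr fun r => ?_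
      simp only [lintegral_const, Measure.restrict_apply MeasurableSet.univ, univ_inter, volume_Ioo]
      rw [mul_comm _ (ENNReal.ofReal (1 - -1)), ← mul_assoc, ← mul_assoc,
        ← ENNReal.ofReal_mul (by positivity), ← ENNReal.ofReal_mul (by norm_num)]
      congr 2
      ring
    · simp only [lintegral_const]
      exact ((by fun_prop : Measurable fun r : ℝ => ENNReal.ofReal (r ^ 2)).mul hΨ).mul_const _
  have hw : Measurable fun p : (ℝ × ℝ) × ℝ =>
      ENNReal.ofReal (8 * π ^ 2 * (p.1.1 ^ 2 * p.1.2 ^ 2)) * Φ p :=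
    (by fun_prop : Measurable fun p : (ℝ × ℝ) × ℝ =>
      ENNReal.ofReal (8 * π ^ 2 * (p.1.1 ^ 2 * p.1.2 ^ 2))).mul hΦ
  rw [lintegral_congr_ae h2, hl, relMeasure, lintegral_prod _ hw.aemeasurable, radialMeasure,
    lintegral_prod _ hw.lintegral_prod_right'.aemeasurable]
  refine lintegral_congr fun r => ?_
  have hm3 : Measurable fun s => ∫⁻ c in Ioo (-1) 1, ENNReal.ofReal (s ^ 2) * Φ ((r, s), c) :=
    (hm2.comp (by fun_prop : Measurable fun q : ℝ × ℝ => ((r, q.1), q.2))).lintegral_prod_right'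
  simp only [Ψ]
  rw [← lintegral_const_mul _ hm3]
  refine lintegral_congr fun t => ?_
  rw [← lintegral_const_mul]
  · refine lintegral_congr fun c => ?_
    rw [← mul_assoc, ← ENNReal.ofReal_mul (by positivity), mul_assoc]
  · exact hm2.comp (by fun_prop : Measurable fun c : ℝ => ((r, t), c))

open Real in
/-- The image of Lebesgue measure in the relative coordinates. -/
theorem map_relCoords : (volume : Measure Config).map relCoords =
    relMeasure.withDensity fun p => ENNReal.ofReal (8 * π ^ 2 * (p.1.1 ^ 2 * p.1.2 ^ 2)) := by
  refine Measure.ext_of_lintegral _ fun Φ hΦ => ?_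
  rw [lintegral_map hΦ measurable_relCoords, lintegral_comp_relCoords Φ hΦ,
    lintegral_withDensity_eq_lintegral_mul _ (by fun_prop) hΦ]
  rfl

lemma quasiMeasurePreserving_relCoords :
    Measure.QuasiMeasurePreserving relCoords volume relMeasure :=
  ⟨measurable_relCoords, by rw [map_relCoords]; exact withDensity_absolutelyContinuous _ _⟩

lemma quasiMeasurePreserving_radii :
    Measure.QuasiMeasurePreserving radii volume radialMeasure :=
  (Measure.quasiMeasurePreserving_fst (μ := radialMeasure)).comp quasiMeasurePreserving_relCoords

open Real in
/-- Integration of functions of the relative coordinates. -/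
theorem integral_comp_relCoords (Φ : (ℝ × ℝ) × ℝ → ℂ)
    (hΦ : AEStronglyMeasurable Φ relMeasure) :
    ∫ x, Φ (relCoords x) =
      ∫ p, ((8 * π ^ 2 * (p.1.1 ^ 2 * p.1.2 ^ 2) : ℝ) : ℂ) * Φ p ∂relMeasure := by
  rw [← integral_map measurable_relCoords.aemeasurable, map_relCoords,
    integral_withDensity_eq_integral_toReal_smul (by fun_prop)]
  · refine integral_congr_ae (Eventually.of_forall fun p => ?_)
    simp only
    rw [ENNReal.toReal_ofReal (by positivity), Complex.real_smul]
  · exact Eventually.of_forall fun p => ENNReal.ofReal_lt_top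
  · rw [map_relCoords]
    exact hΦ.mono_ac (withDensity_absolutelyContinuous _ _)

lemma ae_relMeasure_pos : ∀ᵐ p ∂relMeasure, 0 < p.1.1 ∧ 0 < p.1.2 ∧ -1 < p.2 ∧ p.2 < 1 := by
  have h : relMeasure = volume.restrict ((Ioi 0 ×ˢ Ioi 0) ×ˢ Ioo (-1) 1) := by
    rw [relMeasure, radialMeasure, Measure.prod_restrict, Measure.prod_restrict]
    rfl
  rw [h]
  filter_upwards [ae_restrict_mem ((measurableSet_Ioi.prod measurableSet_Ioi).prod
    measurableSet_Ioo)] with p hp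
  exact ⟨hp.1.1, hp.1.2, hp.2.1, hp.2.2⟩

end Coordinates

/-! ### The action of `SU(2)` -/

section Gauge

/-- The group `SU(2)`. -/
abbrev SU2 : Type := Matrix.specialUnitaryGroup (Fin 2) ℂ

lemma SU2.star_mul (g : SU2) : g.1ᴴ * g.1 = 1 := g.2.1.1

lemma SU2.mul_star (g : SU2) : g.1 * g.1ᴴ = 1 := g.2.1.2

/-- The rotation of `ℝ³` induced by `g`. -/
def vecAction (g : Matrix (Fin 2) (Fin 2) ℂ) (v : EuclideanSpace ℝ (Fin 3)) :
    EuclideanSpace ℝ (Fin 3) :=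
  WithLp.toLp 2 fun a => (pauli a * (g * toMatrix v * gᴴ)).trace.re

lemma gaugeAction_apply (g : Matrix (Fin 2) (Fin 2) ℂ) (x : Config) (i : Fin 2) :
    gaugeAction g x i = vecAction g (x i) := rfl

lemma toMatrix_add (v w : EuclideanSpace ℝ (Fin 3)) :
    toMatrix (v + w) = toMatrix v + toMatrix w := by
  simp [toMatrix, add_smul, Finset.sum_add_distrib]

lemma toMatrix_smul (c : ℝ) (v : EuclideanSpace ℝ (Fin 3)) :
    toMatrix (c • v) = (c : ℂ) • toMatrix v := by
  simp only [toMatrix, Finset.smul_sum, smul_smul, PiLp.smul_apply, smul_eq_mul,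
    Complex.ofReal_mul]

lemma trace_toMatrix (v : EuclideanSpace ℝ (Fin 3)) : (toMatrix v).trace = 0 := by
  rw [toMatrix_eq]
  simp [Matrix.trace_fin_two]

lemma conjTranspose_toMatrix (v : EuclideanSpace ℝ (Fin 3)) : (toMatrix v)ᴴ = toMatrix v := by
  rw [toMatrix_eq]
  ext i j
  fin_cases i <;> fin_cases j <;> simp [Matrix.conjTranspose_apply, sub_eq_add_neg]

lemma det_toMatrix (v : EuclideanSpace ℝ (Fin 3)) :
    (toMatrix v).det = ((-(1 / 4) * ‖v‖ ^ 2 : ℝ) : ℂ) := by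
  rw [toMatrix_eq, EuclideanSpace.norm_sq_eq, Fin.sum_univ_three]
  simp only [Real.norm_eq_abs, sq_abs, Matrix.det_fin_two, Matrix.smul_apply]
  simp
  linear_combination (1 / 4 : ℂ) * (v 1 : ℂ) ^ 2 * Complex.I_mul_I

/-- A traceless Hermitian matrix is recovered from its Pauli coordinates. -/
lemma toMatrix_coords {Y : Matrix (Fin 2) (Fin 2) ℂ} (hY : Yᴴ = Y) (ht : Y.trace = 0) :
    toMatrix (WithLp.toLp 2 fun a => (pauli a * Y).trace.re) = Y := by
  have h00 : starRingEnd ℂ (Y 0 0) = Y 0 0 := congrFun (congrFun hY 0) 0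
  have h11 : starRingEnd ℂ (Y 1 1) = Y 1 1 := congrFun (congrFun hY 1) 1
  have h10 : starRingEnd ℂ (Y 0 1) = Y 1 0 := congrFun (congrFun hY 1) 0
  rw [Matrix.trace_fin_two] at ht
  have h1 : Y 1 1 = -Y 0 0 := by linear_combination ht
  have h0 : (Y 0 0).im = 0 := by
    have := congrArg Complex.im h00
    simp at this
    linarith
  have key : ∀ a, (pauli a * Y).trace.re =
      ![2 * (Y 0 1).re, -(2 * (Y 0 1).im), 2 * (Y 0 0).re] a := by
    intro a
    fin_cases a <;>
      simp [pauli, Matrix.trace_fin_two, Matrix.mul_apply, Fin.sum_univ_two, h1, ← h10,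
        -Matrix.cons_mul] <;> ring
  rw [toMatrix_eq]
  simp only [key]
  ext i j
  fin_cases i <;> fin_cases j <;> simp [h1, ← h10] <;> apply Complex.ext <;> simp [h0]

lemma toMatrix_vecAction (g : SU2) (v : EuclideanSpace ℝ (Fin 3)) :
    toMatrix (vecAction g.1 v) = g.1 * toMatrix v * g.1ᴴ := by
  refine toMatrix_coords ?_ ?_
  · rw [Matrix.conjTranspose_mul, Matrix.conjTranspose_mul, Matrix.conjTranspose_conjTranspose,
      conjTranspose_toMatrix, Matrix.mul_assoc]
  · rw [Matrix.trace_mul_comm, ← Matrix.mul_assoc, g.star_mul, Matrix.one_mul, trace_toMatrix]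

lemma toMatrix_injective : Function.Injective toMatrix := by
  intro v w h
  rw [toMatrix_eq, toMatrix_eq] at h
  have h00 := congrFun (congrFun h 0) 0
  have h10 := congrFun (congrFun h 1) 0
  simp only [Matrix.smul_apply, Matrix.of_apply, Matrix.cons_val', Matrix.cons_val_zero,
    Matrix.cons_val_one, smul_eq_mul, Matrix.cons_val_fin_one] at h00 h10
  have a := congrArg Complex.re h00
  have b := congrArg Complex.re h10
  have c := congrArg Complex.im h10
  simp at a b c
  ext i
  fin_cases i <;> assumption

lemma vecAction_mul (g k : SU2) (v : EuclideanSpace ℝ (Fin 3)) :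
    vecAction (g * k).1 v = vecAction g.1 (vecAction k.1 v) := by
  apply toMatrix_injective
  rw [toMatrix_vecAction, toMatrix_vecAction, toMatrix_vecAction, Submonoid.coe_mul,
    Matrix.conjTranspose_mul]
  simp only [Matrix.mul_assoc]

/-- The squared length is a multiple of the determinant of the matrix, which conjugation preserves.
-/
lemma norm_vecAction (g : SU2) (v : EuclideanSpace ℝ (Fin 3)) : ‖vecAction g.1 v‖ = ‖v‖ := by
  have h := det_toMatrix (vecAction g.1 v)
  rw [toMatrix_vecAction, Matrix.det_mul_right_comm, g.mul_star, Matrix.one_mul, det_toMatrix] at h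
  have h2 := Complex.ofReal_injective h
  refine (pow_left_inj₀ (norm_nonneg _) (norm_nonneg _) two_ne_zero).1 ?_
  linarith

/-- The rotation of `ℝ³` induced by `g`, as a linear isometry. -/
def vecIsometry (g : SU2) : EuclideanSpace ℝ (Fin 3) ≃ₗᵢ[ℝ] EuclideanSpace ℝ (Fin 3) :=
  LinearIsometry.toLinearIsometryEquiv
    { toFun := vecAction g.1
      map_add' := fun v w => toMatrix_injective (by
        simp only [toMatrix_vecAction, toMatrix_add, Matrix.mul_add, Matrix.add_mul])
      map_smul' := fun c v => toMatrix_injective (by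
        simp only [toMatrix_vecAction, toMatrix_smul, Matrix.mul_smul, Matrix.smul_mul,
          RingHom.id_apply])
      norm_map' := norm_vecAction g } rfl

lemma vecIsometry_apply (g : SU2) (v : EuclideanSpace ℝ (Fin 3)) :
    vecIsometry g v = vecAction g.1 v := rfl

lemma gaugeAction_mul (g k : SU2) (x : Config) :
    gaugeAction (g * k).1 x = gaugeAction g.1 (gaugeAction k.1 x) :=
  funext fun i => vecAction_mul g k (x i)

lemma relCoords_gaugeAction (g : SU2) (x : Config) :
    relCoords (gaugeAction g.1 x) = relCoords x := by
  simp only [relCoords, radii, cosAngle, gaugeAction_apply, ← vecIsometry_apply,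
    LinearIsometryEquiv.norm_map, LinearIsometryEquiv.inner_map_map]

lemma measurePreserving_gaugeAction (g : SU2) :
    MeasurePreserving (gaugeAction g.1) (volume : Measure Config) volume :=
  volume_preserving_pi fun _ => (vecIsometry g).measurePreserving

lemma continuous_vecAction :
    Continuous fun p : SU2 × EuclideanSpace ℝ (Fin 3) => vecAction p.1.1 p.2 := by
  unfold vecAction
  have h1 : Continuous fun p : SU2 × EuclideanSpace ℝ (Fin 3) => toMatrix p.2 := by
    unfold toMatrix
    fun_prop
  have h2 : Continuous fun p : SU2 × EuclideanSpace ℝ (Fin 3) =>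
      (p.1.1 : Matrix (Fin 2) (Fin 2) ℂ) := by fun_prop
  refine (PiLp.continuous_toLp 2 _).comp (continuous_pi fun a => Complex.continuous_re.comp ?_)
  exact (continuous_const.matrix_mul
    ((h2.matrix_mul h1).matrix_mul h2.matrix_conjTranspose)).matrix_trace

lemma continuous_gaugeAction :
    Continuous fun p : SU2 × Config => gaugeAction p.1.1 p.2 := by
  have h1 : ∀ i, Continuous fun p : SU2 × Config => (p.1, p.2 i) := fun i =>
    continuous_fst.prodMk ((continuous_apply i).comp continuous_snd)
  have h2 : ∀ i, Continuous ((fun p : SU2 × EuclideanSpace ℝ (Fin 3) => vecAction p.1.1 p.2) ∘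
      fun p : SU2 × Config => (p.1, p.2 i)) := fun i => continuous_vecAction.comp (h1 i)
  have h3 : ∀ i, Continuous fun p : SU2 × Config => gaugeAction p.1.1 p.2 i := h2
  exact continuous_pi h3

/-! #### Transitivity -/

lemma finrank_span_pair_le (a b : EuclideanSpace ℝ (Fin 3)) :
    Module.finrank ℝ (Submodule.span ℝ ({a, b} : Set (EuclideanSpace ℝ (Fin 3)))) ≤ 2 := by
  classical
  have := finrank_span_finset_le_card (R := ℝ) ({a, b} : Finset (EuclideanSpace ℝ (Fin 3)))
  rw [Set.finrank, Finset.coe_pair] at this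
  exact this.trans Finset.card_le_two

lemma orthogonal_ne_bot (S : Submodule ℝ (EuclideanSpace ℝ (Fin 3)))
    (h : Module.finrank ℝ S ≤ 2) : Sᗮ ≠ ⊥ := by
  intro h'
  have h2 := S.finrank_add_finrank_orthogonal
  rw [h', finrank_bot, finrank_euclideanSpace_fin] at h2
  omega

lemma exists_unit_orthogonal (a b : EuclideanSpace ℝ (Fin 3)) :
    ∃ n : EuclideanSpace ℝ (Fin 3), ‖n‖ = 1 ∧ inner ℝ n a = 0 ∧ inner ℝ n b = 0 := by
  obtain ⟨m, hm, hm0⟩ := (Submodule.ne_bot_iff _).1 (orthogonal_ne_bot _ (finrank_span_pair_le a b))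
  rw [Submodule.mem_orthogonal'] at hm
  have hmn : ‖m‖ ≠ 0 := norm_ne_zero_iff.2 hm0
  have hma := hm a (Submodule.subset_span (mem_insert _ _))
  have hmb := hm b (Submodule.subset_span (mem_insert_of_mem _ rfl))
  refine ⟨(‖m‖⁻¹ : ℝ) • m, by rw [norm_smul, norm_inv, norm_norm, inv_mul_cancel₀ hmn], ?_, ?_⟩
  · rw [inner_smul_left, hma, mul_zero]
  · rw [inner_smul_left, hmb, mul_zero]

/-- The witness is `i (n · σ)`, unitary of determinant one because `(n · σ)² = 1`. Half-turns are
enough for transitivity and avoid exponentials or Euler angles. -/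
lemma exists_halfTurn {n : EuclideanSpace ℝ (Fin 3)} (hn : ‖n‖ = 1) :
    ∃ g : SU2, ∀ v, vecAction g.1 v = (2 * inner ℝ n v) • n - v := by
  have hsq : n 0 ^ 2 + n 1 ^ 2 + n 2 ^ 2 = 1 := by
    have := EuclideanSpace.norm_sq_eq n
    rw [hn, Fin.sum_univ_three] at this
    simp only [Real.norm_eq_abs, sq_abs] at this
    linarith
  have hsqc : (n 0 : ℂ) ^ 2 + (n 1 : ℂ) ^ 2 + (n 2 : ℂ) ^ 2 = 1 := by
    rw [← Complex.ofReal_one, ← hsq]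
    push_cast
    rfl
  let g : Matrix (Fin 2) (Fin 2) ℂ := !![Complex.I * n 2, Complex.I * n 0 + n 1;
    Complex.I * n 0 - n 1, -(Complex.I * n 2)]
  have hgH : gᴴ = !![-(Complex.I * n 2), -(Complex.I * n 0) - n 1;
    -(Complex.I * n 0) + n 1, Complex.I * n 2] := by
    ext i j
    fin_cases i <;> fin_cases j <;> simp [g, Matrix.conjTranspose_apply, sub_eq_add_neg]
  have hI := Complex.I_mul_I
  have hmul : g * gᴴ = 1 := by
    rw [hgH]
    ext i j
    fin_cases i <;> fin_cases j <;>
      simp [g, Matrix.mul_apply, Fin.sum_univ_two] <;> grind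
  have hg : g ∈ Matrix.specialUnitaryGroup (Fin 2) ℂ := by
    rw [Matrix.mem_specialUnitaryGroup_iff, Matrix.mem_unitaryGroup_iff]
    refine ⟨hmul, ?_⟩
    simp [g, Matrix.det_fin_two]
    grind
  refine ⟨⟨g, hg⟩, fun v => toMatrix_injective ?_⟩
  rw [toMatrix_vecAction]
  dsimp only
  rw [hgH, toMatrix_eq, toMatrix_eq]
  have hin : inner ℝ n v = n 0 * v 0 + n 1 * v 1 + n 2 * v 2 := by
    simp [PiLp.inner_apply, Fin.sum_univ_three]
    ring
  ext i j
  fin_cases i <;> fin_cases j <;>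
    simp [g, Matrix.mul_apply, Fin.sum_univ_two, hin] <;> grind

/-- The half-turn about the bisector of two vectors of equal length interchanges them. -/
lemma halfTurn_swap {m v w n : EuclideanSpace ℝ (Fin 3)} (hm : m ≠ 0)
    (hn : n = (‖m‖⁻¹ : ℝ) • m) (hmv : m = v + w) (hvw : ‖v‖ = ‖w‖) :
    (2 * inner ℝ n v) • n - v = w := by
  have h1 : 2 * inner ℝ m v = ‖m‖ ^ 2 := by
    rw [hmv, ← real_inner_self_eq_norm_sq, inner_add_left, inner_add_left, inner_add_right,
      inner_add_right, real_inner_self_eq_norm_sq, real_inner_self_eq_norm_sq,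
      real_inner_comm w v, hvw]
    ring
  have h2 : ‖m‖ ≠ 0 := norm_ne_zero_iff.2 hm
  have h3 : (2 * inner ℝ n v) • n = m := by
    rw [hn, inner_smul_left, smul_smul]
    simp only [conj_trivial]
    rw [show 2 * (‖m‖⁻¹ * inner ℝ m v) * ‖m‖⁻¹ = 2 * inner ℝ m v * (‖m‖⁻¹ * ‖m‖⁻¹) by ring, h1]
    rw [show ‖m‖ ^ 2 * (‖m‖⁻¹ * ‖m‖⁻¹) = 1 by field_simp, one_smul]
  rw [h3, hmv]
  abel

/-- The axis is the bisector of `u` and `v`; if `v = -u`, any axis orthogonal to both `u` and `a`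
serves. Since `a` is orthogonal to the axis in either case, it is negated. -/
lemma exists_halfTurn_map (u v a : EuclideanSpace ℝ (Fin 3)) (huv : ‖u‖ = ‖v‖)
    (h : inner ℝ (u + v) a = 0) :
    ∃ g : SU2, vecAction g.1 u = v ∧ vecAction g.1 a = -a := by
  by_cases hm : u + v = 0
  · obtain ⟨n, hn, hnu, hna⟩ := exists_unit_orthogonal u a
    obtain ⟨g, hg⟩ := exists_halfTurn hn
    refine ⟨g, ?_, ?_⟩
    · rw [hg, hnu, mul_zero, zero_smul, zero_sub, neg_eq_of_add_eq_zero_right hm]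
    · rw [hg, hna, mul_zero, zero_smul, zero_sub]
  · have hm' : ‖u + v‖ ≠ 0 := norm_ne_zero_iff.2 hm
    obtain ⟨g, hg⟩ := exists_halfTurn (n := (‖u + v‖⁻¹ : ℝ) • (u + v))
      (by rw [norm_smul, norm_inv, norm_norm, inv_mul_cancel₀ hm'])
    refine ⟨g, ?_, ?_⟩
    · rw [hg, halfTurn_swap hm rfl rfl huv]
    · rw [hg, inner_smul_left, h, mul_zero, mul_zero, zero_smul, zero_sub]

/-- `SU(2)` acts transitively on the configurations with given lengths and angle. -/
theorem exists_gaugeAction_eq {x y : Config} (h0 : ‖x 0‖ = ‖y 0‖) (h1 : ‖x 1‖ = ‖y 1‖)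
    (h : inner ℝ (x 0) (x 1) = inner ℝ (y 0) (y 1)) : ∃ g : SU2, gaugeAction g.1 x = y := by
  -- The first half-turn aims at `-y 0` because the second one, which brings the other vector to `y
  -- 1`, negates `y 0`. With this sign the orthogonality needed for the second half-turn is equality
  -- of the inner products.
  obtain ⟨g, hg, -⟩ := exists_halfTurn_map (x 0) (-y 0) 0 (by rw [norm_neg, h0]) (by simp)
  have h2 : inner ℝ (y 0) (vecAction g.1 (x 1)) = -inner ℝ (y 0) (y 1) := by
    rw [← h, ← (vecIsometry g).inner_map_map (x 0), vecIsometry_apply, vecIsometry_apply, hg,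
      inner_neg_left, neg_neg]
  obtain ⟨k, hk, hk'⟩ := exists_halfTurn_map (vecAction g.1 (x 1)) (y 1) (y 0)
    (by rw [norm_vecAction, h1]) (by
      rw [inner_add_left, real_inner_comm, h2, real_inner_comm]
      simp)
  refine ⟨k * g, ?_⟩
  rw [gaugeAction_mul]
  funext i
  fin_cases i
  · change vecAction k.1 (vecAction g.1 (x 0)) = y 0
    rw [hg, ← vecIsometry_apply, map_neg, vecIsometry_apply, hk', neg_neg]
  · exact hk

end Gauge

/-! ### Averaging over `SU(2)` -/

section Average

attribute [local irreducible] gaugeAction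

instance : IsTopologicalGroup SU2 where
  continuous_inv := by
    refine Continuous.subtype_mk ?_ _
    exact continuous_subtype_val.matrix_conjTranspose

instance : CompactSpace SU2 := by
  refine isCompact_iff_compactSpace.1
    (a := IsCompact (Matrix.specialUnitaryGroup (Fin 2) ℂ : Set (Matrix (Fin 2) (Fin 2) ℂ))) ?_
  have hK : IsCompact (Set.pi univ fun _ : Fin 2 => Set.pi univ fun _ : Fin 2 =>
      Metric.closedBall (0 : ℂ) 1) :=
    isCompact_univ_pi fun _ => isCompact_univ_pi fun _ => isCompact_closedBall _ _
  refine hK.of_isClosed_subset ?_ fun A hA i _ j _ => ?_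
  · have h1 : IsClosed {A : Matrix (Fin 2) (Fin 2) ℂ | A * Aᴴ = 1} :=
      isClosed_eq (continuous_id.matrix_mul continuous_id.matrix_conjTranspose) continuous_const
    have h2 : IsClosed {A : Matrix (Fin 2) (Fin 2) ℂ | A.det = 1} :=
      isClosed_eq continuous_id.matrix_det continuous_const
    have h3 : (Matrix.specialUnitaryGroup (Fin 2) ℂ : Set (Matrix (Fin 2) (Fin 2) ℂ)) =
        {A | A * Aᴴ = 1} ∩ {A | A.det = 1} := by
      ext A
      simp only [SetLike.mem_coe, Matrix.mem_specialUnitaryGroup_iff, Matrix.mem_unitaryGroup_iff]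
      rfl
    rw [h3]
    exact h1.inter h2
  · rw [mem_closedBall_zero_iff]
    exact entry_norm_bound_of_unitary hA.1 i j

instance : SecondCountableTopology (Matrix (Fin 2) (Fin 2) ℂ) :=
  inferInstanceAs (SecondCountableTopology (Fin 2 → Fin 2 → ℂ))

instance : SecondCountableTopology SU2 := TopologicalSpace.Subtype.secondCountableTopology _

instance : MeasurableSpace SU2 := borel _

instance : BorelSpace SU2 := ⟨rfl⟩

/-- A right-invariant probability measure on `SU(2)`. -/
def haarSU2 : Measure SU2 := (Measure.haarMeasure (⊤ : TopologicalSpace.PositiveCompacts SU2)).inv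

instance : haarSU2.IsMulRightInvariant :=
  inferInstanceAs (Measure.haarMeasure (⊤ : TopologicalSpace.PositiveCompacts SU2)).inv.IsMulRightInvariant

instance : IsProbabilityMeasure haarSU2 := by
  constructor
  rw [haarSU2, Measure.inv_apply, inv_univ]
  exact Measure.haarMeasure_self

/-- The average of a function over the action of `SU(2)`. -/
def average (f : Config → ℂ) (x : Config) : ℂ := ∫ g : SU2, f (gaugeAction g.1 x) ∂haarSU2

/-- Right invariance of the measure absorbs `k`. The average is therefore invariant at every point,
not only almost everywhere. -/
lemma average_gaugeAction (f : Config → ℂ) (k : SU2) (x : Config) :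
    average f (gaugeAction k.1 x) = average f x := by
  simp only [average, ← gaugeAction_mul]
  exact integral_mul_right_eq_self (fun g : SU2 => f (gaugeAction g.1 x)) k

lemma stronglyMeasurable_comp_gaugeAction {f : Config → ℂ} (hf : StronglyMeasurable f) :
    StronglyMeasurable fun p : Config × SU2 => f (gaugeAction p.2.1 p.1) :=
  hf.comp_measurable (continuous_gaugeAction.comp continuous_swap).measurable

lemma stronglyMeasurable_average {f : Config → ℂ} (hf : StronglyMeasurable f) :
    StronglyMeasurable (average f) :=
  (stronglyMeasurable_comp_gaugeAction hf).integral_prod_right'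

/-- A function invariant almost everywhere under each `g` agrees with its average. -/
lemma ae_eq_average {f : Config → ℂ} (hf : StronglyMeasurable f)
    (h : ∀ g : SU2, (fun x => f (gaugeAction g.1 x)) =ᵐ[volume] f) : f =ᵐ[volume] average f := by
  have hm : MeasurableSet {p : SU2 × Config | f (gaugeAction p.1.1 p.2) = f p.2} :=
    measurableSet_eq_fun (hf.measurable.comp continuous_gaugeAction.measurable)
      (hf.measurable.comp measurable_snd)
  have h1 : ∀ᵐ g ∂haarSU2, ∀ᵐ x : Config, f (gaugeAction g.1 x) = f x :=
    Eventually.of_forall h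
  -- The null set depends on `g`; Fubini exchanges the quantifiers, so for almost every `x` the
  -- integrand is constant for almost every `g`.
  rw [Measure.ae_ae_comm hm] at h1
  filter_upwards [h1] with x hx
  rw [average, integral_congr_ae hx]
  simp

lemma gaugeAction_one (x : Config) : gaugeAction (1 : SU2).1 x = x := by
  funext i
  apply toMatrix_injective
  rw [gaugeAction_apply, toMatrix_vecAction]
  simp

lemma measurableEmbedding_gaugeAction (g : SU2) : MeasurableEmbedding (gaugeAction g.1) := by
  have hc : ∀ k : SU2, Continuous (gaugeAction k.1) := fun k =>
    continuous_gaugeAction.comp (Continuous.prodMk_right k)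
  let e : Config ≃ₜ Config :=
    { toFun := gaugeAction g.1
      invFun := gaugeAction (g⁻¹).1
      left_inv := fun x => by rw [← gaugeAction_mul, inv_mul_cancel, gaugeAction_one]
      right_inv := fun x => by rw [← gaugeAction_mul, mul_inv_cancel, gaugeAction_one]
      continuous_toFun := hc g
      continuous_invFun := hc g⁻¹ }
  exact e.measurableEmbedding

lemma integral_comp_gaugeAction {E : Type*} [NormedAddCommGroup E] [NormedSpace ℝ E] (g : SU2)
    (F : Config → E) : ∫ x, F (gaugeAction g.1 x) = ∫ x, F x :=
  (measurePreserving_gaugeAction g).integral_comp (measurableEmbedding_gaugeAction g) F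

/-- As `Φ` is invariant and the action preserves volume, the `L¹` norm of the slice is the same for
each `g`, and the group has finite measure. -/
lemma integrable_prod_mul_comp_gaugeAction {Φ f : Config → ℂ}
    (hΦ : ∀ (g : SU2) x, Φ (gaugeAction g.1 x) = Φ x)
    (hf : StronglyMeasurable f) (hΦm : StronglyMeasurable Φ)
    (hint : Integrable fun x => Φ x * f x) :
    Integrable (fun p : Config × SU2 => Φ p.1 * f (gaugeAction p.2.1 p.1))
      (volume.prod haarSU2) := by
  have hm : StronglyMeasurable fun p : Config × SU2 => Φ p.1 * f (gaugeAction p.2.1 p.1) :=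
    (hΦm.comp_measurable measurable_fst).mul (stronglyMeasurable_comp_gaugeAction hf)
  have hi : ∀ g : SU2, Integrable fun x => Φ x * f (gaugeAction g.1 x) := by
    intro g
    have := (measurePreserving_gaugeAction g).integrable_comp_of_integrable hint
    simpa [Function.comp_def, hΦ] using this
  rw [integrable_prod_iff' hm.aestronglyMeasurable]
  refine ⟨Eventually.of_forall hi, ?_⟩
  have : ∀ g : SU2, ∫ x, ‖Φ x * f (gaugeAction g.1 x)‖ = ∫ x, ‖Φ x * f x‖ := by
    intro g
    rw [← integral_comp_gaugeAction g fun x => ‖Φ x * f x‖]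
    simp only [hΦ]
  simp only [this]
  exact integrable_const _

/-- Averaging is symmetric with respect to integration against invariant functions. -/
lemma integral_mul_average {Φ f : Config → ℂ} (hΦ : ∀ (g : SU2) x, Φ (gaugeAction g.1 x) = Φ x)
    (hf : StronglyMeasurable f) (hΦm : StronglyMeasurable Φ)
    (hint : Integrable fun x => Φ x * f x) :
    ∫ x, Φ x * f x = ∫ x, Φ x * average f x := by
  have hprod := integrable_prod_mul_comp_gaugeAction hΦ hf hΦm hint
  have h1 := integral_integral_swap (f := fun x (g : SU2) => Φ x * f (gaugeAction g.1 x)) hprod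
  have h2 : ∀ g : SU2, ∫ x, Φ x * f (gaugeAction g.1 x) = ∫ x, Φ x * f x := by
    intro g
    rw [← integral_comp_gaugeAction g fun x => Φ x * f x]
    simp only [hΦ]
  simp only [h2, integral_const, integral_const_mul] at h1
  simpa [average] using h1.symm

/-! ### A section of the orbits, and singlets as functions of the relative coordinates -/

/-- A configuration with given relative coordinates, depending linearly on the lengths. -/
def sectionMap (c : ℝ) : ℝ × ℝ →L[ℝ] Config :=
  ContinuousLinearMap.pi ![
    (ContinuousLinearMap.fst ℝ ℝ ℝ).smulRight (EuclideanSpace.single 0 1),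
    (ContinuousLinearMap.snd ℝ ℝ ℝ).smulRight
      (EuclideanSpace.single 0 c + EuclideanSpace.single 1 √(1 - c ^ 2))]

lemma sectionMap_zero (c : ℝ) (r : ℝ × ℝ) :
    sectionMap c r 0 = r.1 • EuclideanSpace.single 0 1 := rfl

lemma sectionMap_one (c : ℝ) (r : ℝ × ℝ) :
    sectionMap c r 1 =
      r.2 • (EuclideanSpace.single 0 c + EuclideanSpace.single 1 √(1 - c ^ 2)) := rfl

lemma norm_sectionMap_zero (c : ℝ) (r : ℝ × ℝ) : ‖sectionMap c r 0‖ = |r.1| := by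
  rw [sectionMap_zero, norm_smul]
  simp

lemma norm_sectionMap_one {c : ℝ} (hc : |c| ≤ 1) (r : ℝ × ℝ) : ‖sectionMap c r 1‖ = |r.2| := by
  rw [sectionMap_one, norm_smul, EuclideanSpace.norm_eq, Fin.sum_univ_three]
  have : 0 ≤ 1 - c ^ 2 := by
    have := (sq_le_one_iff_abs_le_one c).2 hc
    linarith
  simp [Real.sq_sqrt this]

lemma inner_sectionMap (c : ℝ) (r : ℝ × ℝ) :
    inner ℝ (sectionMap c r 0) (sectionMap c r 1) = r.1 * r.2 * c := by
  rw [sectionMap_zero, sectionMap_one, inner_smul_left, inner_smul_right, inner_add_right]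
  simp [PiLp.inner_apply]
  ring

lemma continuous_sectionMap : Continuous fun p : (ℝ × ℝ) × ℝ => sectionMap p.2 p.1 := by
  refine continuous_pi (Fin.forall_fin_two.2 ⟨?_, ?_⟩)
  · simp only [sectionMap_zero]
    fun_prop
  · simp only [sectionMap_one]
    have h : ∀ i : Fin 3, Continuous fun c : ℝ => EuclideanSpace.single i c := fun i =>
      (PiLp.continuous_toLp 2 fun _ : Fin 3 => ℝ).comp
        (continuous_single (A := fun _ : Fin 3 => ℝ) i)
    exact continuous_fst.snd.smul (((h 0).comp continuous_snd).add
      ((h 1).comp (by fun_prop : Continuous fun p : (ℝ × ℝ) × ℝ => √(1 - p.2 ^ 2))))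

lemma abs_cosAngle_le (x : Config) : |cosAngle x| ≤ 1 := by
  rw [cosAngle, abs_div, abs_mul, abs_norm, abs_norm]
  exact div_le_one_of_le₀ (abs_real_inner_le_norm _ _) (by positivity)

/-- It holds without nondegeneracy: if a vector vanishes, both sides are zero. -/
lemma radii_mul_cosAngle (x : Config) :
    ‖x 0‖ * ‖x 1‖ * cosAngle x = inner ℝ (x 0) (x 1) := by
  rcases eq_or_ne (‖x 0‖ * ‖x 1‖) 0 with h | h
  · rw [h, zero_mul]
    have := abs_real_inner_le_norm (x 0) (x 1)
    rw [h] at this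
    exact (abs_nonpos_iff.1 this).symm
  · rw [cosAngle, mul_div_cancel₀ _ h]

/-- An invariant function is determined by its values on the section. -/
lemma eq_comp_sectionMap {F : Config → ℂ} (hF : ∀ (g : SU2) x, F (gaugeAction g.1 x) = F x)
    (x : Config) : F x = F (sectionMap (cosAngle x) (radii x)) := by
  obtain ⟨g, hg⟩ := exists_gaugeAction_eq (x := sectionMap (cosAngle x) (radii x)) (y := x)
    (by rw [norm_sectionMap_zero, radii, abs_norm])
    (by rw [norm_sectionMap_one (abs_cosAngle_le x), radii, abs_norm])
    (by rw [inner_sectionMap]; exact radii_mul_cosAngle x)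
  conv_lhs => rw [← hg]
  exact hF g _

/-- The average is a strictly invariant representative, hence is determined by its restriction to
the section, and that restriction is measurable because the section is continuous. -/
lemma exists_ae_eq_comp_relCoords {f : Config → ℂ} (hf : AEStronglyMeasurable f volume)
    (h : ∀ g : SU2, (fun x => f (gaugeAction g.1 x)) =ᵐ[volume] f) :
    ∃ φ : (ℝ × ℝ) × ℝ → ℂ, StronglyMeasurable φ ∧ f =ᵐ[volume] fun x => φ (relCoords x) := by
  obtain ⟨F, hF, hfF⟩ := hf
  have hinv : ∀ g : SU2, (fun x => F (gaugeAction g.1 x)) =ᵐ[volume] F := by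
    intro g
    have h1 := (measurePreserving_gaugeAction g).quasiMeasurePreserving.ae_eq_comp hfF
    exact (h1.symm.trans (h g)).trans hfF
  refine ⟨fun p => average F (sectionMap p.2 p.1),
    (stronglyMeasurable_average hF).comp_measurable continuous_sectionMap.measurable, ?_⟩
  refine hfF.trans ((ae_eq_average hF hinv).trans (Eventually.of_forall fun x => ?_))
  exact eq_comp_sectionMap (average_gaugeAction F) x

end Average

/-! ### Partial waves -/

section PartialWaves

open Real in
lemma integrable_comp_relCoords {Φ : (ℝ × ℝ) × ℝ → ℂ} (hΦ : AEStronglyMeasurable Φ relMeasure) :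
    Integrable (fun x => Φ (relCoords x)) ↔
      Integrable (fun p => ((8 * π ^ 2 * (p.1.1 ^ 2 * p.1.2 ^ 2) : ℝ) : ℂ) * Φ p) relMeasure := by
  have h1 : AEStronglyMeasurable Φ ((volume : Measure Config).map relCoords) := by
    rw [map_relCoords]
    exact hΦ.mono_ac (withDensity_absolutelyContinuous _ _)
  have h2 := integrable_map_measure h1 measurable_relCoords.aemeasurable
  rw [map_relCoords, integrable_withDensity_iff_integrable_smul' (by fun_prop)
    (Eventually.of_forall fun p => ENNReal.ofReal_lt_top)] at h2
  refine h2.symm.trans (integrable_congr (Eventually.of_forall fun p => ?_))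
  simp only
  rw [ENNReal.toReal_ofReal (by positivity), Complex.real_smul]

open Real in
/-- The weight of the partial wave of angular momentum `l`. -/
def waveWeight (l : ℕ) (p : (ℝ × ℝ) × ℝ) : ℝ := normLegendre l p.2 / (4 * π * (p.1.1 * p.1.2))

/-- The function on configuration space with angular momentum `l` and radial part `h`. -/
def partialWave (l : ℕ) (h : ℝ × ℝ → ℂ) (x : Config) : ℂ :=
  (waveWeight l (relCoords x) : ℂ) * h (radii x)

lemma measurable_waveWeight (l : ℕ) : Measurable (waveWeight l) := by
  have := (continuous_normLegendre l).measurable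
  unfold waveWeight
  fun_prop

lemma partialWave_congr_ae (l : ℕ) {h k : ℝ × ℝ → ℂ} (hk : h =ᵐ[radialMeasure] k) :
    partialWave l h =ᵐ[volume] partialWave l k := by
  filter_upwards [quasiMeasurePreserving_radii.ae_eq_comp hk] with x hx
  simp only [partialWave]
  rw [show h (radii x) = k (radii x) from hx]

lemma aestronglyMeasurable_partialWave (l : ℕ) {h : ℝ × ℝ → ℂ}
    (hh : AEStronglyMeasurable h radialMeasure) :
    AEStronglyMeasurable (partialWave l h) volume := by
  have h1 : Measurable fun x => ((waveWeight l (relCoords x) : ℝ) : ℂ) :=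
    Complex.measurable_ofReal.comp ((measurable_waveWeight l).comp measurable_relCoords)
  exact h1.aestronglyMeasurable.mul (hh.comp_quasiMeasurePreserving quasiMeasurePreserving_radii)

open Real in
-- This fixes the normalization of the waves: `8π² / (4π)² = 1/2`, against the value `2` of the
-- integral of a squared normalized Legendre function over `(-1, 1)`.
lemma weight_mul_waveWeight (l m : ℕ) {p : (ℝ × ℝ) × ℝ} (h0 : 0 < p.1.1) (h1 : 0 < p.1.2) :
    8 * π ^ 2 * (p.1.1 ^ 2 * p.1.2 ^ 2) * (waveWeight l p * waveWeight m p) =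
      1 / 2 * (normLegendre l p.2 * normLegendre m p.2) := by
  unfold waveWeight
  have := h0.ne'
  have := h1.ne'
  have := pi_pos.ne'
  field_simp
  ring

lemma integrableOn_normLegendre_mul (l m : ℕ) :
    Integrable (fun c => ((normLegendre l c * normLegendre m c : ℝ) : ℂ))
      ((volume : Measure ℝ).restrict (Ioo (-1) 1)) := by
  have h : Continuous fun c => ((normLegendre l c * normLegendre m c : ℝ) : ℂ) :=
    Complex.continuous_ofReal.comp
      ((continuous_normLegendre l).mul (continuous_normLegendre m))
  exact (h.integrableOn_Icc (a := -1) (b := 1)).mono_set Ioo_subset_Icc_self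

lemma memLp_partialWave (l : ℕ) {h : ℝ × ℝ → ℂ} (hh : MemLp h 2 radialMeasure) :
    MemLp (partialWave l h) 2 volume := by
  rw [memLp_two_iff_integrable_sq_norm (aestronglyMeasurable_partialWave l hh.1)]
  have hm : AEStronglyMeasurable
      (fun p : (ℝ × ℝ) × ℝ => ((waveWeight l p ^ 2 * ‖h p.1‖ ^ 2 : ℝ) : ℂ)) relMeasure := by
    refine Complex.continuous_ofReal.comp_aestronglyMeasurable ?_
    exact ((measurable_waveWeight l).pow_const 2).aestronglyMeasurable.mul
      ((hh.1.comp_fst (ν := (volume : Measure ℝ).restrict (Ioo (-1) 1))).norm.pow 2)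
  have h1 : Integrable
      (fun x => ((waveWeight l (relCoords x) ^ 2 * ‖h (radii x)‖ ^ 2 : ℝ) : ℂ)) := by
    refine (integrable_comp_relCoords hm).2 ?_
    have h2 : Integrable (fun r => ((1 / 2 * ‖h r‖ ^ 2 : ℝ) : ℂ)) radialMeasure :=
      (((memLp_two_iff_integrable_sq_norm hh.1).1 hh).const_mul (1 / 2)).ofReal
    refine (h2.mul_prod (integrableOn_normLegendre_mul l l)).congr ?_
    filter_upwards [ae_relMeasure_pos] with p hp
    have := weight_mul_waveWeight l l hp.1 hp.2.1
    norm_cast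
    linear_combination -‖h p.1‖ ^ 2 * this
  refine h1.re.congr (Eventually.of_forall fun x => ?_)
  simp only [partialWave, norm_mul, mul_pow, Complex.norm_real, Real.norm_eq_abs, sq_abs]
  exact Complex.ofReal_re _

lemma integral_conj_partialWave_mul (l m : ℕ) {h k : ℝ × ℝ → ℂ}
    (hh : AEStronglyMeasurable h radialMeasure) (hk : AEStronglyMeasurable k radialMeasure) :
    ∫ x, starRingEnd ℂ (partialWave l h x) * partialWave m k x =
      if l = m then ∫ r, starRingEnd ℂ (h r) * k r ∂radialMeasure else 0 := by
  have hm : AEStronglyMeasurable (fun p : (ℝ × ℝ) × ℝ =>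
      ((waveWeight l p * waveWeight m p : ℝ) : ℂ) * (starRingEnd ℂ (h p.1) * k p.1))
      relMeasure := by
    refine (Complex.continuous_ofReal.comp_aestronglyMeasurable ?_).mul
      ((Complex.continuous_conj.comp_aestronglyMeasurable
        (hh.comp_fst (ν := (volume : Measure ℝ).restrict (Ioo (-1) 1)))).mul
        (hk.comp_fst (ν := (volume : Measure ℝ).restrict (Ioo (-1) 1))))
    exact ((measurable_waveWeight l).mul (measurable_waveWeight m)).aestronglyMeasurable
  have h1 : ∀ x, starRingEnd ℂ (partialWave l h x) * partialWave m k x =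
      (fun p : (ℝ × ℝ) × ℝ =>
        ((waveWeight l p * waveWeight m p : ℝ) : ℂ) * (starRingEnd ℂ (h p.1) * k p.1))
        (relCoords x) := by
    intro x
    simp only [partialWave, map_mul, Complex.conj_ofReal, Complex.ofReal_mul, relCoords]
    ring
  simp only [h1]
  rw [integral_comp_relCoords _ hm]
  have h2 : ∫ p, ((8 * Real.pi ^ 2 * (p.1.1 ^ 2 * p.1.2 ^ 2) : ℝ) : ℂ) *
      (((waveWeight l p * waveWeight m p : ℝ) : ℂ) * (starRingEnd ℂ (h p.1) * k p.1))
        ∂relMeasure =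
      ∫ p, (fun r => 1 / 2 * (starRingEnd ℂ (h r) * k r)) p.1 *
        (fun c => ((normLegendre l c * normLegendre m c : ℝ) : ℂ)) p.2 ∂relMeasure := by
    refine integral_congr_ae ?_
    filter_upwards [ae_relMeasure_pos] with p hp
    have := congrArg (fun z : ℝ => (z : ℂ)) (weight_mul_waveWeight l m hp.1 hp.2.1)
    simp only [Complex.ofReal_mul] at this ⊢
    push_cast at this ⊢
    linear_combination (starRingEnd ℂ (h p.1) * k p.1) * this
  have h3 : ∫ c in Ioo (-1 : ℝ) 1, ((normLegendre l c * normLegendre m c : ℝ) : ℂ) =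
      if l = m then 2 else 0 := by
    rw [integral_complex_ofReal, ← integral_Ioc_eq_integral_Ioo,
      ← intervalIntegral.integral_of_le (by norm_num), integral_normLegendre_mul]
    split_ifs <;> simp
  rw [h2, relMeasure]
  refine (integral_prod_mul (L := ℂ) (μ := radialMeasure)
    (ν := (volume : Measure ℝ).restrict (Ioo (-1) 1))
    (fun r => 1 / 2 * (starRingEnd ℂ (h r) * k r))
    (fun c => ((normLegendre l c * normLegendre m c : ℝ) : ℂ))).trans ?_
  rw [h3, integral_const_mul]
  split_ifs
  · ring
  · ring

/-- The isometry onto the singlets of angular momentum `l`. -/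
def waveIsometry (l : ℕ) : RadialSpace →ₗᵢ[ℂ] StateSpace :=
  LinearMap.isometryOfInner
    { toFun := fun h => (memLp_partialWave l (Lp.memLp h)).toLp
      map_add' := fun h k => by
        rw [← MemLp.toLp_add, MemLp.toLp_eq_toLp_iff]
        refine (partialWave_congr_ae l (Lp.coeFn_add h k)).trans (Eventually.of_forall fun x => ?_)
        simp only [partialWave, Pi.add_apply]
        ring
      map_smul' := fun c h => by
        rw [RingHom.id_apply, ← MemLp.toLp_const_smul, MemLp.toLp_eq_toLp_iff]
        refine (partialWave_congr_ae l (Lp.coeFn_smul c h)).trans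
          (Eventually.of_forall fun x => ?_)
        simp only [partialWave, Pi.smul_apply, smul_eq_mul]
        ring } fun h k => by
    simp only [LinearMap.coe_mk, AddHom.coe_mk]
    rw [inner_eq_integral (MemLp.coeFn_toLp _) (MemLp.coeFn_toLp _),
      integral_conj_partialWave_mul l l (Lp.aestronglyMeasurable h) (Lp.aestronglyMeasurable k),
      if_pos rfl, inner_eq_integral EventuallyEq.rfl EventuallyEq.rfl]

lemma coeFn_waveIsometry (l : ℕ) (h : RadialSpace) :
    waveIsometry l h =ᵐ[volume] partialWave l h :=
  MemLp.coeFn_toLp (memLp_partialWave l (Lp.memLp h))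

lemma orthogonalFamily_waveIsometry :
    OrthogonalFamily ℂ (fun _ : ℕ => RadialSpace) waveIsometry := by
  intro l m hlm h k
  rw [inner_eq_integral (coeFn_waveIsometry l h) (coeFn_waveIsometry m k),
    integral_conj_partialWave_mul l m (Lp.aestronglyMeasurable h) (Lp.aestronglyMeasurable k),
    if_neg hlm]

/-- The unitary map from the model space onto the singlets. -/
def modelIsometry : ModelSpace →ₗᵢ[ℂ] StateSpace :=
  orthogonalFamily_waveIsometry.linearIsometry

lemma modelIsometry_single (l : ℕ) (h : RadialSpace) :
    modelIsometry (lp.single 2 l h) = waveIsometry l h :=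
  orthogonalFamily_waveIsometry.linearIsometry_apply_single h

/-- The action of `g` on states. -/
def stateAction (g : SU2) : StateSpace →+ StateSpace :=
  Lp.compMeasurePreserving (gaugeAction g.1) (measurePreserving_gaugeAction g)

lemma isSinglet_iff {ψ : StateSpace} : IsSinglet ψ ↔ ∀ g : SU2, stateAction g ψ = ψ := by
  have h : ∀ g : SU2, (fun x => ψ (gaugeAction g.1 x)) =ᵐ[volume] ψ ↔ stateAction g ψ = ψ := by
    intro g
    have h1 := Lp.coeFn_compMeasurePreserving ψ (measurePreserving_gaugeAction g)
    constructor
    · exact fun h2 => Lp.ext (h1.trans h2)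
    · intro h2
      have h3 : stateAction g ψ =ᵐ[volume] fun x => ψ (gaugeAction g.1 x) := h1
      rw [h2] at h3
      exact h3.symm
  exact ⟨fun hψ g => (h g).1 (hψ g.1 g.2), fun hψ g hg => (h ⟨g, hg⟩).2 (hψ ⟨g, hg⟩)⟩

lemma isSinglet_waveIsometry (l : ℕ) (h : RadialSpace) : IsSinglet (waveIsometry l h) := by
  intro g hg
  have h1 := (measurePreserving_gaugeAction ⟨g, hg⟩).quasiMeasurePreserving.ae_eq_comp
    (coeFn_waveIsometry l h)
  refine (h1.trans (Eventually.of_forall fun x => ?_)).trans (coeFn_waveIsometry l h).symm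
  have h2 := relCoords_gaugeAction ⟨g, hg⟩ x
  have h3 : radii (gaugeAction g x) = radii x := congrArg Prod.fst h2
  simp only [Function.comp_apply, partialWave]
  rw [h3]
  rw [show relCoords (gaugeAction g x) = relCoords x from h2]

/-- Invariance under a fixed `g` is a closed condition, and each partial sum of waves satisfies it.
-/
lemma isSinglet_modelIsometry (ψ : ModelSpace) : IsSinglet (modelIsometry ψ) := by
  refine isSinglet_iff.2 fun g => ?_
  have hc : IsClosed {φ : StateSpace | stateAction g φ = φ} :=
    isClosed_eq (Lp.isometry_compMeasurePreserving (measurePreserving_gaugeAction g)).continuous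
      continuous_id
  refine hc.mem_of_tendsto (orthogonalFamily_waveIsometry.hasSum_linearIsometry ψ)
    (Eventually.of_forall fun s => ?_)
  rw [mem_ofPred_eq, map_sum]
  exact Finset.sum_congr rfl fun l _ => isSinglet_iff.1 (isSinglet_waveIsometry l (ψ l)) g

end PartialWaves

/-! ### Completeness of the partial waves -/

section Completeness

lemma integral_polynomial_mul_eq_zero {f : ℝ → ℂ}
    (hf : Integrable f ((volume : Measure ℝ).restrict (Ioo (-1) 1)))
    (h : ∀ l, ∫ c in Ioo (-1 : ℝ) 1, (normLegendre l c : ℂ) * f c = 0) (p : Polynomial ℝ) :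
    ∫ c in Ioo (-1 : ℝ) 1, ((p.eval c : ℝ) : ℂ) * f c = 0 := by
  have hi : ∀ p : Polynomial ℝ, Integrable (fun c => ((p.eval c : ℝ) : ℂ) * f c)
      ((volume : Measure ℝ).restrict (Ioo (-1) 1)) := by
    intro p
    have hc : Continuous fun c : ℝ => ((p.eval c : ℝ) : ℂ) :=
      Complex.continuous_ofReal.comp p.continuous
    obtain ⟨C, hC⟩ := isCompact_Icc.exists_bound_of_continuousOn (hc.continuousOn (s := Icc (-1) 1))
    refine hf.bdd_mul hc.aestronglyMeasurable (c := C) ?_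
    filter_upwards [ae_restrict_mem measurableSet_Ioo] with c hc
    exact hC c (Ioo_subset_Icc_self hc)
  induction mem_span_legendre p using Submodule.span_induction with
  | mem q hq =>
    obtain ⟨l, rfl⟩ := hq
    have h1 := h l
    simp only [normLegendre, Complex.ofReal_mul, mul_assoc] at h1
    rw [integral_const_mul] at h1
    exact (mul_eq_zero.1 h1).resolve_left (Complex.ofReal_ne_zero.2 (by positivity))
  | zero => simp
  | add q r _ _ hq hr =>
    simp only [Polynomial.eval_add, Complex.ofReal_add, add_mul]
    rw [integral_add (hi q) (hi r), hq, hr, add_zero]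
  | smul a q _ hq =>
    simp only [Polynomial.eval_smul, smul_eq_mul, Complex.ofReal_mul, mul_assoc]
    rw [integral_const_mul, hq, mul_zero]

/-- Orthogonality to all polynomials passes to continuous functions on `[-1, 1]` by Weierstrass
approximation, and smooth test functions then detect zero. -/
lemma ae_eq_zero_of_integral_normLegendre {f : ℝ → ℂ}
    (hf : Integrable f ((volume : Measure ℝ).restrict (Ioo (-1) 1)))
    (h : ∀ l, ∫ c in Ioo (-1 : ℝ) 1, (normLegendre l c : ℂ) * f c = 0) :
    ∀ᵐ c ∂(volume : Measure ℝ).restrict (Ioo (-1) 1), f c = 0 := by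
  refine ae_eq_zero_of_integral_contDiff_smul_eq_zero hf.locallyIntegrable fun g hg _ => ?_
  have hgc : Continuous g := hg.continuous
  rw [← norm_le_zero_iff]
  refine le_of_forall_pos_le_add fun ε hε => ?_
  set K := ∫ c in Ioo (-1 : ℝ) 1, ‖f c‖
  have hK : 0 ≤ K := integral_nonneg fun c => norm_nonneg _
  obtain ⟨p, hp⟩ := exists_polynomial_near_of_continuousOn (-1) 1 g hgc.continuousOn
    (ε / (K + 1)) (by positivity)
  have hpi : Integrable (fun c => ((p.eval c : ℝ) : ℂ) * f c)
      ((volume : Measure ℝ).restrict (Ioo (-1) 1)) := by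
    have hc : Continuous fun c : ℝ => ((p.eval c : ℝ) : ℂ) :=
      Complex.continuous_ofReal.comp p.continuous
    obtain ⟨C, hC⟩ := isCompact_Icc.exists_bound_of_continuousOn (hc.continuousOn (s := Icc (-1) 1))
    refine hf.bdd_mul hc.aestronglyMeasurable (c := C) ?_
    filter_upwards [ae_restrict_mem measurableSet_Ioo] with c hc
    exact hC c (Ioo_subset_Icc_self hc)
  have hgi : Integrable (fun c => g c • f c) ((volume : Measure ℝ).restrict (Ioo (-1) 1)) := by
    obtain ⟨C, hC⟩ := isCompact_Icc.exists_bound_of_continuousOn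
      (hgc.continuousOn (s := Icc (-1) 1))
    refine hf.bdd_smul C hgc.aestronglyMeasurable ?_
    filter_upwards [ae_restrict_mem measurableSet_Ioo] with c hc
    exact hC c (Ioo_subset_Icc_self hc)
  have h1 : ∫ c in Ioo (-1 : ℝ) 1, g c • f c =
      ∫ c in Ioo (-1 : ℝ) 1, (g c • f c - ((p.eval c : ℝ) : ℂ) * f c) := by
    rw [integral_sub hgi hpi, integral_polynomial_mul_eq_zero hf h p, sub_zero]
  rw [h1]
  calc ‖∫ c in Ioo (-1 : ℝ) 1, (g c • f c - ((p.eval c : ℝ) : ℂ) * f c)‖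
      ≤ ∫ c in Ioo (-1 : ℝ) 1, ε / (K + 1) * ‖f c‖ := by
        refine norm_integral_le_of_norm_le (hf.norm.const_mul _) ?_
        filter_upwards [ae_restrict_mem measurableSet_Ioo] with c hc
        rw [Complex.real_smul, ← sub_mul, norm_mul, ← Complex.ofReal_sub, Complex.norm_real,
          Real.norm_eq_abs, abs_sub_comm]
        exact mul_le_mul_of_nonneg_right (hp c (Ioo_subset_Icc_self hc)).le (norm_nonneg _)
    _ = ε / (K + 1) * K := integral_const_mul _ _
    _ ≤ ε := by
        rw [div_mul_eq_mul_div, div_le_iff₀ (by positivity)]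
        nlinarith
    _ ≤ 0 + ε := by rw [zero_add]

/-- Varying the set `s` shows, for each `l`, that the Legendre moment of the slice at `r` vanishes
for almost every `r`. There are countably many `l`, so almost every slice has all its moments zero.
-/
lemma ae_eq_zero_of_integral_prod_normLegendre {ψ : (ℝ × ℝ) × ℝ → ℂ}
    (hψm : StronglyMeasurable ψ) (hψ : MemLp ψ 2 relMeasure)
    (h : ∀ l (s : Set (ℝ × ℝ)), MeasurableSet s → radialMeasure s < ⊤ →
      ∫ p, s.indicator 1 p.1 * (normLegendre l p.2 * ψ p) ∂relMeasure = 0) :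
    ψ =ᵐ[relMeasure] 0 := by
  set ν : Measure ℝ := (volume : Measure ℝ).restrict (Ioo (-1) 1) with hν
  have hint : ∀ s : Set (ℝ × ℝ), MeasurableSet s → radialMeasure s < ⊤ →
      Integrable ψ ((radialMeasure.restrict s).prod ν) := by
    intro s hs hsf
    have h1 : (radialMeasure.restrict s).prod ν = relMeasure.restrict (s ×ˢ univ) := by
      rw [relMeasure, ← Measure.prod_restrict, Measure.restrict_univ]
    have : Fact (radialMeasure s < ⊤) := ⟨hsf⟩
    have h2 : MemLp ψ 2 ((radialMeasure.restrict s).prod ν) := by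
      rw [h1]
      exact hψ.restrict _
    exact h2.integrable one_le_two
  have hintl : ∀ l (s : Set (ℝ × ℝ)), MeasurableSet s → radialMeasure s < ⊤ →
      Integrable (fun p => (normLegendre l p.2 : ℂ) * ψ p) ((radialMeasure.restrict s).prod ν) := by
    intro l s hs hsf
    have hc := continuous_normLegendre l
    obtain ⟨C, hC⟩ := isCompact_Icc.exists_bound_of_continuousOn (hc.continuousOn (s := Icc (-1) 1))
    refine (hint s hs hsf).bdd_mul (c := C)
      (Complex.continuous_ofReal.comp (hc.comp continuous_snd)).aestronglyMeasurable ?_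
    have h1 : ∀ᵐ c ∂ν, c ∈ Ioo (-1 : ℝ) 1 := ae_restrict_mem measurableSet_Ioo
    have h2 := (Measure.quasiMeasurePreserving_snd (μ := radialMeasure.restrict s) (ν := ν)).ae h1
    filter_upwards [h2] with p hp
    rw [Complex.norm_real]
    exact hC _ (Ioo_subset_Icc_self hp)
  have h1 : ∀ l, ∀ᵐ r ∂radialMeasure, ∫ c, (normLegendre l c : ℂ) * ψ (r, c) ∂ν = 0 := by
    intro l
    refine ae_eq_zero_of_forall_setIntegral_eq_of_sigmaFinite (fun s hs hsf => ?_)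
      fun s hs hsf => ?_
    · exact (hintl l s hs hsf).integral_prod_left
    · rw [← integral_prod _ (hintl l s hs hsf), ← h l s hs hsf]
      have e1 : (radialMeasure.restrict s).prod ν = relMeasure.restrict (s ×ˢ univ) := by
        rw [relMeasure, ← Measure.prod_restrict, Measure.restrict_univ]
      rw [e1, ← integral_indicator (hs.prod MeasurableSet.univ)]
      refine integral_congr_ae (Eventually.of_forall fun p => ?_)
      by_cases hp : p.1 ∈ s
      · rw [indicator_of_mem (show p ∈ s ×ˢ univ from ⟨hp, mem_univ _⟩)]
        simp [hp]
      · rw [indicator_of_notMem (show p ∉ s ×ˢ univ from fun h => hp h.1)]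
        simp [hp]
  have h2 : ∀ᵐ r ∂radialMeasure, Integrable (fun c => ψ (r, c)) ν := by
    have h3 : Integrable (fun p => ‖ψ p‖ ^ 2) relMeasure :=
      (memLp_two_iff_integrable_sq_norm hψ.1).1 hψ
    filter_upwards [h3.prod_right_ae, hψ.1.prodMk_left] with r hr hm
    exact ((memLp_two_iff_integrable_sq_norm hm).2 hr).integrable one_le_two
  refine (Measure.ae_prod_iff_ae_ae
    (measurableSet_eq_fun hψm.measurable measurable_const)).2 ?_
  filter_upwards [ae_all_iff.2 h1, h2] with r hr hi
  exact ae_eq_zero_of_integral_normLegendre hi hr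

lemma eq_zero_of_inner_waveIsometry_eq_zero {b : StateSpace} (hb : IsSinglet b)
    (h : ∀ l k, ⟪waveIsometry l k, b⟫_ℂ = 0) : b = 0 := by
  obtain ⟨φ, hφ, hbφ⟩ := exists_ae_eq_comp_relCoords (Lp.aestronglyMeasurable b)
    fun g => hb g.1 g.2
  -- Multiplication by `r₁ r₂` absorbs the Jacobian, making the function square integrable for
  -- `relMeasure`.
  let ψ : (ℝ × ℝ) × ℝ → ℂ := fun p => ((p.1.1 * p.1.2 : ℝ) : ℂ) * φ p
  have hw : StronglyMeasurable fun p : (ℝ × ℝ) × ℝ => ((p.1.1 * p.1.2 : ℝ) : ℂ) :=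
    Continuous.stronglyMeasurable (by fun_prop)
  have hψm : StronglyMeasurable ψ := hw.mul hφ
  have hψ : MemLp ψ 2 relMeasure := by
    rw [memLp_two_iff_integrable_sq_norm hψm.aestronglyMeasurable]
    have h1 : Integrable fun x => ((‖φ (relCoords x)‖ ^ 2 : ℝ) : ℂ) := by
      refine Integrable.congr
        ((memLp_two_iff_integrable_sq_norm (Lp.aestronglyMeasurable b)).1 (Lp.memLp b)).ofReal ?_
      filter_upwards [hbφ] with x hx
      rw [hx]
      rfl
    have hm : StronglyMeasurable fun p => ((‖φ p‖ ^ 2 : ℝ) : ℂ) :=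
      Complex.continuous_ofReal.comp_stronglyMeasurable (hφ.norm.pow 2)
    have h2 := (integrable_comp_relCoords (Φ := fun p => ((‖φ p‖ ^ 2 : ℝ) : ℂ))
      hm.aestronglyMeasurable).1 h1
    refine (h2.re.const_mul (8 * Real.pi ^ 2)⁻¹).congr (Eventually.of_forall fun p => ?_)
    have h3 : RCLike.re (((8 * Real.pi ^ 2 * (p.1.1 ^ 2 * p.1.2 ^ 2) : ℝ) : ℂ) *
        ((‖φ p‖ ^ 2 : ℝ) : ℂ)) = 8 * Real.pi ^ 2 * (p.1.1 ^ 2 * p.1.2 ^ 2) * ‖φ p‖ ^ 2 := by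
      rw [← Complex.ofReal_mul]
      exact Complex.ofReal_re _
    simp only [h3]
    simp only [ψ, norm_mul, Complex.norm_real, Real.norm_eq_abs, mul_pow, sq_abs]
    have := Real.pi_pos.ne'
    field_simp
  have hψ0 : ψ =ᵐ[relMeasure] 0 := by
    refine ae_eq_zero_of_integral_prod_normLegendre hψm hψ fun l s hs hsf => ?_
    have h1 := h l (indicatorConstLp 2 hs hsf.ne (1 : ℂ))
    have h2 : waveIsometry l (indicatorConstLp 2 hs hsf.ne (1 : ℂ)) =ᵐ[volume]
        partialWave l (s.indicator 1) :=
      (coeFn_waveIsometry l _).trans (partialWave_congr_ae l indicatorConstLp_coeFn)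
    rw [inner_eq_integral h2 hbφ] at h1
    have hm : AEStronglyMeasurable (fun p : (ℝ × ℝ) × ℝ =>
        (waveWeight l p : ℂ) * s.indicator 1 p.1 * φ p) relMeasure := by
      have m1 : Measurable (s.indicator (1 : ℝ × ℝ → ℂ)) := measurable_one.indicator hs
      exact (((Complex.measurable_ofReal.comp (measurable_waveWeight l)).mul
        (m1.comp measurable_fst)).mul hφ.measurable).aestronglyMeasurable
    have h3 : ∀ x, starRingEnd ℂ (partialWave l (s.indicator 1) x) * φ (relCoords x) =
        (fun p : (ℝ × ℝ) × ℝ => (waveWeight l p : ℂ) * s.indicator 1 p.1 * φ p)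
          (relCoords x) := by
      intro x
      by_cases hx : radii x ∈ s <;> simp [partialWave, relCoords, hx]
    simp only [h3] at h1
    rw [integral_comp_relCoords _ hm] at h1
    have h4 : ∫ p, ((8 * Real.pi ^ 2 * (p.1.1 ^ 2 * p.1.2 ^ 2) : ℝ) : ℂ) *
        ((waveWeight l p : ℂ) * s.indicator 1 p.1 * φ p) ∂relMeasure =
        ∫ p, ((2 * Real.pi : ℝ) : ℂ) *
          (s.indicator 1 p.1 * (normLegendre l p.2 * ψ p)) ∂relMeasure := by
      refine integral_congr_ae ?_
      filter_upwards [ae_relMeasure_pos] with p hp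
      have e1 : 8 * Real.pi ^ 2 * (p.1.1 ^ 2 * p.1.2 ^ 2) * waveWeight l p =
          2 * Real.pi * (normLegendre l p.2 * (p.1.1 * p.1.2)) := by
        unfold waveWeight
        have := hp.1.ne'
        have := hp.2.1.ne'
        have := Real.pi_pos.ne'
        field_simp
        ring
      have e2 := congrArg (fun z : ℝ => (z : ℂ)) e1
      simp only [ψ]
      push_cast at e2 ⊢
      linear_combination s.indicator 1 p.1 * φ p * e2
    rw [h4, integral_const_mul] at h1
    exact (mul_eq_zero.1 h1).resolve_left
      (Complex.ofReal_ne_zero.2 (mul_pos two_pos Real.pi_pos).ne')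
  have hφ0 : ∀ᵐ p ∂relMeasure, φ p = 0 := by
    filter_upwards [hψ0, ae_relMeasure_pos] with p hp hpos
    exact (mul_eq_zero.1 hp).resolve_left
      (Complex.ofReal_ne_zero.2 (mul_pos hpos.1 hpos.2.1).ne')
  rw [Lp.eq_zero_iff_ae_eq_zero]
  filter_upwards [hbφ, quasiMeasurePreserving_relCoords.ae hφ0] with x h1 h2
  rw [h1, h2]
  rfl

theorem range_modelIsometry : range modelIsometry = {ψ | IsSinglet ψ} := by
  refine Subset.antisymm (range_subset_iff.2 isSinglet_modelIsometry) fun b hb => ?_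
  set a := modelIsometry.toContinuousLinearMap.adjoint b
  -- What remains of `b` after projection to the range is still a singlet and is orthogonal to each
  -- wave.
  have hs : IsSinglet (b - modelIsometry a) := by
    refine isSinglet_iff.2 fun g => ?_
    rw [map_sub, isSinglet_iff.1 hb g, isSinglet_iff.1 (isSinglet_modelIsometry a) g]
  have h0 := eq_zero_of_inner_waveIsometry_eq_zero hs fun l k => by
    rw [inner_sub_right, ← modelIsometry_single, modelIsometry.inner_map_map,
      ContinuousLinearMap.adjoint_inner_right]
    exact sub_self _
  exact ⟨a, (sub_eq_zero.1 h0).symm⟩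

end Completeness

/-! ### The kinetic energy of a partial wave -/

section Laplacian

lemma hasDerivAt_comp_line {V F : Type*} [NormedAddCommGroup V] [NormedSpace ℝ V]
    [NormedAddCommGroup F] [NormedSpace ℝ F] {f : V → F} {x e : V} {t : ℝ}
    (hf : DifferentiableAt ℝ f (x + t • e)) :
    HasDerivAt (fun s : ℝ => f (x + s • e)) (fderiv ℝ f (x + t • e) e) t := by
  have h : HasDerivAt (fun s : ℝ => x + s • e) e t := by
    simpa using ((hasDerivAt_id t).smul_const e).const_add x
  exact hf.hasFDerivAt.comp_hasDerivAt t h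

/-- It reduces a second partial derivative to one-variable calculus: the first derivative is needed
along the line near `0`, the second only at `0`. -/
lemma momentum_momentum_eq_neg {V : Type*} [NormedAddCommGroup V] [NormedSpace ℝ V] {f : V → ℂ}
    (hf : ContDiff ℝ ∞ f) {x e : V} {φ : ℝ → ℂ} {d : ℂ}
    (h1 : ∀ᶠ t in 𝓝 0, HasDerivAt (fun s : ℝ => f (x + s • e)) (φ t) t) (h2 : HasDerivAt φ d 0) :
    momentum e (momentum e f) x = -d := by
  rw [momentum_momentum_apply]
  congr 1
  have hg : Differentiable ℝ fun y => fderiv ℝ f y e :=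
    ((hf.fderiv_right (m := ∞) (by simp)).clm_apply contDiff_const).differentiable (by simp)
  have h3 := hasDerivAt_comp_line (x := x) (e := e) (t := 0) (hg _)
  rw [zero_smul, add_zero] at h3
  refine h3.unique (h2.congr_of_eventuallyEq ?_)
  filter_upwards [h1] with t ht
  exact (hasDerivAt_comp_line (hf.differentiable (by simp) _)).unique ht

variable {E : Type*} [NormedAddCommGroup E] [InnerProductSpace ℝ E]

lemma hasDerivAt_norm_line {y e : E} {t : ℝ} (h : y + t • e ≠ 0) :
    HasDerivAt (fun s : ℝ => ‖y + s • e‖) (inner ℝ (y + t • e) e / ‖y + t • e‖) t := by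
  have h0 : HasDerivAt (fun s : ℝ => y + s • e) e t := by
    simpa using ((hasDerivAt_id t).smul_const e).const_add y
  have h1 := h0.norm_sq.sqrt (pow_ne_zero 2 (norm_ne_zero_iff.2 h))
  simp only [Real.sqrt_sq (norm_nonneg _)] at h1
  convert! h1 using 1
  ring

lemma hasDerivAt_inner_line (z y e : E) (t : ℝ) :
    HasDerivAt (fun s : ℝ => inner ℝ z (y + s • e)) (inner ℝ z e) t := by
  have h0 : HasDerivAt (fun s : ℝ => y + s • e) e t := by
    simpa using ((hasDerivAt_id t).smul_const e).const_add y
  simpa using (hasDerivAt_const t z).inner ℝ h0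

lemma hasDerivAt_cos_line {z y e : E} {t : ℝ} (hz : z ≠ 0) (h : y + t • e ≠ 0) :
    HasDerivAt (fun s : ℝ => inner ℝ z (y + s • e) / (‖z‖ * ‖y + s • e‖))
      (inner ℝ z e / (‖z‖ * ‖y + t • e‖) - inner ℝ z (y + t • e) / (‖z‖ * ‖y + t • e‖) *
        inner ℝ (y + t • e) e / ‖y + t • e‖ ^ 2) t := by
  have hz' := norm_ne_zero_iff.2 hz
  have h' := norm_ne_zero_iff.2 h
  convert! (hasDerivAt_inner_line z y e t).div ((hasDerivAt_norm_line h).const_mul ‖z‖)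
    (mul_ne_zero hz' h') using 1
  field_simp

/-- The second derivative along a line of a function of the length and the angle. -/
lemma exists_hasDerivAt_line (P : Polynomial ℝ) {η η₁ η₂ : ℝ → ℂ}
    (h1 : ∀ s, 0 < s → HasDerivAt η (η₁ s) s) (h2 : ∀ s, 0 < s → HasDerivAt η₁ (η₂ s) s)
    {y z e : E} (hy : y ≠ 0) (hz : z ≠ 0) (he : ‖e‖ = 1) :
    ∃ φ : ℝ → ℂ, (∀ᶠ t in 𝓝 0, HasDerivAt (fun s : ℝ =>
        ((P.eval (inner ℝ z (y + s • e) / (‖z‖ * ‖y + s • e‖)) : ℝ) : ℂ) * η ‖y + s • e‖)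
        (φ t) t) ∧
      ∀ (r c R α β : ℝ), r = ‖y‖ → R = ‖z‖ → c = inner ℝ z y / (‖z‖ * ‖y‖) → α = inner ℝ y e →
        β = inner ℝ z e →
      HasDerivAt φ (
        ((P.derivative.derivative.eval c : ℝ) : ℂ) * (β / (R * r) - c * α / r ^ 2) ^ 2 * η r
        + ((P.derivative.eval c : ℝ) : ℂ) * (-(β * α / (R * r ^ 3))
          - (β / (R * r) - c * α / r ^ 2) * α / r ^ 2 - c / r ^ 2 + 2 * c * α ^ 2 / r ^ 4) * η r
        + 2 * ((P.derivative.eval c : ℝ) : ℂ) * (β / (R * r) - c * α / r ^ 2) * (η₁ r * (α / r))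
        + ((P.eval c : ℝ) : ℂ) * (η₂ r * (α / r) ^ 2 + η₁ r * (1 / r - α ^ 2 / r ^ 3))) 0 := by
  let v : ℝ → E := fun t => y + t • e
  let r : ℝ → ℝ := fun t => ‖v t‖
  let c : ℝ → ℝ := fun t => inner ℝ z (v t) / (‖z‖ * ‖v t‖)
  let α : ℝ → ℝ := fun t => inner ℝ (v t) e
  let β : ℝ := inner ℝ z e
  -- `κ` is the derivative of the cosine `c` along the line, and `α t / r t` that of the length.
  let κ : ℝ → ℝ := fun t => β / (‖z‖ * r t) - c t * α t / r t ^ 2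
  have hr : ∀ t, v t ≠ 0 → HasDerivAt r (α t / r t) t := fun t ht => hasDerivAt_norm_line ht
  have hc : ∀ t, v t ≠ 0 → HasDerivAt c (κ t) t := fun t ht => hasDerivAt_cos_line hz ht
  have hα : HasDerivAt α 1 0 := by
    have h := hasDerivAt_inner_line e y e 0
    rw [real_inner_self_eq_norm_sq, he, one_pow] at h
    exact h.congr_of_eventuallyEq (Eventually.of_forall fun t => real_inner_comm _ _)
  have hv0 : v 0 = y := by simp [v]
  have hy0 : v 0 ≠ 0 := by rwa [hv0]
  have hr0 : r 0 ≠ 0 := norm_ne_zero_iff.2 hy0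
  have hR : ‖z‖ ≠ 0 := norm_ne_zero_iff.2 hz
  have hP : ∀ (Q : Polynomial ℝ) t, v t ≠ 0 →
      HasDerivAt (fun s => ((Q.eval (c s) : ℝ) : ℂ))
        ((Q.derivative.eval (c t) * κ t : ℝ) : ℂ) t :=
    fun Q t ht => ((Q.hasDerivAt (c t)).comp t (hc t ht)).ofReal_comp
  have hη : ∀ t, v t ≠ 0 → HasDerivAt (fun s => η (r s)) ((α t / r t : ℝ) • η₁ (r t)) t :=
    fun t ht => (h1 _ (norm_pos_iff.2 ht)).scomp t (hr t ht)
  have hη₁ : HasDerivAt (fun s => η₁ (r s)) ((α 0 / r 0 : ℝ) • η₂ (r 0)) 0 :=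
    (h2 _ (norm_pos_iff.2 hy0)).scomp 0 (hr 0 hy0)
  have hκ : HasDerivAt κ (-(β * α 0 / (‖z‖ * r 0 ^ 3)) - κ 0 * α 0 / r 0 ^ 2 - c 0 / r 0 ^ 2
      + 2 * c 0 * α 0 ^ 2 / r 0 ^ 4) 0 := by
    have e1 := ((hasDerivAt_const (0 : ℝ) β).div ((hr 0 hy0).const_mul ‖z‖) (mul_ne_zero hR hr0))
    have e2 := ((hc 0 hy0).mul hα).div ((hr 0 hy0).pow 2) (pow_ne_zero 2 hr0)
    convert! e1.sub e2 using 1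
    simp only [Pi.mul_apply, Pi.pow_apply]
    field_simp
    ring
  refine ⟨fun t => ((P.derivative.eval (c t) : ℝ) : ℂ) * (κ t : ℂ) * η (r t) +
    ((P.eval (c t) : ℝ) : ℂ) * (((α t / r t : ℝ) : ℂ) * η₁ (r t)), ?_, ?_⟩
  · have hvc : Continuous v := by fun_prop
    filter_upwards [hvc.continuousAt.eventually_ne hy0] with t ht
    convert! (hP P t ht).mul (hη t ht) using 1
    rw [Complex.real_smul, Complex.ofReal_mul]
  · rintro r' c' R' α' β' rfl rfl rfl rfl rfl
    have d1 := ((hP P.derivative 0 hy0).mul hκ.ofReal_comp).mul (hη 0 hy0)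
    have d2 := (hP P 0 hy0).mul ((hα.div (hr 0 hy0) hr0).ofReal_comp.mul hη₁)
    convert! d1.add d2 using 1
    have hrr : ((‖y‖ : ℝ) : ℂ) ≠ 0 := Complex.ofReal_ne_zero.2 (norm_ne_zero_iff.2 hy)
    have hRR : ((‖z‖ : ℝ) : ℂ) ≠ 0 := Complex.ofReal_ne_zero.2 hR
    simp only [Pi.mul_apply, Complex.real_smul, κ, α, r, c, hv0, β, Pi.div_apply]
    push_cast
    field_simp
    ring

/-- The summand is quadratic in the components of the two vectors, so the sum over an orthonormal
basis sees only their lengths and inner product. The angular part comes out as the Legendre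
operator. -/
lemma sum_second_derivative {α β : Fin 3 → ℂ} {r R c p₀ p₁ p₂ e₀ e₁ e₂ : ℂ} (hr : r ≠ 0)
    (hR : R ≠ 0) (hα : ∑ a, α a ^ 2 = r ^ 2) (hαβ : ∑ a, α a * β a = r * R * c)
    (hβ : ∑ a, β a ^ 2 = R ^ 2) :
    ∑ a, (p₂ * (β a / (R * r) - c * α a / r ^ 2) ^ 2 * e₀
        + p₁ * (-(β a * α a / (R * r ^ 3)) - (β a / (R * r) - c * α a / r ^ 2) * α a / r ^ 2
          - c / r ^ 2 + 2 * c * α a ^ 2 / r ^ 4) * e₀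
        + 2 * p₁ * (β a / (R * r) - c * α a / r ^ 2) * (e₁ * (α a / r))
        + p₀ * (e₂ * (α a / r) ^ 2 + e₁ * (1 / r - α a ^ 2 / r ^ 3))) =
      p₀ * (e₂ + 2 * e₁ / r) + e₀ * ((1 - c ^ 2) * p₂ - 2 * c * p₁) / r ^ 2 := by
  set B := p₂ * e₀ / (R ^ 2 * r ^ 2)
  set D := -2 * c * p₂ * e₀ / (R * r ^ 3) - 2 * p₁ * e₀ / (R * r ^ 3)
    + 2 * p₁ * e₁ / (R * r ^ 2)
  set A := p₂ * e₀ * c ^ 2 / r ^ 4 + 3 * p₁ * e₀ * c / r ^ 4 - 2 * p₁ * e₁ * c / r ^ 3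
    + p₀ * e₂ / r ^ 2 - p₀ * e₁ / r ^ 3
  set K := -(p₁ * e₀ * c / r ^ 2) + p₀ * e₁ / r
  have h : ∀ a, p₂ * (β a / (R * r) - c * α a / r ^ 2) ^ 2 * e₀
        + p₁ * (-(β a * α a / (R * r ^ 3)) - (β a / (R * r) - c * α a / r ^ 2) * α a / r ^ 2
          - c / r ^ 2 + 2 * c * α a ^ 2 / r ^ 4) * e₀
        + 2 * p₁ * (β a / (R * r) - c * α a / r ^ 2) * (e₁ * (α a / r))
        + p₀ * (e₂ * (α a / r) ^ 2 + e₁ * (1 / r - α a ^ 2 / r ^ 3)) =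
      B * β a ^ 2 + D * (α a * β a) + A * α a ^ 2 + K := by
    intro a
    simp only [B, D, A, K]
    field_simp
    ring
  simp only [h, Finset.sum_add_distrib, ← Finset.mul_sum, hα, hβ, hαβ, Finset.sum_const,
    Finset.card_univ, Fintype.card_fin, nsmul_eq_mul]
  simp only [B, D, A, K]
  field_simp
  ring

/-- The radial Laplacian of a function of the length and the angle. -/
lemma exists_laplacian (l : ℕ) (K : ℂ) {τ τ₁ τ₂ : ℝ → ℂ} (h1 : ∀ s, HasDerivAt τ (τ₁ s) s)
    (h2 : ∀ s, HasDerivAt τ₁ (τ₂ s) s) {y z : EuclideanSpace ℝ (Fin 3)} (hy : y ≠ 0)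
    (hz : z ≠ 0) :
    ∃ (φ : Fin 3 → ℝ → ℂ) (d : Fin 3 → ℂ),
      (∀ a, ∀ᶠ t in 𝓝 0, HasDerivAt (fun s : ℝ =>
        (((legendre l).eval (inner ℝ z (y + s • EuclideanSpace.single a (1 : ℝ)) /
          (‖z‖ * ‖y + s • EuclideanSpace.single a (1 : ℝ)‖)) : ℝ) : ℂ) *
          (K / ‖y + s • EuclideanSpace.single a (1 : ℝ)‖ *
            τ ‖y + s • EuclideanSpace.single a (1 : ℝ)‖)) (φ a t) t) ∧
      (∀ a, HasDerivAt (φ a) (d a) 0) ∧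
      ∑ a, d a = (((legendre l).eval (inner ℝ z y / (‖z‖ * ‖y‖)) : ℝ) : ℂ) * (K / ‖y‖) *
        (τ₂ ‖y‖ - l * (l + 1) / ‖y‖ ^ 2 * τ ‖y‖) := by
  -- With radial part `K τ / s`, the combination `η'' + 2 η' / s` collapses to `K τ'' / s`.
  have e1 : ∀ s : ℝ, 0 < s → HasDerivAt (fun s : ℝ => K / s * τ s)
      (K * (τ₁ s / s - τ s / s ^ 2)) s := by
    intro s hs
    have hs' : (s : ℂ) ≠ 0 := Complex.ofReal_ne_zero.2 hs.ne'
    convert! ((hasDerivAt_const s K).div (hasDerivAt_id s).ofReal_comp hs').mul (h1 s) using 1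
    simp
    field_simp
    ring
  have e2 : ∀ s : ℝ, 0 < s → HasDerivAt (fun s : ℝ => K * (τ₁ s / s - τ s / s ^ 2))
      (K * (τ₂ s / s - 2 * τ₁ s / s ^ 2 + 2 * τ s / s ^ 3)) s := by
    intro s hs
    have hs' : (s : ℂ) ≠ 0 := Complex.ofReal_ne_zero.2 hs.ne'
    have d1 := (hasDerivAt_id s).ofReal_comp
    convert! (((h2 s).div d1 hs').sub ((h1 s).div (d1.pow 2) (pow_ne_zero 2 hs'))).const_mul K
      using 1
    simp
    left
    field_simp
    ring
  have hs : ∀ (w : EuclideanSpace ℝ (Fin 3)) (a : Fin 3),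
      w a = inner ℝ w (EuclideanSpace.single a (1 : ℝ)) := fun w a => by
    rw [EuclideanSpace.inner_single_right]
    simp
  choose φ hφ1 hφ2 using fun a : Fin 3 => exists_hasDerivAt_line (legendre l) e1 e2 hy hz
    (e := EuclideanSpace.single a (1 : ℝ)) (by simp)
  refine ⟨φ, _, hφ1, fun a => hφ2 a ‖y‖ _ ‖z‖ (y a) (z a) rfl rfl rfl (hs y a) (hs z a), ?_⟩
  have hr : ((‖y‖ : ℝ) : ℂ) ≠ 0 := Complex.ofReal_ne_zero.2 (norm_ne_zero_iff.2 hy)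
  have hR : ((‖z‖ : ℝ) : ℂ) ≠ 0 := Complex.ofReal_ne_zero.2 (norm_ne_zero_iff.2 hz)
  have sq : ∀ w : EuclideanSpace ℝ (Fin 3), ∑ a, ((w a : ℝ) : ℂ) ^ 2 = (‖w‖ : ℂ) ^ 2 := by
    intro w
    have := EuclideanSpace.norm_sq_eq w
    simp only [Real.norm_eq_abs, sq_abs] at this
    exact_mod_cast this.symm
  have hyz : ∑ a, ((y a : ℝ) : ℂ) * ((z a : ℝ) : ℂ) =
      ‖y‖ * ‖z‖ * ((inner ℝ z y / (‖z‖ * ‖y‖) : ℝ) : ℂ) := by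
    have : ∑ a, y a * z a = inner ℝ z y := by simp [PiLp.inner_apply]
    push_cast
    rw [← this]
    push_cast
    field_simp
  rw [sum_second_derivative hr hR (sq y) hyz (sq z)]
  have hode := congrArg (fun Q : Polynomial ℝ => Q.eval (inner ℝ z y / (‖z‖ * ‖y‖)))
    (legendre_ode l)
  simp only [Polynomial.eval_sub, Polynomial.eval_mul, Polynomial.eval_pow, Polynomial.eval_X,
    Polynomial.eval_one, Polynomial.eval_neg, Polynomial.eval_add, Polynomial.eval_natCast,
    Polynomial.eval_ofNat] at hode
  set c : ℝ := inner ℝ z y / (‖z‖ * ‖y‖)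
  have hode' := congrArg (fun x : ℝ => (x : ℂ)) hode
  push_cast at hode'
  rw [hode']
  field_simp
  ring

end Laplacian

/-! ### Radial test functions -/

section RadialTest

/-- Smooth functions with compact support in `(0, ∞) × (0, ∞)`. -/
structure IsRadialTest (ρ : ℝ × ℝ → ℂ) : Prop extends IsTest ρ where
  tsupport_subset : tsupport ρ ⊆ Ioi 0 ×ˢ Ioi 0

variable {ρ σ : ℝ × ℝ → ℂ}

lemma IsRadialTest.eq_zero (h : IsRadialTest ρ) {r : ℝ × ℝ} (hr : r ∉ Ioi (0 : ℝ) ×ˢ Ioi (0 : ℝ)) :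
    ρ r = 0 :=
  image_eq_zero_of_notMem_tsupport fun h' => hr (h.tsupport_subset h')

/-- `w` need only be smooth in the open quadrant: off the support of `ρ` it vanishes in a
neighbourhood. This admits multipliers such as `r⁻²` that are singular on the boundary. -/
lemma IsRadialTest.of_support {w : ℝ × ℝ → ℂ} (h : IsRadialTest ρ)
    (hw : ContDiffOn ℝ ∞ w (Ioi 0 ×ˢ Ioi 0)) (hs : Function.support w ⊆ Function.support ρ) :
    IsRadialTest w where
  contDiff := by
    rw [contDiff_iff_contDiffAt]
    intro r
    by_cases hr : r ∈ tsupport ρ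
    · exact hw.contDiffAt ((isOpen_Ioi.prod isOpen_Ioi).mem_nhds (h.tsupport_subset hr))
    · have h1 : w =ᶠ[𝓝 r] 0 := by
        filter_upwards [notMem_tsupport_iff_eventuallyEq.1 hr] with s hs'
        by_contra hne
        exact hs hne hs'
      exact contDiffAt_const.congr_of_eventuallyEq h1
  hasCompactSupport := h.hasCompactSupport.mono hs
  tsupport_subset := (closure_mono hs).trans h.tsupport_subset

lemma IsRadialTest.zero : IsRadialTest 0 := ⟨IsTest.zero, by simp [tsupport]⟩

lemma IsRadialTest.add (h : IsRadialTest ρ) (h' : IsRadialTest σ) : IsRadialTest (ρ + σ) :=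
  ⟨h.1.add h'.1, (tsupport_add ρ σ).trans (union_subset h.2 h'.2)⟩

lemma IsRadialTest.mul_left {w : ℝ × ℝ → ℂ} (h : IsRadialTest ρ)
    (hw : ContDiffOn ℝ ∞ w (Ioi 0 ×ˢ Ioi 0)) : IsRadialTest fun r => w r * ρ r :=
  h.of_support (hw.mul h.contDiff.contDiffOn) fun _ hr => right_ne_zero_of_mul hr

lemma IsRadialTest.smul (h : IsRadialTest ρ) (c : ℂ) : IsRadialTest (c • ρ) :=
  h.mul_left contDiffOn_const

lemma IsRadialTest.sum {ι : Type*} {s : Finset ι} {f : ι → ℝ × ℝ → ℂ}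
    (hf : ∀ i ∈ s, IsRadialTest (f i)) : IsRadialTest (∑ i ∈ s, f i) :=
  Finset.sum_induction _ IsRadialTest (fun _ _ => IsRadialTest.add) IsRadialTest.zero hf

lemma IsRadialTest.momentum (h : IsRadialTest ρ) (e : ℝ × ℝ) : IsRadialTest (momentum e ρ) := by
  refine ⟨h.1.momentum e, (closure_minimal (fun r hr => ?_) (isClosed_tsupport ρ)).trans h.2⟩
  refine support_fderiv_subset ℝ fun h0 => hr ?_
  simp [MatrixModel.momentum, h0]

lemma IsRadialTest.memLp (h : IsRadialTest ρ) : MemLp ρ 2 radialMeasure := by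
  rw [radialMeasure, Measure.prod_restrict, ← Measure.volume_eq_prod]
  exact (h.1.memLp 2).restrict _

/-- A radial test function as an element of `L²`. -/
def IsRadialTest.toRadial (h : IsRadialTest ρ) : RadialSpace := MemLp.toLp ρ h.memLp

lemma IsRadialTest.coeFn_toRadial (h : IsRadialTest ρ) : h.toRadial =ᵐ[radialMeasure] ρ :=
  MemLp.coeFn_toLp _

lemma contDiffAt_relCoords {x : Config} (h0 : x 0 ≠ 0) (h1 : x 1 ≠ 0) :
    ContDiffAt ℝ ∞ relCoords x := by
  have a0 : ContDiffAt ℝ ∞ (fun x : Config => x 0) x := (contDiff_apply ℝ _ 0).contDiffAt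
  have a1 : ContDiffAt ℝ ∞ (fun x : Config => x 1) x := (contDiff_apply ℝ _ 1).contDiffAt
  have n0 := a0.norm ℝ h0
  have n1 := a1.norm ℝ h1
  exact (n0.prodMk n1).prodMk ((a0.inner ℝ a1).div (n0.mul n1)
    (mul_ne_zero (norm_ne_zero_iff.2 h0) (norm_ne_zero_iff.2 h1)))

/-- Lengths and angle are smooth only where both vectors are nonzero, but the wave vanishes in a
neighbourhood of the remaining configurations. -/
lemma IsRadialTest.partialWave (h : IsRadialTest ρ) (l : ℕ) : IsTest (partialWave l ρ) where
  contDiff := by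
    rw [contDiff_iff_contDiffAt]
    intro x
    by_cases hx : radii x ∈ tsupport ρ
    · have hx' := h.tsupport_subset hx
      have h0 : x 0 ≠ 0 := norm_pos_iff.1 hx'.1
      have h1 : x 1 ≠ 0 := norm_pos_iff.1 hx'.2
      have hr := contDiffAt_relCoords h0 h1
      have hL : ContDiff ℝ ∞ (normLegendre l) := 
        contDiff_const.mul ((legendre l).contDiff_aeval ∞)
      have hw : ContDiffAt ℝ ∞ (waveWeight l) (relCoords x) := by
        unfold waveWeight
        refine (hL.comp contDiff_snd).contDiffAt.div ?_ ?_
        · exact (contDiff_const.mul ((contDiff_fst.comp contDiff_fst).mul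
            (contDiff_snd.comp contDiff_fst))).contDiffAt
        · exact mul_ne_zero (by positivity) (mul_ne_zero (ne_of_gt hx'.1) (ne_of_gt hx'.2))
      exact (Complex.ofRealCLM.contDiff.contDiffAt.comp x (hw.comp x hr)).mul
        (h.contDiff.contDiffAt.comp x (contDiffAt_fst.comp x hr))
    · have h1 : MatrixModel.partialWave l ρ =ᶠ[𝓝 x] 0 := by
        filter_upwards [continuous_radii.continuousAt.eventually
          (notMem_tsupport_iff_eventuallyEq.1 hx)] with y hy
        simp [MatrixModel.partialWave, hy]
      exact contDiffAt_const.congr_of_eventuallyEq h1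
  hasCompactSupport := by
    obtain ⟨C, hC⟩ := h.hasCompactSupport.isCompact.isBounded.subset_closedBall 0
    refine HasCompactSupport.of_support_subset_isCompact (isCompact_closedBall (0 : Config) C)
      fun x hx => ?_
    have h1 : radii x ∈ tsupport ρ := subset_tsupport _ (right_ne_zero_of_mul hx)
    have h2 := mem_closedBall_zero_iff.1 (hC h1)
    rw [mem_closedBall_zero_iff]
    refine (pi_norm_le_iff_of_nonneg ((norm_nonneg _).trans h2)).2 (Fin.forall_fin_two.2 ⟨?_, ?_⟩)
    · have := (norm_fst_le (radii x)).trans h2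
      rwa [radii, norm_norm] at this
    · have := (norm_snd_le (radii x)).trans h2
      rwa [radii, norm_norm] at this

/-- The kinetic energy of the radial part of a partial wave. -/
def radialKinetic (l : ℕ) (ρ : ℝ × ℝ → ℂ) (r : ℝ × ℝ) : ℂ :=
  momentum (1, 0) (momentum (1, 0) ρ) r + momentum (0, 1) (momentum (0, 1) ρ) r
    + ((r.1 ^ 2)⁻¹ + (r.2 ^ 2)⁻¹ : ℝ) * ((l : ℂ) * ((l : ℂ) + 1)) * ρ r

lemma IsRadialTest.radialKinetic (h : IsRadialTest ρ) (l : ℕ) :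
    IsRadialTest (radialKinetic l ρ) := by
  refine (((h.momentum _).momentum _).add ((h.momentum _).momentum _)).add (h.mul_left ?_)
  refine ContDiffOn.mul ?_ contDiffOn_const
  refine Complex.ofRealCLM.contDiff.comp_contDiffOn (ContDiffOn.add ?_ ?_)
  · exact (contDiff_fst.pow 2).contDiffOn.inv fun r hr => pow_ne_zero 2 (ne_of_gt hr.1)
  · exact (contDiff_snd.pow 2).contDiffOn.inv fun r hr => pow_ne_zero 2 (ne_of_gt hr.2)

lemma IsRadialTest.hasDerivAt_line (h : IsRadialTest ρ) (b e : ℝ × ℝ) (s : ℝ) :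
    HasDerivAt (fun s : ℝ => ρ (b + s • e)) (fderiv ℝ ρ (b + s • e) e) s ∧
    HasDerivAt (fun s : ℝ => fderiv ℝ ρ (b + s • e) e)
      (-MatrixModel.momentum e (MatrixModel.momentum e ρ) (b + s • e)) s := by
  refine ⟨hasDerivAt_comp_line (h.differentiable _), ?_⟩
  rw [momentum_momentum_apply, neg_neg]
  exact hasDerivAt_comp_line (f := fun y => fderiv ℝ ρ y e) ((((h.contDiff.fderiv_right (m := ∞)
    (by simp)).clm_apply contDiff_const).differentiable (by simp)) _)

/-- The kinetic energy of a partial wave. -/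
theorem kinetic_partialWave (h : IsRadialTest ρ) (l : ℕ) {x : Config} (h0 : x 0 ≠ 0)
    (h1 : x 1 ≠ 0) :
    kinetic (partialWave l ρ) x =
      partialWave l (radialKinetic l ρ) x := by
  have hn0 : ((‖x 0‖ : ℝ) : ℂ) ≠ 0 := Complex.ofReal_ne_zero.2 (norm_ne_zero_iff.2 h0)
  have hn1 : ((‖x 1‖ : ℝ) : ℂ) ≠ 0 := Complex.ofReal_ne_zero.2 (norm_ne_zero_iff.2 h1)
  have hπ : ((Real.pi : ℝ) : ℂ) ≠ 0 := Complex.ofReal_ne_zero.2 Real.pi_ne_zero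
  have hsmooth := (h.partialWave l).contDiff
  -- The first vector moves with the second fixed: the radial function is `s ↦ ρ (s, ‖x 1‖)`, and
  -- the rest of the normalization goes into the constant. The second application exchanges the
  -- roles.
  obtain ⟨φ, d, hφ, hd, hsum⟩ := exists_laplacian l (√(2 * l + 1) / (4 * Real.pi * ‖x 1‖) : ℂ)
    (fun s => (h.hasDerivAt_line (0, ‖x 1‖) (1, 0) s).1)
    (fun s => (h.hasDerivAt_line (0, ‖x 1‖) (1, 0) s).2) h0 h1
  obtain ⟨φ', d', hφ', hd', hsum'⟩ := exists_laplacian l (√(2 * l + 1) / (4 * Real.pi * ‖x 0‖) : ℂ)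
    (fun s => (h.hasDerivAt_line (‖x 0‖, 0) (0, 1) s).1)
    (fun s => (h.hasDerivAt_line (‖x 0‖, 0) (0, 1) s).2) h1 h0
  have hm : ∀ a, momentum (direction 0 a) (momentum (direction 0 a)
      (partialWave l ρ)) x = -d a := by
    intro a
    refine momentum_momentum_eq_neg hsmooth ?_ (hd a)
    filter_upwards [hφ a] with t ht
    convert! ht using 1
    funext s
    have e0 : (x + s • direction 0 a) 0 = x 0 + s • EuclideanSpace.single a 1 := by
      simp [direction]
    have e1 : (x + s • direction 0 a) 1 = x 1 := by
      simp [direction]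
    simp only [partialWave, waveWeight, normLegendre, relCoords, radii, cosAngle, e0,
      e1, real_inner_comm (x 1), mul_comm ‖x 1‖]
    simp
    field_simp
  have hm' : ∀ a, momentum (direction 1 a) (momentum (direction 1 a)
      (partialWave l ρ)) x = -d' a := by
    intro a
    refine momentum_momentum_eq_neg hsmooth ?_ (hd' a)
    filter_upwards [hφ' a] with t ht
    convert! ht using 1
    funext s
    have e0 : (x + s • direction 1 a) 0 = x 0 := by
      simp [direction]
    have e1 : (x + s • direction 1 a) 1 = x 1 + s • EuclideanSpace.single a 1 := by
      simp [direction]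
    simp only [partialWave, waveWeight, normLegendre, relCoords, radii, cosAngle, e0,
      e1]
    simp
    field_simp
  simp only [kinetic, Fin.sum_univ_two, hm, hm', Finset.sum_neg_distrib, hsum, hsum']
  simp only [partialWave, waveWeight, normLegendre, relCoords, radii, cosAngle,
    radialKinetic, real_inner_comm (x 1) (x 0), mul_comm ‖x 1‖ ‖x 0‖]
  simp
  field_simp
  ring

end RadialTest

/-! ### The model operator on its core -/

section ModelCore

/-- Finite families of smooth functions with compact support in `(0, ∞) × (0, ∞)`. -/
structure IsModelTest (ρ : ℕ → ℝ × ℝ → ℂ) : Prop where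
  finite : {l | ρ l ≠ 0}.Finite
  radial : ∀ l, IsRadialTest (ρ l)

lemma mem_modelCore {p : ModelSpace × ModelSpace} :
    p ∈ modelCore ↔ ∃ ρ, IsModelTest ρ ∧ (∀ l, p.1 l =ᵐ[radialMeasure] ρ l) ∧
      ∀ l, p.2 l =ᵐ[radialMeasure] modelOperator ρ l := by
  constructor
  · rintro ⟨ρ, h1, h2, h3⟩
    exact ⟨ρ, ⟨h1, fun l => ⟨⟨(h2 l).1, (h2 l).2.1⟩, (h2 l).2.2⟩⟩, fun l => (h3 l).1,
      fun l => (h3 l).2⟩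
  · rintro ⟨ρ, h1, h2, h3⟩
    exact ⟨ρ, h1.finite, fun l => ⟨(h1.radial l).contDiff, (h1.radial l).hasCompactSupport,
      (h1.radial l).tsupport_subset⟩, fun l => ⟨h2 l, h3 l⟩⟩

variable {ρ : ℕ → ℝ × ℝ → ℂ}

lemma IsModelTest.exists_bound (h : IsModelTest ρ) : ∃ N, ∀ l, N ≤ l → ρ l = 0 := by
  obtain ⟨B, hB⟩ := h.finite.bddAbove
  refine ⟨B + 1, fun l hl => ?_⟩
  by_contra hne
  have : l ≤ B := hB hne
  omega

lemma IsModelTest.add {σ : ℕ → ℝ × ℝ → ℂ} (h : IsModelTest ρ) (h' : IsModelTest σ) :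
    IsModelTest (ρ + σ) := by
  refine ⟨(h.finite.union h'.finite).subset fun l hl => ?_,
    fun l => (h.radial l).add (h'.radial l)⟩
  by_contra hne
  simp only [mem_union, mem_ofPred_eq, not_or, not_not] at hne
  exact hl (by rw [Pi.add_apply, hne.1, hne.2, add_zero])

lemma IsModelTest.smul (h : IsModelTest ρ) (c : ℂ) : IsModelTest (c • ρ) :=
  ⟨h.finite.subset fun l hl h0 => hl (by rw [Pi.smul_apply, h0, smul_zero]),
    fun l => (h.radial l).smul c⟩

lemma isModelTest_zero : IsModelTest 0 := ⟨by simp, fun _ => IsRadialTest.zero⟩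

lemma coupling_eq_zero {l m : ℕ} (h : m + 2 < l) : coupling l m = 0 := by
  simp [coupling, show l ≠ m by omega, show m ≠ l + 2 by omega, show l ≠ m + 2 by omega]

lemma modelOperator_eq {N : ℕ} (hN : ∀ l, N ≤ l → ρ l = 0) (l : ℕ) (r : ℝ × ℝ) :
    modelOperator ρ l r = radialKinetic l (ρ l) r +
      (r.1 ^ 2 * r.2 ^ 2 : ℝ) * ∑ m ∈ Finset.range N, (coupling l m : ℂ) * ρ m r := by
  rw [modelOperator, radialKinetic, tsum_eq_sum (s := Finset.range N)]
  intro m hm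
  rw [hN m (by simpa using hm), Pi.zero_apply, mul_zero]

lemma radialKinetic_zero (l : ℕ) : radialKinetic l 0 = 0 := by
  ext r
  have h : ∀ e : ℝ × ℝ, momentum e (0 : ℝ × ℝ → ℂ) = 0 := fun e => by
    simpa using momentum_smul (0 : ℝ × ℝ → ℂ) 0 e
  simp [radialKinetic, h]

lemma modelOperator_eq_zero {N : ℕ} (hN : ∀ l, N ≤ l → ρ l = 0) {l : ℕ} (hl : N + 2 ≤ l) :
    modelOperator ρ l = 0 := by
  ext r
  rw [modelOperator_eq hN, hN l (by omega), radialKinetic_zero, Finset.sum_eq_zero]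
  · simp
  · intro m hm
    rw [coupling_eq_zero (by have := Finset.mem_range.1 hm; omega), Complex.ofReal_zero, zero_mul]

lemma IsModelTest.modelOperator (h : IsModelTest ρ) (l : ℕ) :
    IsRadialTest (modelOperator ρ l) := by
  obtain ⟨N, hN⟩ := h.exists_bound
  have h1 : MatrixModel.modelOperator ρ l = radialKinetic l (ρ l) + fun r =>
      ((r.1 ^ 2 * r.2 ^ 2 : ℝ) : ℂ) * (∑ m ∈ Finset.range N, (coupling l m : ℂ) • ρ m) r := by
    ext r
    rw [modelOperator_eq hN]
    simp
  rw [h1]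
  refine ((h.radial l).radialKinetic l).add
    ((IsRadialTest.sum fun m _ => (h.radial m).smul _).mul_left (ContDiff.contDiffOn ?_))
  exact Complex.ofRealCLM.contDiff.comp ((contDiff_fst.pow 2).mul (contDiff_snd.pow 2))

lemma sum_single_apply (N l : ℕ) (u : ℕ → RadialSpace) :
    (∑ m ∈ Finset.range N, (lp.single 2 m (u m) : ModelSpace)) l = if l < N then u l else 0 := by
  rw [lp.coeFn_sum, Finset.sum_apply]
  simp only [lp.coeFn_single]
  rw [Finset.sum_pi_single]
  simp

lemma modelIsometry_eq_sum {ψ : ModelSpace} {N : ℕ} (h : ∀ l, N ≤ l → ψ l = 0) :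
    modelIsometry ψ = ∑ l ∈ Finset.range N, waveIsometry l (ψ l) := by
  refine (orthogonalFamily_waveIsometry.hasSum_linearIsometry ψ).unique
    (hasSum_sum_of_ne_finset_zero fun l hl => ?_)
  rw [h l (by simpa using hl), map_zero]

lemma coeFn_sum_waveIsometry {h : ℕ → RadialSpace} {k : ℕ → ℝ × ℝ → ℂ}
    (hk : ∀ l, h l =ᵐ[radialMeasure] k l) (s : Finset ℕ) :
    (∑ l ∈ s, waveIsometry l (h l) : StateSpace) =ᵐ[volume] ∑ l ∈ s, partialWave l (k l) := by
  induction s using Finset.induction_on with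
  | empty => exact Lp.coeFn_zero _ _ _
  | insert l s hl ih =>
    rw [Finset.sum_insert hl, Finset.sum_insert hl]
    refine (Lp.coeFn_add _ _).trans ?_
    exact ((coeFn_waveIsometry l (h l)).trans (partialWave_congr_ae l (hk l))).add ih

lemma kinetic_zero : kinetic 0 = 0 := by simpa using kinetic_smul (f := 0) 0

lemma kinetic_sum {ι : Type*} {s : Finset ι} {f : ι → Config → ℂ} (hf : ∀ i ∈ s, IsTest (f i)) :
    kinetic (∑ i ∈ s, f i) = ∑ i ∈ s, kinetic (f i) := by
  induction s using Finset.cons_induction with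
  | empty => exact kinetic_zero
  | cons i s hi ih =>
    rw [Finset.sum_cons, Finset.sum_cons, kinetic_add (hf i (by simp))
      (IsTest.sum fun j hj => hf j (by simp [hj])), ih fun j hj => hf j (by simp [hj])]

lemma ae_ne_zero : ∀ᵐ x : Config, x 0 ≠ 0 ∧ x 1 ≠ 0 := by
  filter_upwards [quasiMeasurePreserving_relCoords.ae ae_relMeasure_pos] with x hx
  exact ⟨norm_pos_iff.1 hx.1, norm_pos_iff.1 hx.2.1⟩

/-- The operator `4 H` on a finite sum of partial waves. -/
lemma IsModelTest.scaled_sum (h : IsModelTest ρ) {N : ℕ} (hN : ∀ l, N ≤ l → ρ l = 0) {x : Config}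
    (h0 : x 0 ≠ 0) (h1 : x 1 ≠ 0) :
    ∑ l ∈ Finset.range (N + 3), partialWave l (MatrixModel.modelOperator ρ l) x =
      kinetic (∑ l ∈ Finset.range (N + 3), partialWave l (ρ l)) x +
        potential x * (∑ l ∈ Finset.range (N + 3), partialWave l (ρ l)) x := by
  -- After exchanging the sums over `l` and `m`, the coupling matrix acts on the angular functions.
  -- The range `N + 3` contains every index the band reaches from `m < N`.
  have hcoup : ∀ m, m < N → ∑ l ∈ Finset.range (N + 3),
      ((coupling l m : ℝ) : ℂ) * waveWeight l (relCoords x) =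
        (1 - (cosAngle x : ℂ) ^ 2) * waveWeight m (relCoords x) := by
    intro m hm
    have := normLegendre_coupling (m := m) (N := N + 3) (by omega) (cosAngle x)
    have h2 : ∑ l ∈ Finset.range (N + 3), coupling l m * waveWeight l (relCoords x) =
        (1 - cosAngle x ^ 2) * waveWeight m (relCoords x) := by
      simp only [waveWeight, relCoords]
      rw [← mul_div_assoc, ← this, Finset.sum_div]
      exact Finset.sum_congr rfl fun l _ => by ring
    exact_mod_cast congrArg (fun y : ℝ => (y : ℂ)) h2
  have hpot : ((potential x : ℝ) : ℂ) = ((‖x 0‖ ^ 2 * ‖x 1‖ ^ 2 : ℝ) : ℂ) *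
      (1 - (cosAngle x : ℂ) ^ 2) := by
    rw [potential_eq, ← radii_mul_cosAngle]
    push_cast
    ring
  rw [kinetic_sum fun l _ => (h.radial l).partialWave l, Finset.sum_apply, Finset.sum_apply]
  simp only [kinetic_partialWave (h.radial _) _ h0 h1]
  have e1 : ∀ l, partialWave l (MatrixModel.modelOperator ρ l) x =
      partialWave l (radialKinetic l (ρ l)) x + ((‖x 0‖ ^ 2 * ‖x 1‖ ^ 2 : ℝ) : ℂ) *
        ∑ m ∈ Finset.range N, ((coupling l m : ℝ) : ℂ) * waveWeight l (relCoords x) *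
          ρ m (radii x) := by
    intro l
    simp only [partialWave, modelOperator_eq hN, radii]
    rw [mul_add, ← mul_assoc, mul_comm _ (((‖x 0‖ ^ 2 * ‖x 1‖ ^ 2 : ℝ) : ℂ)), mul_assoc,
      Finset.mul_sum]
    congr 2
    exact Finset.sum_congr rfl fun m _ => by ring
  simp only [e1, Finset.sum_add_distrib]
  congr 1
  rw [← Finset.mul_sum, Finset.sum_comm, hpot, mul_assoc]
  congr 1
  rw [Finset.mul_sum, Finset.sum_range_add]
  rw [Finset.sum_eq_zero (s := Finset.range 3) fun m _ => by
    simp [partialWave, hN (N + m) (by omega)], add_zero]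
  refine Finset.sum_congr rfl fun m hm => ?_
  rw [← Finset.sum_mul, hcoup m (Finset.mem_range.1 hm), partialWave]
  ring

lemma modelIsometry_mem_scaledGraph {p : ModelSpace × ModelSpace} (hp : p ∈ modelCore) :
    (modelIsometry p.1, modelIsometry p.2) ∈ scaledGraph := by
  obtain ⟨ρ, hρ, h1, h2⟩ := mem_modelCore.1 hp
  obtain ⟨N, hN⟩ := hρ.exists_bound
  have z1 : ∀ l, N + 3 ≤ l → p.1 l = 0 := fun l hl => by
    rw [Lp.eq_zero_iff_ae_eq_zero]
    have := h1 l
    rwa [hN l (by omega)] at this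
  have z2 : ∀ l, N + 3 ≤ l → p.2 l = 0 := fun l hl => by
    rw [Lp.eq_zero_iff_ae_eq_zero]
    have := h2 l
    rwa [modelOperator_eq_zero hN (by omega)] at this
  rw [modelIsometry_eq_sum z1, modelIsometry_eq_sum z2]
  refine ⟨∑ l ∈ Finset.range (N + 3), partialWave l (ρ l),
    IsTest.sum fun l _ => (hρ.radial l).partialWave l, coeFn_sum_waveIsometry h1 _,
    (coeFn_sum_waveIsometry h2 _).trans ?_⟩
  filter_upwards [ae_ne_zero] with x hx
  rw [Finset.sum_apply]
  exact hρ.scaled_sum hN hx.1 hx.2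

/-- A finite family of radial test functions as an element of the model space. -/
lemma IsModelTest.exists_mem (h : IsModelTest ρ) :
    ∃ p ∈ modelCore, ∀ l, p.1 l =ᵐ[radialMeasure] ρ l := by
  obtain ⟨N, hN⟩ := h.exists_bound
  let p : ModelSpace × ModelSpace :=
    (∑ l ∈ Finset.range N, lp.single 2 l (h.radial l).toRadial,
      ∑ l ∈ Finset.range (N + 2), lp.single 2 l (h.modelOperator l).toRadial)
  have h1 : ∀ l, p.1 l =ᵐ[radialMeasure] ρ l := by
    intro l
    simp only [p, sum_single_apply]
    split_ifs with hl
    · exact (h.radial l).coeFn_toRadial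
    · rw [hN l (by omega)]
      exact Lp.coeFn_zero _ _ _
  refine ⟨p, mem_modelCore.2 ⟨ρ, h, h1, fun l => ?_⟩, h1⟩
  simp only [p, sum_single_apply]
  split_ifs with hl
  · exact (h.modelOperator l).coeFn_toRadial
  · rw [modelOperator_eq_zero hN (by omega)]
    exact Lp.coeFn_zero _ _ _

/-- The difference of two values pairs to zero with the dense domain by symmetry. -/
lemma IsNonnegSymmetric.snd_unique {E : Type*} [NormedAddCommGroup E] [InnerProductSpace ℂ E]
    {T : Submodule ℂ (E × E)} (hT : IsNonnegSymmetric T) {u v w : E} (hv : (u, v) ∈ T)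
    (hw : (u, w) ∈ T) : v = w := by
  have h := T.sub_mem hv hw
  have h1 : ∀ q ∈ Prod.fst '' (T : Set (E × E)), ⟪v - w, q⟫_ℂ = 0 := by
    rintro _ ⟨q, hq, rfl⟩
    have := hT.symm _ h q hq
    simp only [Prod.mk_sub_mk, sub_self, inner_zero_left] at this
    exact this.symm
  have h2 := hT.dense.induction (P := fun q => ⟪v - w, q⟫_ℂ = 0) h1
    (isClosed_eq (by fun_prop) continuous_const) (v - w)
  exact sub_eq_zero.1 (inner_self_eq_zero.1 h2)

/-- Since `scaledGraph` is single-valued and `modelIsometry` injective, the second component is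
pinned down by its image. Linearity of the model graph can thus be borrowed from `scaledGraph`. -/
lemma mem_modelCore_iff {p : ModelSpace × ModelSpace} :
    p ∈ modelCore ↔ (∃ ρ, IsModelTest ρ ∧ ∀ l, p.1 l =ᵐ[radialMeasure] ρ l) ∧
      (modelIsometry p.1, modelIsometry p.2) ∈ scaledGraph := by
  constructor
  · intro hp
    obtain ⟨ρ, hρ, h1, -⟩ := mem_modelCore.1 hp
    exact ⟨⟨ρ, hρ, h1⟩, modelIsometry_mem_scaledGraph hp⟩
  · rintro ⟨⟨ρ, hρ, h1⟩, h2⟩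
    obtain ⟨q, hq, hq1⟩ := hρ.exists_mem
    have e1 : q.1 = p.1 := lp.ext (funext fun l => Lp.ext ((hq1 l).trans (h1 l).symm))
    have h3 := modelIsometry_mem_scaledGraph hq
    rw [e1] at h3
    have e2 : q.2 = p.2 := modelIsometry.injective
      (isNonnegSymmetric_scaledGraph.snd_unique h3 h2)
    rwa [show p = q from Prod.ext e1.symm e2.symm]

/-- The graph of the model operator on finite families of radial test functions. -/
def modelGraph : Submodule ℂ (ModelSpace × ModelSpace) where
  carrier := modelCore
  zero_mem' := by
    refine mem_modelCore_iff.2 ⟨⟨0, isModelTest_zero, fun l => Lp.coeFn_zero _ _ _⟩, ?_⟩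
    simp only [Prod.fst_zero, Prod.snd_zero, map_zero]
    exact scaledGraph.zero_mem
  add_mem' := by
    intro p q hp hq
    obtain ⟨⟨ρ, hρ, h1⟩, h2⟩ := mem_modelCore_iff.1 hp
    obtain ⟨⟨σ, hσ, k1⟩, k2⟩ := mem_modelCore_iff.1 hq
    refine mem_modelCore_iff.2 ⟨⟨ρ + σ, hρ.add hσ, fun l => ?_⟩, ?_⟩
    · exact (Lp.coeFn_add _ _).trans ((h1 l).add (k1 l))
    · simpa using scaledGraph.add_mem h2 k2
  smul_mem' := by
    intro c p hp
    obtain ⟨⟨ρ, hρ, h1⟩, h2⟩ := mem_modelCore_iff.1 hp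
    refine mem_modelCore_iff.2 ⟨⟨c • ρ, hρ.smul c, fun l => ?_⟩, ?_⟩
    · exact (Lp.coeFn_smul _ _).trans ((h1 l).const_smul c)
    · simpa using scaledGraph.smul_mem c h2

lemma IsRadialTest.single {σ : ℝ × ℝ → ℂ} (h : IsRadialTest σ) (l : ℕ) :
    IsModelTest (Pi.single l σ) := by
  refine ⟨(Set.finite_singleton l).subset fun m hm => ?_, fun m => ?_⟩
  · by_contra hne
    exact hm (Pi.single_eq_of_ne (M := fun _ : ℕ => ℝ × ℝ → ℂ) hne σ)
  · rcases eq_or_ne m l with rfl | hm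
    · rwa [Pi.single_eq_same]
    · rw [Pi.single_eq_of_ne hm]
      exact IsRadialTest.zero

lemma ae_eq_zero_of_inner_radialTest {u : RadialSpace}
    (h : ∀ σ (hσ : IsRadialTest σ), ⟪hσ.toRadial, u⟫_ℂ = 0) : u = 0 := by
  have hQ : IsOpen (Ioi (0 : ℝ) ×ˢ Ioi (0 : ℝ)) := isOpen_Ioi.prod isOpen_Ioi
  have hμ : radialMeasure = (volume : Measure (ℝ × ℝ)).restrict (Ioi 0 ×ˢ Ioi 0) := by
    rw [radialMeasure, Measure.prod_restrict, ← Measure.volume_eq_prod]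
  have hloc : LocallyIntegrableOn u (Ioi (0 : ℝ) ×ˢ Ioi (0 : ℝ)) (volume : Measure (ℝ × ℝ)) := by
    refine locallyIntegrableOn_of_locallyIntegrable_restrict ?_
    rw [← hμ]
    exact (Lp.memLp u).locallyIntegrable one_le_two
  have h1 := hQ.ae_eq_zero_of_integral_contDiff_smul_eq_zero hloc fun g hg hgs hgt => by
    have ht : IsRadialTest fun x => (g x : ℂ) :=
      ⟨⟨Complex.ofRealCLM.contDiff.comp hg, hgs.comp_left (g := Complex.ofReal) (by simp)⟩,
        (tsupport_comp_subset (g := Complex.ofReal) (by simp) g).trans hgt⟩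
    have h2 := h _ ht
    rw [inner_eq_integral ht.coeFn_toRadial EventuallyEq.rfl] at h2
    generalize (u : ℝ × ℝ → ℂ) = w at h2 ⊢
    rw [hμ, setIntegral_eq_integral_of_forall_compl_eq_zero
      (fun x hx => by rw [ht.eq_zero hx, map_zero, zero_mul])] at h2
    simpa using h2
  rw [Lp.eq_zero_iff_ae_eq_zero]
  change _ =ᵐ[radialMeasure] _
  rw [hμ]
  filter_upwards [ae_restrict_of_ae h1, ae_restrict_mem hQ.measurableSet] with r hr hr'
  exact hr hr'

lemma isNonnegSymmetric_modelGraph : IsNonnegSymmetric modelGraph where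
  symm := by
    intro p hp q hq
    rw [← modelIsometry.inner_map_map, ← modelIsometry.inner_map_map p.2]
    exact isNonnegSymmetric_scaledGraph.symm _ (modelIsometry_mem_scaledGraph hp) _
      (modelIsometry_mem_scaledGraph hq)
  nonneg := by
    intro p hp
    rw [← modelIsometry.inner_map_map]
    exact isNonnegSymmetric_scaledGraph.nonneg _ (modelIsometry_mem_scaledGraph hp)
  dense := by
    have h : (Prod.fst '' (modelGraph : Set (ModelSpace × ModelSpace))) =
        (modelGraph.map (LinearMap.fst ℂ ModelSpace ModelSpace) : Set ModelSpace) := rfl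
    rw [h, Submodule.dense_iff_topologicalClosure_eq_top, Submodule.topologicalClosure_eq_top_iff,
      Submodule.eq_bot_iff]
    intro v hv
    rw [Submodule.mem_orthogonal] at hv
    refine lp.ext (funext fun l => ae_eq_zero_of_inner_radialTest fun σ hσ => ?_)
    obtain ⟨p, hp, hp1⟩ := (hσ.single l).exists_mem
    have e : p.1 = lp.single 2 l hσ.toRadial := by
      refine lp.ext (funext fun m => Lp.ext ((hp1 m).trans ?_))
      rw [lp.coeFn_single]
      rcases eq_or_ne m l with rfl | hm
      · rw [Pi.single_eq_same, Pi.single_eq_same]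
        exact hσ.coeFn_toRadial.symm
      · rw [Pi.single_eq_of_ne hm, Pi.single_eq_of_ne hm]
        exact (Lp.coeFn_zero _ _ _).symm
    have h2 := hv _ ⟨p, hp, rfl⟩
    rw [LinearMap.fst_apply, e, lp.inner_single_left] at h2
    exact h2

end ModelCore

/-! ### Smooth dependence of integrals on parameters -/

section Parametric

variable {α : Type*} [MeasurableSpace α] {μ : Measure α}
  {K V : Type} [NormedAddCommGroup K] [NormedAddCommGroup V] {k : α → K} {C : ℝ}

lemma aestronglyMeasurable_comp_param {F : Type*} [NormedAddCommGroup F] {G : K × V → F}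
    (hG : Continuous G) (hk : AEStronglyMeasurable k μ) (x : V) :
    AEStronglyMeasurable (fun a => G (k a, x)) μ :=
  (hG.comp (Continuous.prodMk_left x)).comp_aestronglyMeasurable hk

variable [NormedSpace ℝ K] [FiniteDimensional ℝ K] [NormedSpace ℝ V] [FiniteDimensional ℝ V]

/-- Finite dimension makes the parameters and a neighbourhood of `x` lie in a compact set, giving a
constant dominating function. -/
lemma exists_bound_param {F : Type*} [NormedAddCommGroup F] {G : K × V → F}
    (hG : Continuous G) (hC : ∀ᵐ a ∂μ, ‖k a‖ ≤ C) (x : V) :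
    ∃ B, ∀ᵐ a ∂μ, ∀ y ∈ Metric.ball x 1, ‖G (k a, y)‖ ≤ B := by
  obtain ⟨B, hB⟩ := ((isCompact_closedBall (0 : K) C).prod
    (isCompact_closedBall x 1)).exists_bound_of_continuousOn hG.continuousOn
  refine ⟨B, hC.mono fun a ha y hy => hB (k a, y) ⟨?_, Metric.ball_subset_closedBall hy⟩⟩
  rwa [mem_closedBall_zero_iff]

variable [IsFiniteMeasure μ]

lemma integrable_comp_param {F : Type*} [NormedAddCommGroup F] {G : K × V → F}
    (hG : Continuous G) (hk : AEStronglyMeasurable k μ) (hC : ∀ᵐ a ∂μ, ‖k a‖ ≤ C) (x : V) :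
    Integrable (fun a => G (k a, x)) μ := by
  obtain ⟨B, hB⟩ := exists_bound_param hG hC x
  exact Integrable.of_bound (aestronglyMeasurable_comp_param hG hk x) B
    (hB.mono fun a ha => ha x (Metric.mem_ball_self one_pos))

lemma hasFDerivAt_integral_param {F : Type*} [NormedAddCommGroup F] [NormedSpace ℝ F]
    {G : K × V → F} (hG : ContDiff ℝ ∞ G) (hk : AEStronglyMeasurable k μ)
    (hC : ∀ᵐ a ∂μ, ‖k a‖ ≤ C) (x : V) :
    HasFDerivAt (fun y => ∫ a, G (k a, y) ∂μ)
      (∫ a, (fderiv ℝ G (k a, x)).comp (ContinuousLinearMap.inr ℝ K V) ∂μ) x := by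
  have hG' : Continuous fun p => (fderiv ℝ G p).comp (ContinuousLinearMap.inr ℝ K V) :=
    (hG.continuous_fderiv (by simp)).clm_comp continuous_const
  obtain ⟨B, hB⟩ := exists_bound_param hG' hC x
  refine hasFDerivAt_integral_of_dominated_of_fderiv_le
    (F' := fun y a => (fderiv ℝ G (k a, y)).comp (ContinuousLinearMap.inr ℝ K V))
    (bound := fun _ => B) (Metric.ball_mem_nhds x one_pos)
    (Eventually.of_forall fun y => aestronglyMeasurable_comp_param hG.continuous hk y)
    (integrable_comp_param hG.continuous hk hC x) (aestronglyMeasurable_comp_param hG' hk x) hB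
    (integrable_const B) (Eventually.of_forall fun a y _ => ?_)
  exact (hG.differentiable (by simp) (k a, y)).hasFDerivAt.comp y (hasFDerivAt_prodMk_right (k a) y)

/-- The derivative is an integral of the same type with values in a space of linear maps, so the
induction is over all target spaces at once. -/
lemma contDiff_nat_integral_param (hk : AEStronglyMeasurable k μ) (hC : ∀ᵐ a ∂μ, ‖k a‖ ≤ C)
    (n : ℕ) : ∀ {F : Type} [NormedAddCommGroup F] [NormedSpace ℝ F] {G : K × V → F},
      ContDiff ℝ ∞ G → ContDiff ℝ n fun x => ∫ a, G (k a, x) ∂μ := by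
  induction n with
  | zero =>
    intro F _ _ G hG
    exact contDiff_zero.2 (continuous_iff_continuousAt.2 fun x =>
      (hasFDerivAt_integral_param hG hk hC x).continuousAt)
  | succ n ih =>
    intro F _ _ G hG
    push_cast
    exact contDiff_succ_iff_hasFDerivAt.2 ⟨_, ih ((hG.fderiv_right (m := ∞) (by simp)).clm_comp
      contDiff_const), hasFDerivAt_integral_param hG hk hC⟩

/-- The integral of a smooth function over a bounded family of parameters is smooth. -/
lemma contDiff_integral_param (hk : AEStronglyMeasurable k μ) (hC : ∀ᵐ a ∂μ, ‖k a‖ ≤ C)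
    {F : Type} [NormedAddCommGroup F] [NormedSpace ℝ F] {G : K × V → F} (hG : ContDiff ℝ ∞ G) :
    ContDiff ℝ ∞ fun x => ∫ a, G (k a, x) ∂μ :=
  contDiff_infty.2 fun n => contDiff_nat_integral_param hk hC n hG

end Parametric

/-! ### The radial coefficients of a test function -/

section Coefficient

attribute [local irreducible] gaugeAction

/-- Rescaling the two vectors of a configuration. -/
def rescale (r : ℝ × ℝ) (x : Config) : Config := ![r.1 • x 0, r.2 • x 1]

/-- The configuration of unit vectors with angle cosine `p.1`, rotated by `p.2`. -/
def unitConfig (p : ℝ × SU2) : Config := gaugeAction p.2.1 (sectionMap p.1 (1, 1))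

/-- The measure on the parameters of unit configurations. -/
abbrev unitMeasure : Measure (ℝ × SU2) :=
  ((volume : Measure ℝ).restrict (Ioo (-1) 1)).prod haarSU2

lemma contDiff_rescale : ContDiff ℝ ∞ fun p : Config × (ℝ × ℝ) => rescale p.2 p.1 := by
  rw [contDiff_pi]
  refine Fin.forall_fin_two.2 ⟨?_, ?_⟩
  · exact (contDiff_fst.comp contDiff_snd).smul ((contDiff_apply ℝ _ 0).comp contDiff_fst)
  · exact (contDiff_snd.comp contDiff_snd).smul ((contDiff_apply ℝ _ 1).comp contDiff_fst)

/-- The action is linear in each vector, so lengths factor out. All parameters other than `r` then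
stay bounded, and smoothness in `r` follows even across `0`. -/
lemma gaugeAction_sectionMap (g : SU2) (c : ℝ) (r : ℝ × ℝ) :
    gaugeAction g.1 (sectionMap c r) = rescale r (unitConfig (c, g)) := by
  funext i
  refine Fin.cases ?_ (fun i => ?_) i
  · change gaugeAction g.1 (sectionMap c r) 0 = r.1 • gaugeAction g.1 (sectionMap c (1, 1)) 0
    rw [gaugeAction_apply, gaugeAction_apply, ← vecIsometry_apply, ← vecIsometry_apply, ← map_smul,
      sectionMap_zero, sectionMap_zero, one_smul]
  · rw [Fin.fin_one_eq_zero i]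
    change gaugeAction g.1 (sectionMap c r) 1 = r.2 • gaugeAction g.1 (sectionMap c (1, 1)) 1
    rw [gaugeAction_apply, gaugeAction_apply, ← vecIsometry_apply, ← vecIsometry_apply, ← map_smul,
      sectionMap_one, sectionMap_one, one_smul]

lemma continuous_unitConfig : Continuous unitConfig := by
  have h1 : Continuous fun p : ℝ × SU2 => sectionMap p.1 (1, 1) := by
    have h : Continuous ((fun p : (ℝ × ℝ) × ℝ => sectionMap p.2 p.1) ∘
        fun p : ℝ × SU2 => (((1 : ℝ), (1 : ℝ)), p.1)) := continuous_sectionMap.comp (by fun_prop)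
    exact h
  have h2 : Continuous ((fun p : SU2 × Config => gaugeAction p.1.1 p.2) ∘
      fun p : ℝ × SU2 => (p.2, sectionMap p.1 (1, 1))) :=
    continuous_gaugeAction.comp (continuous_snd.prodMk h1)
  exact h2

lemma ae_unitMeasure : ∀ᵐ p ∂unitMeasure, |p.1| ≤ 1 := by
  have h1 : ∀ᵐ c ∂(volume : Measure ℝ).restrict (Ioo (-1) 1), c ∈ Ioo (-1 : ℝ) 1 :=
    ae_restrict_mem measurableSet_Ioo
  filter_upwards [(Measure.quasiMeasurePreserving_fst (ν := haarSU2)).ae h1] with p hp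
  exact abs_le.2 ⟨hp.1.le, hp.2.le⟩

lemma norm_unitConfig_zero (p : ℝ × SU2) : ‖unitConfig p 0‖ = 1 := by
  rw [unitConfig, gaugeAction_apply, norm_vecAction, norm_sectionMap_zero, abs_one]

lemma norm_unitConfig_one {p : ℝ × SU2} (hp : |p.1| ≤ 1) : ‖unitConfig p 1‖ = 1 := by
  rw [unitConfig, gaugeAction_apply, norm_vecAction, norm_sectionMap_one hp, abs_one]

lemma inner_unitConfig (p : ℝ × SU2) : inner ℝ (unitConfig p 0) (unitConfig p 1) = p.1 := by
  rw [unitConfig, gaugeAction_apply, gaugeAction_apply, ← vecIsometry_apply, ← vecIsometry_apply,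
    LinearIsometryEquiv.inner_map_map, inner_sectionMap, one_mul, one_mul]

lemma ae_norm_unitConfig : ∀ᵐ p ∂unitMeasure, ‖unitConfig p‖ ≤ 1 := by
  filter_upwards [ae_unitMeasure] with p hp
  exact (pi_norm_le_iff_of_nonneg zero_le_one).2 (Fin.forall_fin_two.2
    ⟨(norm_unitConfig_zero p).le, (norm_unitConfig_one hp).le⟩)

/-- The integral of a function against a Legendre polynomial over the configurations of given
lengths. -/
def angularIntegral (l : ℕ) (f : Config → ℂ) (r : ℝ × ℝ) : ℂ :=
  ∫ p, (normLegendre l (inner ℝ (unitConfig p 0) (unitConfig p 1)) : ℂ) *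
    f (rescale r (unitConfig p)) ∂unitMeasure

variable {f : Config → ℂ}

lemma contDiff_angularIntegrand (l : ℕ) (hf : ContDiff ℝ ∞ f) :
    ContDiff ℝ ∞ fun q : Config × (ℝ × ℝ) =>
      (normLegendre l (inner ℝ (q.1 0) (q.1 1)) : ℂ) * f (rescale q.2 q.1) := by
  have hL : ContDiff ℝ ∞ (normLegendre l) := contDiff_const.mul ((legendre l).contDiff_aeval ∞)
  refine (Complex.ofRealCLM.contDiff.comp (hL.comp ?_)).mul (hf.comp contDiff_rescale)
  exact ((contDiff_apply ℝ _ 0).comp contDiff_fst).inner ℝ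
    ((contDiff_apply ℝ _ 1).comp contDiff_fst)

lemma contDiff_angularIntegral (l : ℕ) (hf : ContDiff ℝ ∞ f) :
    ContDiff ℝ ∞ (angularIntegral l f) :=
  contDiff_integral_param continuous_unitConfig.aestronglyMeasurable ae_norm_unitConfig
    (contDiff_angularIntegrand l hf)

lemma angularIntegral_eq (l : ℕ) (hf : ContDiff ℝ ∞ f) (r : ℝ × ℝ) :
    angularIntegral l f r = ∫ c in Ioo (-1 : ℝ) 1,
      (normLegendre l c : ℂ) * average f (sectionMap c r) := by
  have hi := integrable_comp_param (contDiff_angularIntegrand l hf).continuous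
    continuous_unitConfig.aestronglyMeasurable ae_norm_unitConfig r
  rw [angularIntegral, integral_prod _ hi]
  refine integral_congr_ae (Eventually.of_forall fun c => ?_)
  simp only [inner_unitConfig, average]
  rw [integral_const_mul]
  simp only [gaugeAction_sectionMap]

lemma angularIntegral_eq_zero {l : ℕ} {r : ℝ × ℝ}
    (h : ∀ x : Config, ‖x 0‖ = |r.1| → ‖x 1‖ = |r.2| → f x = 0) : angularIntegral l f r = 0 := by
  refine integral_eq_zero_of_ae ?_
  filter_upwards [ae_unitMeasure] with p hp
  rw [h (rescale r (unitConfig p)) ?_ ?_, mul_zero]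
  · rfl
  · change ‖r.1 • unitConfig p 0‖ = _
    rw [norm_smul, norm_unitConfig_zero, mul_one, Real.norm_eq_abs]
  · change ‖r.2 • unitConfig p 1‖ = _
    rw [norm_smul, norm_unitConfig_one hp, mul_one, Real.norm_eq_abs]

/-- A smooth cutoff, vanishing below `δ / 2` and equal to `1` above `δ`. -/
def cutoff (δ s : ℝ) : ℝ := Real.smoothTransition (2 / δ * s - 1)

lemma contDiff_cutoff (δ : ℝ) : ContDiff ℝ ∞ (cutoff δ) :=
  Real.smoothTransition.contDiff.comp ((contDiff_const.mul contDiff_id).sub contDiff_const)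

lemma cutoff_of_le {δ s : ℝ} (hδ : 0 < δ) (hs : s ≤ δ / 2) : cutoff δ s = 0 := by
  refine Real.smoothTransition.zero_of_nonpos ?_
  have : 2 / δ * s ≤ 2 / δ * (δ / 2) := by gcongr
  rw [show 2 / δ * (δ / 2) = 1 by field_simp] at this
  linarith

lemma cutoff_of_ge {δ s : ℝ} (hδ : 0 < δ) (hs : δ ≤ s) : cutoff δ s = 1 := by
  refine Real.smoothTransition.one_of_one_le ?_
  have : 2 / δ * δ ≤ 2 / δ * s := by gcongr
  rw [show 2 / δ * δ = 2 by field_simp] at this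
  linarith

/-- The radial part of the component of angular momentum `l` of a function that vanishes where one
of the vectors is shorter than `δ`. -/
def radialCoefficient (δ : ℝ) (l : ℕ) (f : Config → ℂ) (r : ℝ × ℝ) : ℂ :=
  ((cutoff δ r.1 * cutoff δ r.2 * (2 * Real.pi * (r.1 * r.2)) : ℝ) : ℂ) * angularIntegral l f r

lemma support_radialCoefficient {δ R : ℝ} (hδ : 0 < δ) (hR : ∀ x, f x ≠ 0 → ‖x‖ ≤ R) (l : ℕ) :
    Function.support (radialCoefficient δ l f) ⊆ Icc (δ / 2) R ×ˢ Icc (δ / 2) R := by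
  intro r hr
  have h1 := left_ne_zero_of_mul hr
  have h2 : angularIntegral l f r ≠ 0 := right_ne_zero_of_mul hr
  rw [Complex.ofReal_ne_zero] at h1
  have h3 := left_ne_zero_of_mul h1
  have a0 : δ / 2 ≤ r.1 := by
    by_contra! h
    exact left_ne_zero_of_mul h3 (cutoff_of_le hδ h.le)
  have a1 : δ / 2 ≤ r.2 := by
    by_contra! h
    exact right_ne_zero_of_mul h3 (cutoff_of_le hδ h.le)
  have h4 : ∃ x : Config, ‖x 0‖ = |r.1| ∧ ‖x 1‖ = |r.2| ∧ f x ≠ 0 := by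
    by_contra! h
    exact h2 (angularIntegral_eq_zero h)
  obtain ⟨x, hx0, hx1, hx⟩ := h4
  have hn := hR x hx
  exact ⟨⟨a0, (le_abs_self _).trans (hx0 ▸ (norm_le_pi_norm x 0).trans hn)⟩,
    ⟨a1, (le_abs_self _).trans (hx1 ▸ (norm_le_pi_norm x 1).trans hn)⟩⟩

lemma isRadialTest_radialCoefficient {δ R : ℝ} (hδ : 0 < δ) (hR : ∀ x, f x ≠ 0 → ‖x‖ ≤ R)
    (hf : ContDiff ℝ ∞ f) (l : ℕ) : IsRadialTest (radialCoefficient δ l f) where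
  contDiff := by
    refine (Complex.ofRealCLM.contDiff.comp ?_).mul (contDiff_angularIntegral l hf)
    exact (((contDiff_cutoff δ).comp contDiff_fst).mul ((contDiff_cutoff δ).comp contDiff_snd)).mul
      (contDiff_const.mul (contDiff_fst.mul contDiff_snd))
  hasCompactSupport := HasCompactSupport.of_support_subset_isCompact
    (isCompact_Icc.prod isCompact_Icc) (support_radialCoefficient hδ hR l)
  tsupport_subset := by
    refine (closure_minimal (support_radialCoefficient hδ hR l)
      (isClosed_Icc.prod isClosed_Icc)).trans fun r hr => ⟨?_, ?_⟩
    · exact (half_pos hδ).trans_le hr.1.1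
    · exact (half_pos hδ).trans_le hr.2.1

lemma integrable_mul_average {Φ f : Config → ℂ} (hΦ : ∀ (g : SU2) x, Φ (gaugeAction g.1 x) = Φ x)
    (hf : StronglyMeasurable f) (hΦm : StronglyMeasurable Φ)
    (hint : Integrable fun x => Φ x * f x) :
    Integrable fun x => Φ x * average f x := by
  have h := (integrable_prod_mul_comp_gaugeAction hΦ hf hΦm hint).integral_prod_left
  simp only [integral_const_mul] at h
  exact h

/-- The wave is invariant, so `f` may be replaced by its average, a function of the relative
coordinates; integrating out the cosine leaves the radial coefficient. Its factor `2π r₁ r₂` is `8π²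
r₁² r₂² / (4π r₁ r₂)`. -/
lemma inner_waveIsometry_toState {δ R : ℝ} (hδ : 0 < δ) (hR : ∀ x, f x ≠ 0 → ‖x‖ ≤ R)
    (hf : IsTest f) (hf0 : ∀ x, ‖x 0‖ < δ ∨ ‖x 1‖ < δ → f x = 0) (l : ℕ) (h : RadialSpace) :
    ⟪waveIsometry l h, hf.toState⟫_ℂ =
      ⟪h, (isRadialTest_radialCoefficient hδ hR hf.contDiff l).toRadial⟫_ℂ := by
  rw [inner_eq_integral (coeFn_waveIsometry l h) hf.coeFn_toState,
    inner_eq_integral EventuallyEq.rfl (IsRadialTest.coeFn_toRadial _)]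
  set Φ : Config → ℂ := fun x => starRingEnd ℂ (partialWave l h x)
  have hm : Measurable h := (Lp.stronglyMeasurable h).measurable
  have hrel : ∀ (g : SU2) x, relCoords (gaugeAction g.1 x) = relCoords x := relCoords_gaugeAction
  have hΦ : ∀ (g : SU2) x, Φ (gaugeAction g.1 x) = Φ x := by
    intro g x
    have h1 : radii (gaugeAction g.1 x) = radii x := congrArg Prod.fst (hrel g x)
    simp only [Φ, partialWave, hrel, h1]
  have hΦm : StronglyMeasurable Φ := by
    refine Measurable.stronglyMeasurable ?_
    refine Complex.continuous_conj.measurable.comp (Measurable.mul ?_ ?_)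
    · exact Complex.measurable_ofReal.comp ((measurable_waveWeight l).comp measurable_relCoords)
    · exact hm.comp continuous_radii.measurable
  have hfm : StronglyMeasurable f := hf.continuous.stronglyMeasurable
  have hint : Integrable fun x => Φ x * f x := by
    have h1 := (memLp_partialWave l (Lp.memLp h)).star.integrable_mul (hf.memLp (μ := volume) 2)
    exact h1
  rw [integral_mul_average hΦ hfm hΦm hint]
  have hint2 := integrable_mul_average hΦ hfm hΦm hint
  let Ψ : (ℝ × ℝ) × ℝ → ℂ := fun p =>
    starRingEnd ℂ (waveWeight l p * h p.1) * average f (sectionMap p.2 p.1)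
  have hΨ : ∀ x, Φ x * average f x = Ψ (relCoords x) := by
    intro x
    rw [eq_comp_sectionMap (average_gaugeAction f) x]
    rfl
  have hΨm : StronglyMeasurable Ψ := by
    refine Measurable.stronglyMeasurable ?_
    refine (Complex.continuous_conj.measurable.comp ((Complex.measurable_ofReal.comp
      (measurable_waveWeight l)).mul (hm.comp measurable_fst))).mul ?_
    exact (stronglyMeasurable_average hfm).measurable.comp continuous_sectionMap.measurable
  simp only [hΨ] at hint2 ⊢
  rw [integrable_comp_relCoords hΨm.aestronglyMeasurable] at hint2
  rw [integral_comp_relCoords _ hΨm.aestronglyMeasurable]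
  have hcongr : (fun p : (ℝ × ℝ) × ℝ => ((8 * Real.pi ^ 2 * (p.1.1 ^ 2 * p.1.2 ^ 2) : ℝ) : ℂ) *
      Ψ p) =ᵐ[relMeasure] fun p => starRingEnd ℂ (h p.1) *
        ((2 * Real.pi * (p.1.1 * p.1.2) : ℝ) : ℂ) *
        ((normLegendre l p.2 : ℂ) * average f (sectionMap p.2 p.1)) := by
    filter_upwards [ae_relMeasure_pos] with p hp
    have e1 : 8 * Real.pi ^ 2 * (p.1.1 ^ 2 * p.1.2 ^ 2) * waveWeight l p =
        2 * Real.pi * (p.1.1 * p.1.2) * normLegendre l p.2 := by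
      unfold waveWeight
      have := hp.1.ne'
      have := hp.2.1.ne'
      have := Real.pi_pos.ne'
      field_simp
      ring
    have e2 := congrArg (fun z : ℝ => (z : ℂ)) e1
    simp only [Ψ, map_mul, Complex.conj_ofReal]
    push_cast at e2 ⊢
    linear_combination starRingEnd ℂ (h p.1) * average f (sectionMap p.2 p.1) * e2
  rw [integral_congr_ae hcongr, integral_prod _ (hint2.congr hcongr)]
  have hpos : ∀ᵐ r ∂radialMeasure, 0 < r.1 ∧ 0 < r.2 := by
    rw [radialMeasure, Measure.prod_restrict]
    filter_upwards [ae_restrict_mem (measurableSet_Ioi.prod measurableSet_Ioi)] with r hr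
    exact hr
  refine integral_congr_ae ?_
  filter_upwards [hpos] with r hr
  rw [integral_const_mul, ← angularIntegral_eq l hf.contDiff, radialCoefficient, mul_assoc]
  congr 1
  -- The cutoff is invisible: it equals `1` when both lengths are at least `δ`, and otherwise `f`
  -- vanishes on the whole orbit.
  by_cases hr' : δ ≤ r.1 ∧ δ ≤ r.2
  · rw [cutoff_of_ge hδ hr'.1, cutoff_of_ge hδ hr'.2, one_mul, one_mul]
  · rw [angularIntegral_eq_zero, mul_zero, mul_zero]
    intro x hx0 hx1
    refine hf0 x ?_
    rw [hx0, hx1, abs_of_pos hr.1, abs_of_pos hr.2]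
    by_contra! h2
    exact hr' h2

end Coefficient

/-! ### The form domain of the model operator -/

section FormDomain

lemma IsTest.exists_bound_support {f : Config → ℂ} (hf : IsTest f) :
    ∃ R : ℝ, 0 ≤ R ∧ ∀ x, f x ≠ 0 → ‖x‖ ≤ R := by
  obtain ⟨R, hR⟩ := hf.hasCompactSupport.isCompact.isBounded.subset_closedBall 0
  refine ⟨max R 0, le_max_right _ _, fun x hx => ?_⟩
  exact (mem_closedBall_zero_iff.1 (hR (subset_tsupport _ hx))).trans (le_max_left _ _)

lemma toState_eq_of_ae {f : Config → ℂ} (hf : IsTest f) {u : StateSpace} (h : u =ᵐ[volume] f) :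
    u = hf.toState :=
  Lp.ext (h.trans hf.coeFn_toState.symm)

/-- The kinetic energy of a finite sum of partial waves as an element of the state space. -/
lemma toState_kinetic_sum {ρ : ℕ → ℝ × ℝ → ℂ} (hρ : ∀ l, IsRadialTest (ρ l)) (N : ℕ)
    (hg : IsTest (∑ l ∈ Finset.range N, partialWave l (ρ l))) :
    hg.kinetic.toState =
      modelIsometry (∑ l ∈ Finset.range N, lp.single 2 l ((hρ l).radialKinetic l).toRadial) := by
  simp only [map_sum, modelIsometry_single]
  symm
  refine toState_eq_of_ae hg.kinetic
    ((coeFn_sum_waveIsometry (fun l => ((hρ l).radialKinetic l).coeFn_toRadial) _).trans ?_)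
  filter_upwards [ae_ne_zero] with x hx
  rw [kinetic_sum fun l _ => (hρ l).partialWave l, Finset.sum_apply, Finset.sum_apply]
  exact Finset.sum_congr rfl fun l _ => (kinetic_partialWave (hρ l) l hx.1 hx.2).symm

/-- The adjoint of `W` maps a test function vanishing where one of the vectors is short to the
form domain. -/
lemma inFormDomain_adjoint_toState_of_vanishing {f : Config → ℂ} (hf : IsTest f) {δ : ℝ}
    (hδ : 0 < δ) (hf0 : ∀ x, ‖x 0‖ < δ ∨ ‖x 1‖ < δ → f x = 0) :
    InFormDomain (modelGraph : Set (ModelSpace × ModelSpace))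
      (modelIsometry.toContinuousLinearMap.adjoint hf.toState) := by
  obtain ⟨R, hR0, hR⟩ := hf.exists_bound_support
  set ρ : ℕ → ℝ × ℝ → ℂ := fun l => radialCoefficient δ l f
  have hρ : ∀ l, IsRadialTest (ρ l) := isRadialTest_radialCoefficient hδ hR hf.contDiff
  set ψ : ModelSpace := modelIsometry.toContinuousLinearMap.adjoint hf.toState with hψdef
  have hψW : ∀ w : ModelSpace, ⟪ψ, w⟫_ℂ = ⟪hf.toState, modelIsometry w⟫_ℂ := fun w =>
    ContinuousLinearMap.adjoint_inner_left _ _ _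
  have hψ : ∀ l, ψ l = (hρ l).toRadial := by
    intro l
    refine ext_inner_left ℂ fun h => ?_
    rw [← inner_waveIsometry_toState hδ hR hf hf0 l h, ← modelIsometry_single]
    refine (lp.inner_single_left (𝕜 := ℂ) (G := fun _ : ℕ => RadialSpace) l h ψ).symm.trans ?_
    exact ContinuousLinearMap.adjoint_inner_right modelIsometry.toContinuousLinearMap
      (lp.single 2 l h) hf.toState
  let g : ℕ → Config → ℂ := fun N => ∑ l ∈ Finset.range N, partialWave l (ρ l)
  have hg : ∀ N, IsTest (g N) := fun N => IsTest.sum fun l _ => (hρ l).partialWave l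
  let u : ℕ → ModelSpace := fun N => ∑ l ∈ Finset.range N, lp.single 2 l (ψ l)
  have hu : ∀ N l, (u N) l = if l < N then (hρ l).toRadial else 0 := by
    intro N l
    simp only [u, sum_single_apply, hψ]
  have hq : ∀ N, ∃ v, (u N, v) ∈ modelCore := by
    intro N
    have ht : IsModelTest fun l => if l < N then ρ l else 0 := by
      refine ⟨(Set.finite_lt_nat N).subset fun l hl => ?_, fun l => ?_⟩
      · by_contra hne
        exact hl (if_neg hne)
      · split_ifs
        exacts [hρ l, IsRadialTest.zero]
    obtain ⟨p, hp, hp1⟩ := ht.exists_mem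
    refine ⟨p.2, ?_⟩
    have : u N = p.1 := by
      refine lp.ext (funext fun l => Lp.ext (EventuallyEq.trans ?_ (hp1 l).symm))
      rw [hu]
      split_ifs
      exacts [(hρ l).coeFn_toRadial, Lp.coeFn_zero _ _ _]
    rwa [this]
  choose v hv using hq
  have hlim : Tendsto u atTop (𝓝 ψ) :=
    (lp.hasSum_single (by norm_num) ψ).tendsto_sum_nat
  obtain ⟨B, hB⟩ := hlim.norm.bddAbove_range
  have hB' : ∀ N, ‖u N‖ ≤ B := fun N => hB ⟨N, rfl⟩
  have hB0 : 0 ≤ B := (norm_nonneg _).trans (hB' 0)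
  have hWu : ∀ N, modelIsometry (u N) = (hg N).toState := by
    intro N
    refine toState_eq_of_ae (hg N) ?_
    simp only [u, map_sum, modelIsometry_single, hψ]
    exact coeFn_sum_waveIsometry (fun l => (hρ l).coeFn_toRadial) _
  have hnorm : ∀ N, ‖(hg N).toState‖ = ‖u N‖ := fun N => by
    rw [← hWu, modelIsometry.norm_map]
  -- Only a bound uniform in `N` is needed. The kinetic part and the potential are estimated
  -- separately because the latter mixes angular momenta.
  refine inFormDomain_of_bounded isNonnegSymmetric_modelGraph (fun N => (u N, v N)) hv hlim
    (‖hf.kinetic.toState‖ * B + B * (R ^ 4 * B)) fun N => ?_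
  have hWv : modelIsometry (v N) = (hg N).scaled.toState := by
    have h1 := modelIsometry_mem_scaledGraph (hv N)
    rw [hWu] at h1
    exact isNonnegSymmetric_scaledGraph.snd_unique h1 (hg N).mem_scaledGraph
  have hsplit : (hg N).scaled.toState = (hg N).kinetic.toState + (hg N).potential_mul.toState := by
    symm
    refine toState_eq_of_ae _ ((Lp.coeFn_add _ _).trans ?_)
    exact (hg N).kinetic.coeFn_toState.add (hg N).potential_mul.coeFn_toState
  simp only
  rw [← modelIsometry.inner_map_map, hWv, hWu, hsplit, inner_add_right, Complex.add_re]
  refine add_le_add ?_ ?_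
  · have h1 : ⟪(hg N).toState, (hg N).kinetic.toState⟫_ℂ =
        ⟪hf.toState, (hg N).kinetic.toState⟫_ℂ := by
      rw [toState_kinetic_sum hρ N (hg N), ← hψW, ← hWu, modelIsometry.inner_map_map, inner_sum,
        inner_sum]
      refine Finset.sum_congr rfl fun l hl => ?_
      rw [lp.inner_single_right, lp.inner_single_right, hu, if_pos (Finset.mem_range.1 hl), hψ]
    have h2 : ⟪hf.toState, (hg N).kinetic.toState⟫_ℂ = ⟪hf.kinetic.toState, (hg N).toState⟫_ℂ := by
      rw [inner_eq_integral hf.coeFn_toState (hg N).kinetic.coeFn_toState,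
        inner_eq_integral hf.kinetic.coeFn_toState (hg N).coeFn_toState,
        integral_kinetic_symm hf (hg N)]
    rw [h1, h2]
    refine (Complex.re_le_norm _).trans ((norm_inner_le_norm _ _).trans ?_)
    rw [hnorm]
    exact mul_le_mul_of_nonneg_left (hB' N) (norm_nonneg _)
  · refine (Complex.re_le_norm _).trans ((norm_inner_le_norm _ _).trans ?_)
    have h1 : ‖(hg N).potential_mul.toState‖ ≤ R ^ 4 * ‖(hg N).toState‖ := by
      refine Lp.norm_le_mul_norm_of_ae_le_mul ?_
      filter_upwards [(hg N).potential_mul.coeFn_toState, (hg N).coeFn_toState] with x h1 h2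
      rw [h1, h2, norm_mul, Complex.norm_real, Real.norm_of_nonneg (potential_nonneg x)]
      by_cases hx : g N x = 0
      · simp [hx]
      refine mul_le_mul_of_nonneg_right ?_ (norm_nonneg _)
      obtain ⟨l, -, hl⟩ := Finset.exists_ne_zero_of_sum_ne_zero
        (by rwa [← Finset.sum_apply] : ∑ l ∈ Finset.range N, partialWave l (ρ l) x ≠ 0)
      have h3 := support_radialCoefficient hδ hR l (right_ne_zero_of_mul hl)
      have h4 : ‖x 0‖ ≤ R := h3.1.2
      have h5 : ‖x 1‖ ≤ R := h3.2.2
      calc potential x ≤ ‖x 0‖ ^ 2 * ‖x 1‖ ^ 2 := by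
            rw [potential_eq]
            linarith [sq_nonneg (inner ℝ (x 0) (x 1))]
        _ ≤ R ^ 2 * R ^ 2 := by gcongr
        _ = R ^ 4 := by ring
    refine mul_le_mul ((hnorm N).trans_le (hB' N)) (h1.trans ?_) (norm_nonneg _) hB0
    rw [hnorm]
    exact mul_le_mul_of_nonneg_left (hB' N) (by positivity)

end FormDomain

/-! ### Removing the configurations with a short vector -/

section Truncation

/-- The quantity is scale invariant: it depends on `u = 2 s / δ` only, is continuous on `[0, 2]` and
vanishes beyond. -/
lemma exists_bound_deriv_cutoff :
    ∃ B : ℝ, 0 ≤ B ∧ ∀ δ s : ℝ, 0 < δ → 0 ≤ s → |deriv (cutoff δ) s| * s ≤ B := by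
  have hd : Continuous (deriv Real.smoothTransition) :=
    (Real.smoothTransition.contDiff (n := 1)).continuous_deriv le_rfl
  have hc : Continuous fun u : ℝ => u * deriv Real.smoothTransition (u - 1) :=
    continuous_id.mul (hd.comp (continuous_id.sub continuous_const))
  obtain ⟨B, hB⟩ := (isCompact_Icc (a := (0 : ℝ)) (b := 2)).exists_bound_of_continuousOn
    hc.continuousOn
  have hB0 : 0 ≤ B := (norm_nonneg _).trans (hB 0 ⟨le_rfl, zero_le_two⟩)
  refine ⟨B, hB0, fun δ s hδ hs => ?_⟩
  have h1 : HasDerivAt (cutoff δ) (deriv Real.smoothTransition (2 / δ * s - 1) * (2 / δ)) s := by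
    have h2 : HasDerivAt (fun s : ℝ => 2 / δ * s - 1) (2 / δ) s := by
      simpa using ((hasDerivAt_id s).const_mul (2 / δ)).sub_const 1
    exact ((Real.smoothTransition.contDiff (n := 1)).differentiable one_ne_zero
      _).hasDerivAt.comp s h2
  have h3 : |deriv (cutoff δ) s| * s =
      ‖(2 / δ * s) * deriv Real.smoothTransition (2 / δ * s - 1)‖ := by
    rw [h1.deriv, Real.norm_eq_abs, abs_mul, abs_mul, abs_mul, abs_of_nonneg hs]
    ring
  rw [h3]
  have hu : 0 ≤ 2 / δ * s := by positivity
  rcases le_or_gt (2 / δ * s) 2 with hle | hgt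
  · exact hB _ ⟨hu, hle⟩
  · have h4 : Real.smoothTransition =ᶠ[𝓝 (2 / δ * s - 1)] fun _ => 1 := by
      filter_upwards [eventually_gt_nhds (show (1 : ℝ) < 2 / δ * s - 1 by linarith)] with t ht
      exact Real.smoothTransition.one_of_one_le ht.le
    rw [h4.deriv_eq, deriv_const, mul_zero, norm_zero]
    exact hB0

lemma cutoff_nonneg (δ s : ℝ) : 0 ≤ cutoff δ s := Real.smoothTransition.nonneg _

lemma cutoff_le_one (δ s : ℝ) : cutoff δ s ≤ 1 := Real.smoothTransition.le_one _

/-- A smooth function on configuration space vanishing where one of the vectors is short. -/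
def truncation (δ : ℝ) (x : Config) : ℝ := cutoff (δ ^ 2) (‖x 0‖ ^ 2) * cutoff (δ ^ 2) (‖x 1‖ ^ 2)

/-- Cutting off in the squared lengths keeps the truncation smooth where a vector vanishes. -/
lemma contDiff_truncation (δ : ℝ) : ContDiff ℝ ∞ (truncation δ) :=
  ((contDiff_cutoff _).comp ((contDiff_apply ℝ _ 0).norm_sq ℝ)).mul
    ((contDiff_cutoff _).comp ((contDiff_apply ℝ _ 1).norm_sq ℝ))

lemma truncation_nonneg (δ : ℝ) (x : Config) : 0 ≤ truncation δ x :=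
  mul_nonneg (cutoff_nonneg _ _) (cutoff_nonneg _ _)

lemma truncation_le_one (δ : ℝ) (x : Config) : truncation δ x ≤ 1 :=
  mul_le_one₀ (cutoff_le_one _ _) (cutoff_nonneg _ _) (cutoff_le_one _ _)

lemma truncation_eq_zero {δ : ℝ} (hδ : 0 < δ) {x : Config} (hx : ‖x 0‖ < δ / 2 ∨ ‖x 1‖ < δ / 2) :
    truncation δ x = 0 := by
  have h : ∀ s : ℝ, 0 ≤ s → s < δ / 2 → cutoff (δ ^ 2) (s ^ 2) = 0 := fun s hs0 hs =>
    cutoff_of_le (by positivity) (by nlinarith)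
  rcases hx with hx | hx
  · rw [truncation, h _ (norm_nonneg _) hx, zero_mul]
  · rw [truncation, h _ (norm_nonneg _) hx, mul_zero]

lemma truncation_eq_one {δ : ℝ} (hδ : 0 < δ) {x : Config} (h0 : δ ≤ ‖x 0‖) (h1 : δ ≤ ‖x 1‖) :
    truncation δ x = 1 := by
  rw [truncation, cutoff_of_ge (by positivity) (by gcongr), cutoff_of_ge (by positivity)
    (by gcongr), one_mul]

lemma fderiv_cutoff_norm_sq (δ : ℝ) (j : Fin 2) (x : Config) :
    HasFDerivAt (fun x : Config => cutoff δ (‖x j‖ ^ 2))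
      (deriv (cutoff δ) (‖x j‖ ^ 2) • 2 • (innerSL ℝ (x j)).comp
        (ContinuousLinearMap.proj (R := ℝ) (φ := fun _ : Fin 2 => EuclideanSpace ℝ (Fin 3)) j))
      x := by
  have h1 : HasDerivAt (cutoff δ) (deriv (cutoff δ) (‖x j‖ ^ 2)) (‖x j‖ ^ 2) :=
    ((contDiff_cutoff δ).differentiable (by simp) _).hasDerivAt
  have h2 : HasFDerivAt (fun x : Config => x j) (ContinuousLinearMap.proj (R := ℝ)
      (φ := fun _ : Fin 2 => EuclideanSpace ℝ (Fin 3)) j) x :=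
    hasFDerivAt_apply j x
  have h3 : HasFDerivAt ((cutoff δ) ∘ fun x : Config => ‖x j‖ ^ 2) _ x :=
    HasDerivAt.comp_hasFDerivAt (h₂ := cutoff δ) (f := fun x : Config => ‖x j‖ ^ 2) x h1
      h2.norm_sq
  exact h3

/-- The gradient of a cutoff in `‖x i‖²` is of size `|cutoff'| · 2 ‖x i‖`; multiplied by `‖x i‖` it
is scale invariant, which gives a constant independent of `δ`. -/
lemma exists_bound_fderiv_truncation :
    ∃ B : ℝ, 0 ≤ B ∧ ∀ (δ : ℝ) (i : Fin 2) (a : Fin 3) (x : Config), 0 < δ →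
      |fderiv ℝ (truncation δ) x (direction i a)| * ‖x i‖ ≤ B := by
  obtain ⟨B, hB0, hB⟩ := exists_bound_deriv_cutoff
  refine ⟨2 * B, by positivity, fun δ i a x hδ => ?_⟩
  have h0 := fderiv_cutoff_norm_sq (δ ^ 2) 0 x
  have h1 := fderiv_cutoff_norm_sq (δ ^ 2) 1 x
  have hd : fderiv ℝ (truncation δ) x = _ := (h0.mul h1).fderiv
  have key : ∀ (j : Fin 2) (t : ℝ), 0 ≤ t → t ≤ 1 →
      |t * (deriv (cutoff (δ ^ 2)) (‖x j‖ ^ 2) * (2 * inner ℝ (x j)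
        (EuclideanSpace.single a 1)))| * ‖x j‖ ≤ 2 * B := by
    intro j t ht0 ht1
    have e1 := hB (δ ^ 2) (‖x j‖ ^ 2) (by positivity) (by positivity)
    have e2 : |inner ℝ (x j) (EuclideanSpace.single a (1 : ℝ))| ≤ ‖x j‖ := by
      refine (abs_real_inner_le_norm _ _).trans ?_
      simp
    rw [abs_mul, abs_mul, abs_mul, abs_of_nonneg ht0, abs_two]
    calc t * (|deriv (cutoff (δ ^ 2)) (‖x j‖ ^ 2)| *
          (2 * |inner ℝ (x j) (EuclideanSpace.single a (1 : ℝ))|)) * ‖x j‖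
        ≤ 1 * (|deriv (cutoff (δ ^ 2)) (‖x j‖ ^ 2)| * (2 * ‖x j‖)) * ‖x j‖ := by gcongr
      _ = 2 * (|deriv (cutoff (δ ^ 2)) (‖x j‖ ^ 2)| * ‖x j‖ ^ 2) := by ring
      _ ≤ 2 * B := by gcongr
  rw [hd]
  fin_cases i
  · have := key 0 (cutoff (δ ^ 2) (‖x 1‖ ^ 2)) (cutoff_nonneg _ _) (cutoff_le_one _ _)
    simpa [direction] using this
  · have := key 1 (cutoff (δ ^ 2) (‖x 0‖ ^ 2)) (cutoff_nonneg _ _) (cutoff_le_one _ _)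
    simpa [direction] using this

/-! ### Local integrability of the inverse squares and the bound on the truncated form -/

lemma integrable_inv_sq_relCoords (R : ℝ) :
    Integrable fun x : Config => (Icc (0 : ℝ) R ×ˢ Icc (0 : ℝ) R).indicator
      (fun r : ℝ × ℝ => (r.1 ^ 2)⁻¹ + (r.2 ^ 2)⁻¹) (radii x) := by
  set S : Set (ℝ × ℝ) := Icc (0 : ℝ) R ×ˢ Icc (0 : ℝ) R
  have hS : MeasurableSet S := measurableSet_Icc.prod measurableSet_Icc
  let Φ : (ℝ × ℝ) × ℝ → ℂ := fun p =>
    ((S.indicator (fun r : ℝ × ℝ => (r.1 ^ 2)⁻¹ + (r.2 ^ 2)⁻¹) p.1 : ℝ) : ℂ)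
  have hΦ : Measurable Φ := by
    have hm : Measurable (S.indicator fun r : ℝ × ℝ => (r.1 ^ 2)⁻¹ + (r.2 ^ 2)⁻¹) :=
      Measurable.indicator (by fun_prop) hS
    exact Complex.measurable_ofReal.comp (hm.comp measurable_fst)
  have h1 : Integrable fun x => Φ (relCoords x) := by
    rw [integrable_comp_relCoords hΦ.aestronglyMeasurable]
    -- The Jacobian `r₁² r₂²` cancels the singularity and leaves a continuous function on a compact
    -- square.
    have h2 : Integrable (S.indicator fun r : ℝ × ℝ =>
        ((8 * Real.pi ^ 2 * (r.1 ^ 2 + r.2 ^ 2) : ℝ) : ℂ)) radialMeasure := by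
      have h3 : Continuous fun r : ℝ × ℝ => ((8 * Real.pi ^ 2 * (r.1 ^ 2 + r.2 ^ 2) : ℝ) : ℂ) := by
        fun_prop
      have h4 := (h3.continuousOn.integrableOn_compact (μ := (volume : Measure (ℝ × ℝ)))
        (isCompact_Icc.prod isCompact_Icc) : IntegrableOn _ S volume)
      rw [radialMeasure, Measure.prod_restrict, ← Measure.volume_eq_prod]
      exact ((integrable_indicator_iff hS).2 h4).restrict
    have h5 := h2.mul_prod (integrable_const (1 : ℂ)
      (μ := (volume : Measure ℝ).restrict (Ioo (-1) 1)))
    refine h5.congr ?_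
    filter_upwards [ae_relMeasure_pos] with p hp
    have := hp.1.ne'
    have := hp.2.1.ne'
    by_cases hpS : p.1 ∈ S
    · simp only [Φ, indicator_of_mem hpS, mul_one]
      rw [← Complex.ofReal_mul]
      congr 1
      field_simp
      ring
    · simp only [Φ, indicator_of_notMem hpS, Complex.ofReal_zero, mul_zero, zero_mul]
  exact h1.re

lemma IsTest.integrable_sq_div {f : Config → ℂ} (hf : IsTest f) (i : Fin 2) :
    Integrable fun x => ‖f x‖ ^ 2 / ‖x i‖ ^ 2 := by
  obtain ⟨R, hR0, hR⟩ := hf.exists_bound_support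
  obtain ⟨M, hM⟩ := hf.continuous.bounded_above_of_compact_support hf.hasCompactSupport
  have hm : Measurable fun x : Config => ‖x i‖ := (measurable_pi_apply i).norm
  refine ((integrable_inv_sq_relCoords R).const_mul (M ^ 2)).mono'
    ((hf.continuous.measurable.norm.pow_const 2).div (hm.pow_const 2)).aestronglyMeasurable
    (Eventually.of_forall fun x => ?_)
  rw [Real.norm_of_nonneg (by positivity)]
  by_cases hx : f x = 0
  · rw [hx, norm_zero, zero_pow two_ne_zero, zero_div]
    refine mul_nonneg (by positivity) (indicator_nonneg (fun r _ => by positivity) _)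
  · have h1 := hR x hx
    have h2 : radii x ∈ Icc (0 : ℝ) R ×ˢ Icc (0 : ℝ) R :=
      ⟨⟨norm_nonneg _, (norm_le_pi_norm x 0).trans h1⟩,
        ⟨norm_nonneg _, (norm_le_pi_norm x 1).trans h1⟩⟩
    rw [indicator_of_mem h2, div_eq_mul_inv]
    have h3 : (‖x i‖ ^ 2)⁻¹ ≤ (‖x 0‖ ^ 2)⁻¹ + (‖x 1‖ ^ 2)⁻¹ := by
      fin_cases i
      · exact le_add_of_nonneg_right (by positivity)
      · exact le_add_of_nonneg_left (by positivity)
    have h4 := hM x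
    change ‖f x‖ ^ 2 * (‖x i‖ ^ 2)⁻¹ ≤ M ^ 2 * ((‖x 0‖ ^ 2)⁻¹ + (‖x 1‖ ^ 2)⁻¹)
    gcongr

/-- The product of a test function with the truncation. -/
def truncate (δ : ℝ) (f : Config → ℂ) (x : Config) : ℂ := (truncation δ x : ℂ) * f x

lemma IsTest.truncate {f : Config → ℂ} (hf : IsTest f) (δ : ℝ) : IsTest (truncate δ f) :=
  hf.mul_left (Complex.ofRealCLM.contDiff.comp (contDiff_truncation δ))

lemma norm_truncate_le (δ : ℝ) (f : Config → ℂ) (x : Config) : ‖truncate δ f x‖ ≤ ‖f x‖ := by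
  rw [truncate, norm_mul, Complex.norm_real, Real.norm_of_nonneg (truncation_nonneg δ x)]
  exact mul_le_of_le_one_left (norm_nonneg _) (truncation_le_one δ x)

lemma norm_momentum_truncate_sq_le {B : ℝ} (hB : ∀ (δ : ℝ) (i : Fin 2) (a : Fin 3) (x : Config),
      0 < δ → |fderiv ℝ (truncation δ) x (direction i a)| * ‖x i‖ ≤ B) {f : Config → ℂ}
    (hf : IsTest f) {δ : ℝ} (hδ : 0 < δ) (i : Fin 2) (a : Fin 3) {x : Config} (hx : x i ≠ 0) :
    ‖momentum (direction i a) (truncate δ f) x‖ ^ 2 ≤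
      2 * ‖momentum (direction i a) f x‖ ^ 2 + 2 * B ^ 2 * (‖f x‖ ^ 2 / ‖x i‖ ^ 2) := by
  have hx' : 0 < ‖x i‖ := norm_pos_iff.2 hx
  have h1 : HasFDerivAt (fun x => (truncation δ x : ℂ))
      (Complex.ofRealCLM.comp (fderiv ℝ (truncation δ) x)) x :=
    Complex.ofRealCLM.hasFDerivAt.comp x
      ((contDiff_truncation δ).differentiable (by simp) x).hasFDerivAt
  have h2 := h1.mul (hf.differentiable x).hasFDerivAt
  have h3 : momentum (direction i a) (truncate δ f) x =
      (truncation δ x : ℂ) * momentum (direction i a) f x +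
        -Complex.I * (f x * (fderiv ℝ (truncation δ) x (direction i a) : ℂ)) := by
    have h4 : fderiv ℝ (truncate δ f) x = _ := h2.fderiv
    rw [momentum, h4, momentum]
    simp
    ring
  have h5 : ‖(truncation δ x : ℂ) * momentum (direction i a) f x‖ ≤
      ‖momentum (direction i a) f x‖ := norm_truncate_le δ (momentum (direction i a) f) x
  have h6 : ‖-Complex.I * (f x * (fderiv ℝ (truncation δ) x (direction i a) : ℂ))‖ ≤
      B * (‖f x‖ / ‖x i‖) := by
    rw [norm_mul, norm_neg, Complex.norm_I, one_mul, norm_mul, Complex.norm_real,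
      Real.norm_eq_abs]
    have h7 := (le_div_iff₀ hx').2 (hB δ i a x hδ)
    calc ‖f x‖ * |fderiv ℝ (truncation δ) x (direction i a)| ≤ ‖f x‖ * (B / ‖x i‖) := by gcongr
      _ = B * (‖f x‖ / ‖x i‖) := by ring
  rw [h3]
  have h8 := (norm_add_le _ _).trans (add_le_add h5 h6)
  calc ‖(truncation δ x : ℂ) * momentum (direction i a) f x +
        -Complex.I * (f x * (fderiv ℝ (truncation δ) x (direction i a) : ℂ))‖ ^ 2
      ≤ (‖momentum (direction i a) f x‖ + B * (‖f x‖ / ‖x i‖)) ^ 2 := by gcongr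
    _ ≤ 2 * ‖momentum (direction i a) f x‖ ^ 2 + 2 * (B * (‖f x‖ / ‖x i‖)) ^ 2 := by
        nlinarith [sq_nonneg (‖momentum (direction i a) f x‖ - B * (‖f x‖ / ‖x i‖))]
    _ = 2 * ‖momentum (direction i a) f x‖ ^ 2 + 2 * B ^ 2 * (‖f x‖ ^ 2 / ‖x i‖ ^ 2) := by
        rw [mul_pow, div_pow]
        ring

lemma IsTest.integrable_norm_sq {f : Config → ℂ} (hf : IsTest f) :
    Integrable fun x => ‖f x‖ ^ 2 :=
  (memLp_two_iff_integrable_sq_norm hf.continuous.aestronglyMeasurable).1 (hf.memLp 2)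

lemma re_integral_conj_mul_self (f : Config → ℂ) :
    (∫ x, starRingEnd ℂ (f x) * f x).re = ∫ x, ‖f x‖ ^ 2 := by
  have h : ∀ x, starRingEnd ℂ (f x) * f x = ((‖f x‖ ^ 2 : ℝ) : ℂ) := fun x => by
    rw [Complex.conj_mul']
    push_cast
    rfl
  simp only [h]
  rw [integral_complex_ofReal, Complex.ofReal_re]

/-- The quadratic form of `4 H`. -/
lemma IsTest.re_inner_scaled {f : Config → ℂ} (hf : IsTest f) :
    (⟪hf.toState, hf.scaled.toState⟫_ℂ).re =
      (∑ i, ∑ a, ∫ x, ‖MatrixModel.momentum (direction i a) f x‖ ^ 2) +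
        ∫ x, potential x * ‖f x‖ ^ 2 := by
  rw [inner_eq_integral hf.coeFn_toState hf.scaled.coeFn_toState]
  simp only [mul_add]
  rw [integral_add (hf.integrable_conj_mul hf.kinetic) (hf.integrable_conj_mul hf.potential_mul),
    integral_conj_mul_kinetic hf hf, Complex.add_re]
  congr 1
  · simp only [Complex.re_sum, re_integral_conj_mul_self]
  · have h : ∀ x, starRingEnd ℂ (f x) * ((potential x : ℂ) * f x) =
        ((potential x * ‖f x‖ ^ 2 : ℝ) : ℂ) := fun x => by
      push_cast
      rw [← Complex.conj_mul']
      ring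
    simp only [h]
    rw [integral_complex_ofReal, Complex.ofReal_re]

/-- By the product rule the extra kinetic energy is at most a multiple of `∫ |f|² / ‖x i‖²`,
uniformly in `δ`. The form need not converge. -/
lemma IsTest.exists_bound_truncate {f : Config → ℂ} (hf : IsTest f) :
    ∃ C : ℝ, ∀ δ, 0 < δ →
      (⟪(hf.truncate δ).toState, (hf.truncate δ).scaled.toState⟫_ℂ).re ≤ C := by
  obtain ⟨B, hB0, hB⟩ := exists_bound_fderiv_truncation
  have hpi : ∀ {g : Config → ℂ}, IsTest g → Integrable fun x => potential x * ‖g x‖ ^ 2 := by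
    intro g hg
    have h1 : Continuous fun x => potential x * ‖g x‖ ^ 2 :=
      contDiff_potential.continuous.mul (hg.continuous.norm.pow 2)
    refine h1.integrable_of_hasCompactSupport (hg.hasCompactSupport.mono fun x hx => ?_)
    intro h0
    exact hx (by simp [h0])
  refine ⟨(∑ i, ∑ a, ∫ x, (2 * ‖MatrixModel.momentum (direction i a) f x‖ ^ 2 +
    2 * B ^ 2 * (‖f x‖ ^ 2 / ‖x i‖ ^ 2))) + ∫ x, potential x * ‖f x‖ ^ 2, fun δ hδ => ?_⟩
  rw [IsTest.re_inner_scaled]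
  refine add_le_add (Finset.sum_le_sum fun i _ => Finset.sum_le_sum fun a _ => ?_) ?_
  · refine integral_mono_ae ((hf.truncate δ).momentum _).integrable_norm_sq
      (((hf.momentum _).integrable_norm_sq.const_mul 2).add
        ((hf.integrable_sq_div i).const_mul (2 * B ^ 2))) ?_
    filter_upwards [ae_ne_zero] with x hx
    refine norm_momentum_truncate_sq_le hB hf hδ i a ?_
    fin_cases i
    exacts [hx.1, hx.2]
  · refine integral_mono (hpi (hf.truncate δ)) (hpi hf) fun x => ?_
    exact mul_le_mul_of_nonneg_left (pow_le_pow_left₀ (norm_nonneg _) (norm_truncate_le δ f x) 2)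
      (potential_nonneg x)

lemma IsTest.tendsto_truncate {f : Config → ℂ} (hf : IsTest f) :
    Tendsto (fun n : ℕ => (hf.truncate (1 / ((n : ℝ) + 1))).toState) atTop (𝓝 hf.toState) := by
  rw [tendsto_iff_norm_sub_tendsto_zero]
  have h1 : ∀ n : ℕ, ‖(hf.truncate (1 / ((n : ℝ) + 1))).toState - hf.toState‖ ^ 2 =
      ∫ x, ‖MatrixModel.truncate (1 / ((n : ℝ) + 1)) f x - f x‖ ^ 2 := by
    intro n
    have h2 := (Lp.coeFn_sub (hf.truncate (1 / ((n : ℝ) + 1))).toState hf.toState).trans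
      ((hf.truncate (1 / ((n : ℝ) + 1))).coeFn_toState.sub hf.coeFn_toState)
    rw [← inner_self_eq_norm_sq (𝕜 := ℂ), inner_eq_integral h2 h2]
    exact re_integral_conj_mul_self _
  have h3 : Tendsto (fun n : ℕ => ∫ x, ‖MatrixModel.truncate (1 / ((n : ℝ) + 1)) f x - f x‖ ^ 2)
      atTop (𝓝 (∫ _ : Config, 0)) := by
    refine tendsto_integral_of_dominated_convergence (fun x => (2 * ‖f x‖) ^ 2) (fun n => ?_) ?_
      (fun n => Eventually.of_forall fun x => ?_) ?_
    · exact (((hf.truncate _).continuous.sub hf.continuous).norm.pow 2).aestronglyMeasurable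
    · simp only [mul_pow]
      exact hf.integrable_norm_sq.const_mul _
    · rw [Real.norm_of_nonneg (by positivity)]
      refine pow_le_pow_left₀ (norm_nonneg _) ((norm_sub_le _ _).trans ?_) 2
      linarith [norm_truncate_le (1 / ((n : ℝ) + 1)) f x]
    · filter_upwards [ae_ne_zero] with x hx
      refine tendsto_const_nhds.congr' ?_
      have e0 := tendsto_one_div_add_atTop_nhds_zero_nat (𝕜 := ℝ)
      filter_upwards [e0.eventually_le_const (norm_pos_iff.2 hx.1),
        e0.eventually_le_const (norm_pos_iff.2 hx.2)] with n hn0 hn1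
      rw [MatrixModel.truncate, truncation_eq_one (by positivity) hn0 hn1]
      simp
  rw [integral_zero] at h3
  have h4 := h3.sqrt
  simp only [← h1, Real.sqrt_sq (norm_nonneg _), Real.sqrt_zero] at h4
  exact h4

/-- The adjoint of `W` maps the core of `4 H` to the form domain of the model operator. -/
theorem inFormDomain_adjoint {p : StateSpace × StateSpace} (hp : p ∈ scaledGraph) :
    InFormDomain (modelGraph : Set (ModelSpace × ModelSpace))
      (modelIsometry.toContinuousLinearMap.adjoint p.1) := by
  obtain ⟨f, hf, hp1, -⟩ := hp
  obtain ⟨C, hC⟩ := hf.exists_bound_truncate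
  rw [toState_eq_of_ae hf hp1]
  refine inFormDomain_adjoint_of_bounded isNonnegSymmetric_scaledGraph
    isNonnegSymmetric_modelGraph (fun q hq => modelIsometry_mem_scaledGraph hq)
    (fun n : ℕ => ((hf.truncate (1 / ((n : ℝ) + 1))).toState,
      (hf.truncate (1 / ((n : ℝ) + 1))).scaled.toState))
    (fun n => (hf.truncate _).mem_scaledGraph) (fun n => ?_) hf.tendsto_truncate C
    fun n => hC _ (by positivity)
  have hδ : 0 < 1 / ((n : ℝ) + 1) := by positivity
  -- The truncation at scale `δ` vanishes below `δ / 2`, so that is the radius passed on.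
  refine inFormDomain_adjoint_toState_of_vanishing (hf.truncate _) (half_pos hδ) fun x hx => ?_
  rw [MatrixModel.truncate, truncation_eq_zero hδ hx, Complex.ofReal_zero, zero_mul]

end Truncation

/-! ### The Friedrichs extensions -/

section Main

/-- The graph of the Hamiltonian on test functions. -/
def hamiltonianGraph : Submodule ℂ (StateSpace × StateSpace) :=
  scaledGraph.comap (LinearMap.prodMap LinearMap.id ((4 : ℂ) • LinearMap.id))

lemma mem_hamiltonianGraph {p : StateSpace × StateSpace} :
    p ∈ hamiltonianGraph ↔ (p.1, (4 : ℂ) • p.2) ∈ scaledGraph := Iff.rfl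

lemma coe_hamiltonianGraph : (hamiltonianGraph : Set (StateSpace × StateSpace)) =
    hamiltonianCore := by
  ext p
  have h4 : (4 : ℂ) ≠ 0 := by norm_num
  have h1 : ∀ f : Config → ℂ, ((4 : ℂ) • p.2 : StateSpace) =ᵐ[volume]
      (fun x => kinetic f x + potential x * f x) ↔ p.2 =ᵐ[volume] hamiltonian f := by
    intro f
    have h2 := Lp.coeFn_smul (4 : ℂ) p.2
    constructor
    · intro h
      filter_upwards [h, h2] with x hx hx2
      rw [hx2, ← four_mul_hamiltonian] at hx
      exact mul_left_cancel₀ h4 hx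
    · intro h
      filter_upwards [h, h2] with x hx hx2
      rw [hx2, ← four_mul_hamiltonian, Pi.smul_apply, hx, smul_eq_mul]
  constructor
  · rintro ⟨f, hf, hp1, hp2⟩
    exact ⟨f, hf.contDiff, hf.hasCompactSupport, hp1, (h1 f).1 hp2⟩
  · rintro ⟨f, hf, hfs, hp1, hp2⟩
    exact ⟨f, ⟨hf, hfs⟩, hp1, (h1 f).2 hp2⟩

lemma mem_scaledGraph_iff {p : StateSpace × StateSpace} :
    p ∈ scaledGraph ↔ (p.1, (4 : ℂ)⁻¹ • p.2) ∈ hamiltonianGraph := by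
  rw [mem_hamiltonianGraph, smul_inv_smul₀ (by norm_num)]

lemma isNonnegSymmetric_hamiltonianGraph : IsNonnegSymmetric hamiltonianGraph where
  symm := by
    intro p hp q hq
    have h := isNonnegSymmetric_scaledGraph.symm _ hp _ hq
    simp only [LinearMap.prodMap_apply, LinearMap.id_apply, LinearMap.smul_apply,
      inner_smul_left, inner_smul_right, map_ofNat] at h
    exact mul_left_cancel₀ (by norm_num) h
  nonneg := by
    intro p hp
    have h := isNonnegSymmetric_scaledGraph.nonneg _ hp
    simp only [LinearMap.prodMap_apply, LinearMap.id_apply, LinearMap.smul_apply,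
      inner_smul_right] at h
    have e : ((4 : ℂ) * ⟪p.1, p.2⟫_ℂ).re = 4 * (⟪p.1, p.2⟫_ℂ).re := by simp
    rw [e] at h
    linarith
  dense := by
    refine isNonnegSymmetric_scaledGraph.dense.mono ?_
    rintro _ ⟨p, hp, rfl⟩
    exact ⟨_, mem_scaledGraph_iff.1 hp, rfl⟩

lemma inFormDomain_scaledGraph_iff {ψ : StateSpace} :
    InFormDomain (scaledGraph : Set (StateSpace × StateSpace)) ψ ↔
      InFormDomain (hamiltonianGraph : Set (StateSpace × StateSpace)) ψ := by
  constructor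
  · rintro ⟨p, hp, h1, h2⟩
    refine ⟨fun n => ((p n).1, (4 : ℂ)⁻¹ • (p n).2), fun n => mem_scaledGraph_iff.1 (hp n), h1, ?_⟩
    simpa only [← smul_sub, inner_smul_right, mul_zero] using h2.const_mul (4 : ℂ)⁻¹
  · rintro ⟨p, hp, h1, h2⟩
    refine ⟨fun n => ((p n).1, (4 : ℂ) • (p n).2), fun n => hp n, h1, ?_⟩
    simpa only [← smul_sub, inner_smul_right, mul_zero] using h2.const_mul (4 : ℂ)

/-- The Friedrichs extension of `4 H` is four times the Friedrichs extension of `H`. -/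
lemma scaled_friedrichs_iff {ψ Φ : StateSpace} :
    (InFormDomain (hamiltonianGraph : Set (StateSpace × StateSpace)) ψ ∧
      ∀ p ∈ hamiltonianGraph, ⟪ψ, p.2⟫_ℂ = ⟪Φ, p.1⟫_ℂ) ↔
    (InFormDomain (scaledGraph : Set (StateSpace × StateSpace)) ψ ∧
      ∀ p ∈ scaledGraph, ⟪ψ, p.2⟫_ℂ = ⟪(4 : ℂ) • Φ, p.1⟫_ℂ) := by
  rw [inFormDomain_scaledGraph_iff]
  refine and_congr_right fun _ => ⟨fun h p hp => ?_, fun h p hp => ?_⟩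
  · have h1 := h _ (mem_scaledGraph_iff.1 hp)
    simp only [inner_smul_right] at h1
    rw [inner_smul_left, ← h1, map_ofNat, mul_inv_cancel_left₀ (by norm_num)]
  · have h1 := h _ (mem_hamiltonianGraph.1 hp)
    simp only [inner_smul_right, inner_smul_left, map_ofNat] at h1
    exact mul_left_cancel₀ (by norm_num) h1

end Main

end MatrixModel

end

/-! ### Assembly of the theorem -/

theorem theorem1 :
    -- in coordinates, `4 H = (p⁽¹⁾)² + (p⁽²⁾)² + (x⁽¹⁾ × x⁽²⁾)²`
    (∀ (f : MatrixModel.Config → ℂ) (x : MatrixModel.Config),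
      4 * MatrixModel.hamiltonian f x =
        (∑ i, ∑ a, MatrixModel.momentum (MatrixModel.direction i a)
          (MatrixModel.momentum (MatrixModel.direction i a) f) x)
        + (((x 0).ofLp ⨯₃ (x 1).ofLp) ⬝ᵥ ((x 0).ofLp ⨯₃ (x 1).ofLp) : ℝ) * f x) ∧
    -- both operators are self-adjoint, and `4 H` on singlets is unitarily equivalent to the model
    ∃ (H : MatrixModel.StateSpace →ₗ.[ℂ] MatrixModel.StateSpace)
      (M : MatrixModel.ModelSpace →ₗ.[ℂ] MatrixModel.ModelSpace),
      MatrixModel.IsFriedrichsExtension MatrixModel.hamiltonianCore H ∧ IsSelfAdjoint H ∧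
      MatrixModel.IsFriedrichsExtension MatrixModel.modelCore M ∧ IsSelfAdjoint M ∧
      ∃ W : MatrixModel.ModelSpace →ₗᵢ[ℂ] MatrixModel.StateSpace,
        Set.range W = {ψ | MatrixModel.IsSinglet ψ} ∧
        ∀ (ψ : MatrixModel.ModelSpace) (Φ : MatrixModel.StateSpace),
          (W ψ, Φ) ∈ H.graph ↔
            ∃ φ : MatrixModel.ModelSpace, (ψ, φ) ∈ M.graph ∧ (4 : ℂ) • Φ = W φ := by
  refine ⟨fun f x => MatrixModel.four_mul_hamiltonian f x, ?_⟩
  obtain ⟨H, hH, hHs⟩ :=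
    MatrixModel.exists_friedrichsExtension MatrixModel.isNonnegSymmetric_hamiltonianGraph
  obtain ⟨M, hM, hMs⟩ :=
    MatrixModel.exists_friedrichsExtension MatrixModel.isNonnegSymmetric_modelGraph
  refine ⟨H, M, MatrixModel.coe_hamiltonianGraph ▸ hH, hHs, hM, hMs, MatrixModel.modelIsometry,
    MatrixModel.range_modelIsometry, fun ψ Φ => ?_⟩
  rw [hH]
  -- The intertwining criterion compares with the core of `4 H`, so the factor `4` is first moved
  -- from the operator onto its value.
  refine MatrixModel.scaled_friedrichs_iff.trans ?_
  simp only [hM ψ]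
  exact MatrixModel.friedrichsExtension_intertwining MatrixModel.isNonnegSymmetric_scaledGraph
    MatrixModel.isNonnegSymmetric_modelGraph
    (fun _ hp => MatrixModel.modelIsometry_mem_scaledGraph hp)
    (fun _ hp => MatrixModel.inFormDomain_adjoint hp) ψ ((4 : ℂ) • Φ)
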